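/- Let $a,b,c:\mathbb R\to\mathbb R$ be smooth with $|a''|,|b''|,|c''|\ge\delta$ on $\mathbb R$ for some $\delta>0$ (hypothesis (H)), and let $m:\mathbb R^2\to\mathbb C$ be smooth and compactly supported. Write $\widehat f(\xi)=(2\pi)^{-1/2}\int e^{-ix\xi}f(x)\,dx$, let $a(D)$ be the Fourier multiplier with symbol $a(\xi)$ (similarly $b(D)$, $c(D)$), and put $$T_m(f,g)(x)=\int_{\mathbb R^2}e^{ix(\xi+\eta)}\,\widehat f(\xi)\,\widehat g(\eta)\,m(\xi,\eta)\,d\xi\,d\eta .$$ For $f,g\in L^2(\mathbb R)$ let $u,v,w\in C([0,\infty);L^2(\mathbb R))$ be the weak solution of $$i\partial_tu+a(D)u=T_m(v,w),\quad i\partial_tv+b(D)v=0,\quad i\partial_tw+c(D)w=0,\qquad u(0)=0,\ v(0)=f,\ w(0)=g,$$ where weak solutions are tested against the functions $\psi$ with $\widehat\psi\in C_c^\infty(\mathbb R)$. (1) There is a constant $C$, depending only on $a,b,c,m$, such that for all $q\in[2,\infty]$, all $f,g\in L^2(\mathbb R)$ and all $t\ge 0$, $$\|u(t)\|_{L^q(\mathbb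 R)}\le C\,t^{\frac12+\frac1{2q}}\,\|f\|_{L^2}\|g\|_{L^2}.$$ (2) Let $\phi(\xi,\eta)=-a(\xi+\eta)+b(\xi)+c(\eta)$, and suppose moreover that there are no time resonances, $\Gamma=\emptyset$, in the sense that $\phi$ has no zero on the (closed) support of $m$. Then for all $p,q\in[2,\infty)$ with $\frac1p+\frac1q<\frac12$ there is a constant $C$, depending only on $a,b,c,m,p,q$, such that for all $f,g\in L^2(\mathbb R)$, $$\|u\|_{L^p_tL^q_x((0,\infty)\times\mathbb R)}\le C\,\|f\|_{L^2}\|g\|_{L^2}.$$ -/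

import Mathlib

open MeasureTheory Set
open scoped ENNReal ContDiff FourierTransform ComplexConjugate

namespace Dispersive

noncomputable section

/-- The space `L²(ℝ; ℂ)`. -/
abbrev L2 : Type := Lp ℂ 2 (volume : Measure ℝ)

/-- The unitary Fourier transform of `f ∈ L²` with the convention
`f̂ ξ = (2π)^{-1/2} ∫ e^{-ixξ} f x dx` (extended to `L²` by Plancherel). Mathlib's `𝓕` uses the
kernel `e^{-2πixξ}`, hence the rescaling. -/
def fourierL2 (f : L2) (ξ : ℝ) : ℂ :=
  ((√(2 * Real.pi) : ℝ) : ℂ)⁻¹ * (𝓕 f : L2) (ξ / (2 * Real.pi))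

/-- The inverse Fourier transform `(2π)^{-1/2} ∫ e^{ixξ} χ ξ dξ` of an integrable function. -/
def invFourier (χ : ℝ → ℂ) (x : ℝ) : ℂ :=
  ((√(2 * Real.pi) : ℝ) : ℂ)⁻¹ * ∫ ξ : ℝ, Complex.exp (Complex.I * x * ξ) * χ ξ

/-- The bilinear Fourier multiplier
`T_m(f,g)(x) = ∫∫ e^{ix(ξ+η)} f̂(ξ) ĝ(η) m(ξ,η) dξ dη`.
The integral converges absolutely for `f, g ∈ L²` and `m` bounded with compact support. -/
def bilinearMultiplier (m : ℝ × ℝ → ℂ) (f g : L2) (x : ℝ) : ℂ :=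
  ∫ p : ℝ × ℝ, Complex.exp (Complex.I * x * (p.1 + p.2)) *
    fourierL2 f p.1 * fourierL2 g p.2 * m p

/-- The `L²` pairing `⟨h, ψ⟩ = ∫ h(x) conj ψ(x) dx`. -/
def pairing (h ψ : ℝ → ℂ) : ℂ := ∫ x : ℝ, h x * conj (ψ x)

/-- `u ∈ C([0,∞); L²)` is a weak solution on `[0,∞)` of `i ∂ₜ u + a(D) u = F` with `u(0) = u₀`,
where `a` is real valued. The test functions are the band-limited Schwartz functions
`ψ = 𝓕⁻¹ χ` with `χ` smooth and compactly supported; on these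
`a(D) ψ = 𝓕⁻¹ (a χ)` makes sense for every smooth `a`, and `a(D)` is moved to `ψ` by symmetry:
`i d/dt ⟨u(t), ψ⟩ + ⟨u(t), a(D) ψ⟩ = ⟨F(t), ψ⟩`. -/
structure IsWeakSolution (a : ℝ → ℝ) (F : ℝ → ℝ → ℂ) (u₀ : L2) (u : ℝ → L2) : Prop where
  continuousOn : ContinuousOn u (Ici 0)
  initial : u 0 = u₀
  equation : ∀ χ : ℝ → ℂ, ContDiff ℝ ∞ χ → HasCompactSupport χ → ∀ t : ℝ, 0 ≤ t →
    ∃ d : ℂ,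
      HasDerivWithinAt (fun s : ℝ => pairing (u s) (invFourier χ)) d (Ici 0) t ∧
      Complex.I * d + pairing (u t) (invFourier fun ξ => (a ξ : ℂ) * χ ξ) =
        pairing (F t) (invFourier χ)

/-- `(u, v, w)` solves, on `[0,∞)`, the system
`i ∂ₜ u + a(D) u = T_m(v, w)`, `i ∂ₜ v + b(D) v = 0`, `i ∂ₜ w + c(D) w = 0`
with `u(0) = 0`, `v(0) = f`, `w(0) = g`. -/
structure IsSolution (a b c : ℝ → ℝ) (m : ℝ × ℝ → ℂ) (f g : L2) (u v w : ℝ → L2) : Prop where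
  left : IsWeakSolution b (fun _ _ => 0) f v
  right : IsWeakSolution c (fun _ _ => 0) g w
  interaction : IsWeakSolution a (fun t => bilinearMultiplier m (v t) (w t)) 0 u

/-- The function `h` is bounded away from zero. -/
def BoundedAwayFromZero (h : ℝ → ℝ) : Prop := ∃ δ : ℝ, 0 < δ ∧ ∀ ξ : ℝ, δ ≤ |h ξ|

/-- The phase `φ(ξ,η) = -a(ξ+η) + b(ξ) + c(η)`. -/
def phase (a b c : ℝ → ℝ) (p : ℝ × ℝ) : ℝ := -a (p.1 + p.2) + b p.1 + c p.2

/-- The set of time resonances that are seen by the symbol `m`: the zeros of the phase `φ` on the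
(closed) support of `m`. -/
def timeResonances (a b c : ℝ → ℝ) (m : ℝ × ℝ → ℂ) : Set (ℝ × ℝ) :=
  {p | p ∈ tsupport m ∧ phase a b c p = 0}

/-- The mixed norm `‖u‖_{L^p_t L^q_x}` over times `t > 0`, for finite exponents `p, q`. -/
def mixedNorm (p q : ℝ) (u : ℝ → L2) : ℝ≥0∞ :=
  (∫⁻ t in Ioi (0 : ℝ), eLpNorm (u t) (ENNReal.ofReal q) volume ^ p) ^ (1 / p)

end

end Dispersive

namespace Dispersive

noncomputable section

/-! By Duhamel's formula, `u(t)` is the bilinear multiplier with symbol `m Φ_t` applied to the data,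
where `Φ_t = -i ∫₀ᵗ e^{i(t-s)a(ξ+η)} e^{is(b(ξ)+c(η))} ds` (`IsSolution.eq_bilinearExtension`).
Since `m` has compact support, the data may be cut off in frequency, so every Fourier integral
converges absolutely.

Two facts drive the growth bound. A smooth compactly supported symbol is an absolutely convergent
superposition of characters, so `T_m` is an average of products of translates, and Cauchy-Schwarz
gives `L² × L² → L¹`. Since `|a''| ≥ δ`, van der Corput's lemma shows that the frequency-localized
`e^{ita(D)}` maps `L¹` to `L^∞` with norm `O(|t|^{-1/2})`. Integrating `(t-s)^{-1/2}` over `[0,t]`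
gives `‖u(t)‖_∞ ≲ t^{1/2}`. For the energy, one writes `‖u(t)‖₂²` as the time integral of the
pairing of `T_m(v(s),w(s))`, bounded in `L¹`, with `e^{-i(t-s)a(D)}u(t)`. The latter is again
`O(t^{1/2})` in `L^∞`, because the kernel singularity merely moves inside `[0,t]`. Hence `‖u(t)‖₂ ≲
t^{3/4}`, and interpolation gives the exponent `1/2 + 1/(2q)`.

Without time resonances, `m/φ` is smooth and the time integral can be evaluated: `m Φ_t =
(m/φ)(e^{ita(ξ+η)} - e^{it(b(ξ)+c(η))})`. Both terms are bounded in `L²` uniformly in time, so by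
interpolation it suffices to bound their sup norms in `L^r_t` with `r = p(1-2/q)`, and `r > 2` is
exactly `1/p + 1/q < 1/2`. The first sup norm is `O(min(1, t^{-1/2}))`. The second is at most a
constant times the product of the sup norms of the two localized free waves, each in `L^{2r}_t` with
`2r > 4`. That is the nonendpoint Strichartz estimate `exists_tsum_packetSup_rpow_le`, proved by a
weak-type `TT*` argument on unit time intervals. -/

/-! ### Fourier integrals, Plancherel and band-limited test functions -/

theorem continuous_fourierInv {F : ℝ → ℂ} (hF : Integrable F) : Continuous (𝓕⁻ F) := by
  rw [Real.fourierInv_eq_fourier_comp_neg]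
  exact VectorFourier.fourierIntegral_continuous Real.continuous_fourierChar
    (by exact continuous_inner) hF.comp_neg

/-- On `L¹ ∩ L²` the inverse `L²` Fourier transform is given by the Fourier integral. -/
theorem coeFn_fourierInv_toLp {F : ℝ → ℂ} (hF : Integrable F) (hF2 : MemLp F 2) :
    ((𝓕⁻ (hF2.toLp F) : L2) : ℝ → ℂ) =ᵐ[volume] 𝓕⁻ F := by
  refine ae_eq_of_integral_contDiff_smul_eq
    ((Lp.memLp _).locallyIntegrable (by norm_num)) (continuous_fourierInv hF).locallyIntegrable ?_
  intro g hg hgs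
  let gS : SchwartzMap ℝ ℂ := (hgs.comp_left (g := fun r : ℝ => (r : ℂ)) (by simp)).toSchwartzMap
    (Complex.ofRealCLM.contDiff.comp hg)
  have hgS : ∀ x, gS x = (g x : ℂ) := fun x => rfl
  have h := congrArg (fun T => T gS) (Lp.fourierInv_toTemperedDistribution_eq (hF2.toLp F))
  simp only [TemperedDistribution.fourierInv_apply, Lp.toTemperedDistribution_apply] at h
  have hflip : ∫ x, (𝓕 gS) x • F (-x) = ∫ x, gS x • 𝓕 (fun y => F (-y)) x := by
    simpa [SchwartzMap.fourier_coe] using! (VectorFourier.integral_fourierIntegral_smul_eq_flip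
      (L := innerₗ ℝ) Real.continuous_fourierChar (by exact continuous_inner) gS.integrable
      hF.comp_neg)
  calc ∫ x, g x • (𝓕⁻ (hF2.toLp F) : L2) x = ∫ x, gS x • (𝓕⁻ (hF2.toLp F) : L2) x := by
        simp [hgS]
    _ = ∫ x, (𝓕⁻ gS) x • (hF2.toLp F) x := h.symm
    _ = ∫ x, (𝓕⁻ gS) x • F x := by
        refine integral_congr_ae ?_
        filter_upwards [hF2.coeFn_toLp] with x hx
        rw [hx]
    _ = ∫ x, (𝓕 gS) x • F (-x) := by
        rw [← integral_neg_eq_self]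
        simp [SchwartzMap.fourier_coe, SchwartzMap.fourierInv_coe, Real.fourierInv_eq_fourier_neg]
    _ = ∫ x, g x • 𝓕⁻ F x := by
        rw [hflip, Real.fourierInv_eq_fourier_comp_neg]; simp [hgS]

theorem memLp_fourierInv {F : ℝ → ℂ} (hF : Integrable F) (hF2 : MemLp F 2) :
    MemLp (𝓕⁻ F) 2 :=
  (memLp_congr_ae (coeFn_fourierInv_toLp hF hF2)).1 (Lp.memLp _)

theorem integral_mul_conj_eq_inner {F G : ℝ → ℂ} (f g : L2) (hF : F =ᵐ[volume] f)
    (hG : G =ᵐ[volume] g) : ∫ x, F x * conj (G x) = inner ℂ g f := by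
  rw [L2.inner_def]
  refine integral_congr_ae ?_
  filter_upwards [hF, hG] with x h1 h2
  rw [h1, h2]; rfl

/-- Parseval's identity on `L¹ ∩ L²`. -/
theorem integral_fourierInv_mul_conj {F G : ℝ → ℂ} (hF : Integrable F) (hF2 : MemLp F 2)
    (hG : Integrable G) (hG2 : MemLp G 2) :
    ∫ x, 𝓕⁻ F x * conj (𝓕⁻ G x) = ∫ x, F x * conj (G x) := by
  rw [integral_mul_conj_eq_inner (𝓕⁻ (hF2.toLp F)) (𝓕⁻ (hG2.toLp G))
    (coeFn_fourierInv_toLp hF hF2).symm (coeFn_fourierInv_toLp hG hG2).symm,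
    integral_mul_conj_eq_inner (hF2.toLp F) (hG2.toLp G) hF2.coeFn_toLp.symm hG2.coeFn_toLp.symm]
  exact (Lp.fourierTransformₗᵢ ℝ ℂ).symm.inner_map_map _ _

/-- The Fourier integral `∫ e^{ixξ} F ξ dξ`. -/
def fourierExtension (F : ℝ → ℂ) (x : ℝ) : ℂ :=
  ∫ ξ : ℝ, Complex.exp (Complex.I * x * ξ) * F ξ

theorem fourierExtension_eq (F : ℝ → ℂ) (x : ℝ) :
    fourierExtension F x = 𝓕⁻ F (x / (2 * Real.pi)) := by
  rw [Real.fourierInv_eq', fourierExtension]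
  refine integral_congr_ae (.of_forall fun ξ => ?_)
  simp only [smul_eq_mul, RCLike.inner_apply, conj_trivial]
  congr 2
  push_cast
  field_simp

theorem invFourier_eq (F : ℝ → ℂ) (x : ℝ) :
    invFourier F x = ((√(2 * Real.pi) : ℝ) : ℂ)⁻¹ * fourierExtension F x := rfl

theorem continuous_fourierExtension {F : ℝ → ℂ} (hF : Integrable F) :
    Continuous (fourierExtension F) := by
  rw [show fourierExtension F = fun x => 𝓕⁻ F (x / (2 * Real.pi)) from
    funext (fourierExtension_eq F)]
  exact (continuous_fourierInv hF).comp (by fun_prop)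

theorem integral_comp_div_two_pi (h : ℝ → ℂ) :
    ∫ x, h (x / (2 * Real.pi)) = (2 * Real.pi : ℝ) * ∫ x, h x := by
  rw [Measure.integral_comp_div, abs_of_pos Real.two_pi_pos]; simp

theorem memLp_comp_mul {F : ℝ → ℂ} {r : ℝ} (hr : r ≠ 0) {p : ℝ≥0∞} (hF : MemLp F p) :
    MemLp (fun x => F (r * x)) p := by
  have h1 : (Measure.map (fun x : ℝ => r * x) volume) = ENNReal.ofReal |r⁻¹| • volume :=
    Real.map_volume_mul_left hr
  have h2 : MemLp F p (Measure.map (fun x : ℝ => r * x) volume) := by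
    rw [h1]; exact hF.smul_measure (by simp)
  exact h2.comp_of_map (by fun_prop)

theorem memLp_fourierExtension {F : ℝ → ℂ} (hF : Integrable F) (hF2 : MemLp F 2) :
    MemLp (fourierExtension F) 2 := by
  refine (memLp_comp_mul (r := (2 * Real.pi)⁻¹) (by simp [Real.pi_ne_zero])
    (memLp_fourierInv hF hF2)).ae_eq (.of_forall fun x => ?_)
  rw [fourierExtension_eq, div_eq_inv_mul]

theorem integral_fourierExtension_mul_conj {F G : ℝ → ℂ} (hF : Integrable F) (hF2 : MemLp F 2)
    (hG : Integrable G) (hG2 : MemLp G 2) :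
    ∫ x, fourierExtension F x * conj (fourierExtension G x) =
      (2 * Real.pi : ℝ) * ∫ x, F x * conj (G x) := by
  rw [← integral_fourierInv_mul_conj hF hF2 hG hG2, ← integral_comp_div_two_pi]
  simp only [fourierExtension_eq]

theorem integral_norm_sq_eq {F : ℝ → ℂ} :
    ((∫ x, ‖F x‖ ^ 2 : ℝ) : ℂ) = ∫ x, F x * conj (F x) := by
  rw [← integral_complex_ofReal]
  refine integral_congr_ae (.of_forall fun x => ?_)
  simp [Complex.mul_conj, Complex.normSq_eq_norm_sq]

theorem integral_norm_sq_fourierExtension {F : ℝ → ℂ} (hF : Integrable F) (hF2 : MemLp F 2) :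
    ∫ x, ‖fourierExtension F x‖ ^ 2 = 2 * Real.pi * ∫ x, ‖F x‖ ^ 2 := by
  have := integral_fourierExtension_mul_conj hF hF2 hF hF2
  rw [← integral_norm_sq_eq, ← integral_norm_sq_eq] at this
  exact_mod_cast this

theorem memLp_fourierL2 (h : L2) : MemLp (fourierL2 h) 2 := by
  have := memLp_comp_mul (r := (2 * Real.pi)⁻¹) (by simp [Real.pi_ne_zero]) (Lp.memLp (𝓕 h : L2))
  refine (this.const_mul (((√(2 * Real.pi) : ℝ) : ℂ)⁻¹)).ae_eq (.of_forall fun x => ?_)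
  simp only [fourierL2, div_eq_inv_mul]

/-- Plancherel for the rescaled convention: the square of the prefactor `(2π)^{-1/2}` cancels the
Jacobian `2π` of the dilation. -/
theorem integral_fourierL2_mul_conj (h k : L2) :
    ∫ ξ, fourierL2 h ξ * conj (fourierL2 k ξ) = inner ℂ k h := by
  have h2 : (((√(2 * Real.pi) : ℝ) : ℂ)⁻¹) * (((√(2 * Real.pi) : ℝ) : ℂ)⁻¹) *
      ((2 * Real.pi : ℝ) : ℂ) = 1 := by
    have : √(2 * Real.pi) * √(2 * Real.pi) = 2 * Real.pi := Real.mul_self_sqrt (by positivity)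
    rw [← mul_inv, ← Complex.ofReal_mul, this]
    exact inv_mul_cancel₀ (by exact_mod_cast Real.two_pi_pos.ne')
  rw [← Lp.inner_fourier_eq, ← integral_mul_conj_eq_inner (𝓕 h) (𝓕 k) .rfl .rfl,
    ← one_mul (∫ x, (𝓕 h : L2) x * conj ((𝓕 k : L2) x)), ← h2, mul_assoc _ _ (∫ x, _),
    ← integral_comp_div_two_pi (fun x => (𝓕 h : L2) x * conj ((𝓕 k : L2) x)),
    ← integral_const_mul]
  refine integral_congr_ae (.of_forall fun x => ?_)
  simp only [fourierL2, map_mul, map_inv₀, Complex.conj_ofReal]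
  ring

theorem integral_norm_sq_fourierL2 (h : L2) : ∫ ξ, ‖fourierL2 h ξ‖ ^ 2 = ‖h‖ ^ 2 := by
  have h1 := integral_fourierL2_mul_conj h h
  rw [← integral_norm_sq_eq, inner_self_eq_norm_sq_to_K] at h1
  exact Complex.ofReal_injective (by rw [h1]; simp)


theorem memLp_invFourier {χ : ℝ → ℂ} (h1 : Integrable χ) (h2 : MemLp χ 2) :
    MemLp (invFourier χ) 2 :=
  (memLp_fourierExtension h1 h2).const_mul _

theorem fourierL2_toLp_invFourier {χ : ℝ → ℂ} (h1 : Integrable χ) (h2 : MemLp χ 2) :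
    fourierL2 ((memLp_invFourier h1 h2).toLp) =ᵐ[volume] χ := by
  have hpi : (2 * Real.pi) ≠ 0 := Real.two_pi_pos.ne'
  have hs : ((√(2 * Real.pi) : ℝ) : ℂ) ≠ 0 := by
    simp [Real.sqrt_eq_zero', Real.pi_pos]
  have hss : ((√(2 * Real.pi) : ℝ) : ℂ) * ((√(2 * Real.pi) : ℝ) : ℂ) = 2 * Real.pi := by
    rw [← Complex.ofReal_mul, Real.mul_self_sqrt (by positivity)]; push_cast; rfl
  -- The dilate of `χ` for which `𝓕⁻ X` is `invFourier χ` exactly; inverting `𝓕⁻` then recovers `χ`.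
  let X : ℝ → ℂ := fun η => ((√(2 * Real.pi) : ℝ) : ℂ) * χ (2 * Real.pi * η)
  have hX1 : Integrable X := (h1.comp_mul_left' hpi).const_mul _
  have hX2 : MemLp X 2 := (memLp_comp_mul hpi h2).const_mul _
  have hinv : ∀ x, 𝓕⁻ X x = invFourier χ x := by
    intro x
    rw [invFourier_eq, fourierExtension, Real.fourierInv_eq']
    have := Measure.integral_comp_mul_left
      (fun ξ => Complex.exp (Complex.I * x * ξ) * χ ξ) (2 * Real.pi)
    rw [abs_of_pos (by positivity)] at this
    have h3 : ∫ ξ : ℝ, Complex.exp (Complex.I * x * ξ) * χ ξ = (2 * Real.pi : ℂ) *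
        ∫ η : ℝ, Complex.exp (Complex.I * x * ((2 * Real.pi * η : ℝ) : ℂ)) * χ (2 * Real.pi * η) := by
      rw [this, Complex.real_smul, ← mul_assoc]
      push_cast
      rw [mul_inv_cancel₀ (by exact_mod_cast hpi), one_mul]
    rw [h3, ← mul_assoc, ← hss, inv_mul_cancel_left₀ hs, ← integral_const_mul]
    refine integral_congr_ae (.of_forall fun η => ?_)
    simp only [smul_eq_mul, RCLike.inner_apply, conj_trivial, X]
    push_cast
    ring_nf
  have hk : (memLp_invFourier h1 h2).toLp = 𝓕⁻ (hX2.toLp X) := by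
    ext1
    filter_upwards [(memLp_invFourier h1 h2).coeFn_toLp, coeFn_fourierInv_toLp hX1 hX2] with x e1 e2
    rw [e1, e2, hinv]
  have hq : Measure.QuasiMeasurePreserving (fun ξ : ℝ => ξ / (2 * Real.pi)) volume volume := by
    refine ⟨by fun_prop, ?_⟩
    simp_rw [div_eq_inv_mul]
    rw [Real.map_volume_mul_left (inv_ne_zero hpi)]
    exact Measure.smul_absolutelyContinuous
  filter_upwards [hq.ae hX2.coeFn_toLp] with ξ e1
  rw [fourierL2, hk, FourierTransform.fourier_fourierInv_eq, e1]
  simp only [X]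
  rw [inv_mul_cancel_left₀ hs, mul_div_cancel₀ _ hpi]

/-- Moves the weak formulation to the Fourier side, where `a(D)` and its propagator are
multiplication operators. -/
theorem pairing_invFourier (h : L2) {χ : ℝ → ℂ} (h1 : Integrable χ) (h2 : MemLp χ 2) :
    pairing h (invFourier χ) = ∫ ξ, fourierL2 h ξ * conj (χ ξ) := by
  rw [pairing, integral_mul_conj_eq_inner h ((memLp_invFourier h1 h2).toLp) .rfl
    (memLp_invFourier h1 h2).coeFn_toLp.symm, ← integral_fourierL2_mul_conj]
  refine integral_congr_ae ?_
  filter_upwards [fourierL2_toLp_invFourier h1 h2] with x hx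
  rw [hx]

/-- Injectivity through Plancherel: all four inner products in the expansion of `‖h - k‖²` equal `∫
|R|²`, so they cancel. -/
theorem eq_invFourier_of_fourierL2_eq {h : L2} {R : ℝ → ℂ} (h1 : Integrable R) (h2 : MemLp R 2)
    (hR : fourierL2 h =ᵐ[volume] R) : h =ᵐ[volume] invFourier R := by
  set k : L2 := (memLp_invFourier h1 h2).toLp with hk
  have hkR := fourierL2_toLp_invFourier h1 h2
  have e : ∀ a b : L2, fourierL2 a =ᵐ[volume] R → fourierL2 b =ᵐ[volume] R →
      inner ℂ b a = ∫ x, R x * conj (R x) := by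
    intro a b ha hb
    rw [← integral_fourierL2_mul_conj]
    refine integral_congr_ae ?_
    filter_upwards [ha, hb] with x h3 h4
    rw [h3, h4]
  have : inner ℂ (h - k) (h - k) = 0 := by
    rw [inner_sub_left, inner_sub_right, inner_sub_right, e h h hR hR, e h k hR hkR,
      e k h hkR hR, e k k hkR hkR]
    ring
  rw [inner_self_eq_zero, sub_eq_zero] at this
  rw [this]
  exact (memLp_invFourier h1 h2).coeFn_toLp

/-! ### Van der Corput's lemma and dispersive decay -/

/-- Van der Corput's second derivative estimate with an amplitude, for a convex phase. -/
theorem norm_integral_exp_mul_le_of_le_deriv2 {ψ ψ' ψ'' : ℝ → ℝ} (h1 : ∀ x, HasDerivAt ψ (ψ' x) x)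
    (h2 : ∀ x, HasDerivAt ψ' (ψ'' x) x) (hcont : Continuous ψ'') {l : ℝ} (hl : 0 < l)
    (h : ∀ x, l ≤ ψ'' x) {χ χ' : ℝ → ℂ} (hχ : ∀ x, HasDerivAt χ (χ' x) x) (hχ' : Continuous χ')
    {r B B' : ℝ} (hr : 0 ≤ r) (hsupp : ∀ x, r ≤ |x| → χ x = 0) (hB : ∀ x, ‖χ x‖ ≤ B)
    (hB' : ∀ x, ‖χ' x‖ ≤ B') :
    ‖∫ x, Complex.exp (Complex.I * ψ x) * χ x‖ ≤ (2 * Real.pi * B + r * B') / √l := by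
  have hB0 : 0 ≤ B := (norm_nonneg _).trans (hB 0)
  have cψ : Continuous ψ := continuous_iff_continuousAt.2 fun x => (h1 x).continuousAt
  have cψ' : Continuous ψ' := continuous_iff_continuousAt.2 fun x => (h2 x).continuousAt
  have cχ : Continuous χ := continuous_iff_continuousAt.2 fun x => (hχ x).continuousAt
  have hsl : 0 < √l := Real.sqrt_pos.2 hl
  have hsq : √l ^ 2 = l := Real.sq_sqrt hl.le
  -- Integration by parts would use `1/ψ'`, which blows up at a stationary point. The regularization
  -- `γ = ψ'/(l + ψ'²)` is global and at most `1/(2√l)`, and its defect `1 - ψ'γ = l/D` is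
  -- controlled by `ψ''/D`. No splitting near the stationary point is needed.
  set D : ℝ → ℝ := fun x => l + ψ' x ^ 2 with hD
  have hDpos : ∀ x, 0 < D x := fun x => by positivity
  have cD : Continuous D := by fun_prop
  have hDd : ∀ x, HasDerivAt D (2 * ψ' x * ψ'' x) x := fun x => by
    simpa [hD] using ((h2 x).pow 2).const_add l
  set γ : ℝ → ℝ := fun x => ψ' x / D x with hγ
  have hγd : ∀ x, HasDerivAt γ (ψ'' x * (l - ψ' x ^ 2) / D x ^ 2) x := fun x => by
    refine ((h2 x).div (hDd x) (hDpos x).ne').congr_deriv ?_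
    simp only [hD]; ring
  have hγb : ∀ x, |γ x| ≤ 1 / (2 * √l) := fun x => by
    rw [hγ, abs_div, abs_of_pos (hDpos x), div_le_div_iff₀ (hDpos x) (by positivity)]
    have : 0 ≤ (|ψ' x| - √l) ^ 2 := sq_nonneg _
    simp only [hD]
    nlinarith [sq_abs (ψ' x)]
  set E : ℝ → ℂ := fun x => Complex.exp (Complex.I * ψ x) with hE
  have hEn : ∀ x, ‖E x‖ = 1 := fun x => by
    rw [hE]; simp only; rw [mul_comm, Complex.norm_exp_ofReal_mul_I]
  have hEd : ∀ x, HasDerivAt E (E x * (Complex.I * ψ' x)) x := fun x =>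
    ((h1 x).ofReal_comp.const_mul Complex.I).cexp
  set rest : ℝ → ℂ := fun x => E x * ((l / D x : ℝ) * χ x +
    Complex.I * (ψ'' x * (l - ψ' x ^ 2) / D x ^ 2 : ℝ) * χ x + Complex.I * γ x * χ' x) with hrest
  have hG : ∀ x, HasDerivAt (fun x => E x * (-Complex.I * γ x) * χ x) (E x * χ x - rest x) x := by
    intro x
    refine (((hEd x).mul ((hγd x).ofReal_comp.const_mul (-Complex.I))).mul (hχ x)).congr_deriv ?_
    have h3 : (ψ' x : ℂ) * γ x = 1 - (l / D x : ℝ) := by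
      have : ψ' x * γ x = 1 - l / D x := by
        have := (hDpos x).ne'
        simp only [hγ]
        field_simp
        simp only [hD]; ring
      exact_mod_cast this
    have hI : Complex.I * Complex.I = -1 := Complex.I_mul_I
    simp only [hrest, Pi.mul_apply]
    linear_combination (-E x * χ x * (ψ' x : ℂ) * γ x) * hI + E x * χ x * h3
  have cγ : Continuous γ := by
    simp only [hγ]; exact cψ'.div cD fun x => (hDpos x).ne'
  have crest : Continuous rest := by
    simp only [hrest]
    have c1 : Continuous fun x => l / D x := continuous_const.div cD fun x => (hDpos x).ne'
    have c2 : Continuous fun x => ψ'' x * (l - ψ' x ^ 2) / D x ^ 2 :=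
      Continuous.div (by fun_prop) (by fun_prop) fun x => (pow_pos (hDpos x) 2).ne'
    fun_prop
  have hrr : -r ≤ r := by linarith
  have hint : ∫ x in (-r)..r, (E x * χ x - rest x) = 0 := by
    rw [intervalIntegral.integral_eq_sub_of_hasDerivAt (fun x _ => hG x)
      (Continuous.intervalIntegrable (by fun_prop) _ _)]
    simp [hsupp r (le_abs_self r), hsupp (-r) (by rw [abs_neg]; exact le_abs_self r)]
  rw [intervalIntegral.integral_sub (Continuous.intervalIntegrable (by fun_prop) _ _)
    (Continuous.intervalIntegrable (by fun_prop) _ _), sub_eq_zero] at hint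
  have hfull : ∫ x, E x * χ x = ∫ x in (-r)..r, E x * χ x := by
    refine (intervalIntegral.integral_eq_integral_of_support_subset fun x hx => ?_).symm
    by_contra hx'
    refine hx ?_
    have : r ≤ |x| := by
      by_contra hlt
      rw [not_le, abs_lt] at hlt
      exact hx' ⟨hlt.1, hlt.2.le⟩
    simp [hsupp x this]
  rw [hfull, hint]
  -- The majorant `ψ''/D` is an exact derivative of total variation at most `π/√l`, whatever the
  -- size of `ψ''`.
  have harc : ∀ x, HasDerivAt (fun x => Real.arctan (ψ' x / √l) / √l) (ψ'' x / D x) x := by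
    intro x
    refine ((((h2 x).div_const (√l)).arctan).div_const (√l)).congr_deriv ?_
    have := (hDpos x).ne'
    simp only [hD] at this ⊢
    rw [div_pow, hsq]
    field_simp
    rw [hsq]
    ring
  have cq : Continuous fun x => ψ'' x / D x := hcont.div cD fun x => (hDpos x).ne'
  have hbound : ∀ x, ‖rest x‖ ≤ 2 * B * (ψ'' x / D x) + B' / (2 * √l) := by
    intro x
    simp only [hrest]
    rw [norm_mul, hEn, one_mul]
    have hp : 0 < ψ'' x := hl.trans_le (h x)
    have t1 : ‖((l / D x : ℝ) : ℂ) * χ x‖ ≤ (ψ'' x / D x) * B := by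
      rw [norm_mul, Complex.norm_real, Real.norm_of_nonneg (div_nonneg hl.le (hDpos x).le)]
      exact mul_le_mul (div_le_div_of_nonneg_right (h x) (hDpos x).le) (hB x) (norm_nonneg _)
        (div_nonneg hp.le (hDpos x).le)
    have t2 : ‖Complex.I * (ψ'' x * (l - ψ' x ^ 2) / D x ^ 2 : ℝ) * χ x‖ ≤ (ψ'' x / D x) * B := by
      rw [norm_mul, norm_mul, Complex.norm_I, one_mul, Complex.norm_real, Real.norm_eq_abs]
      refine mul_le_mul ?_ (hB x) (norm_nonneg _) (div_nonneg hp.le (hDpos x).le)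
      rw [abs_div, abs_mul, abs_of_pos hp, abs_of_pos (pow_pos (hDpos x) 2), div_le_div_iff₀
        (pow_pos (hDpos x) 2) (hDpos x)]
      have h5 : |l - ψ' x ^ 2| ≤ D x := by
        rw [abs_le]; simp only [hD]; constructor <;> nlinarith [sq_nonneg (ψ' x)]
      nlinarith [mul_le_mul_of_nonneg_left h5 (mul_pos hp (hDpos x)).le]
    have t3 : ‖Complex.I * γ x * χ' x‖ ≤ B' / (2 * √l) := by
      rw [norm_mul, norm_mul, Complex.norm_I, one_mul, Complex.norm_real, Real.norm_eq_abs]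
      calc |γ x| * ‖χ' x‖ ≤ 1 / (2 * √l) * B' :=
            mul_le_mul (hγb x) (hB' x) (norm_nonneg _) (by positivity)
        _ = _ := by ring
    calc _ ≤ _ := norm_add₃_le
      _ ≤ _ := add_le_add_three t1 t2 t3
      _ = _ := by ring
  calc ‖∫ x in (-r)..r, rest x‖ ≤ ∫ x in (-r)..r, (2 * B * (ψ'' x / D x) + B' / (2 * √l)) :=
        intervalIntegral.norm_integral_le_of_norm_le hrr (.of_forall fun x _ => hbound x)
          (Continuous.intervalIntegrable (by fun_prop) _ _)
    _ = 2 * B * (Real.arctan (ψ' r / √l) / √l - Real.arctan (ψ' (-r) / √l) / √l) +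
        2 * r * (B' / (2 * √l)) := by
      rw [intervalIntegral.integral_add (Continuous.intervalIntegrable (by fun_prop) _ _)
        (by simp), intervalIntegral.integral_const_mul,
        intervalIntegral.integral_eq_sub_of_hasDerivAt (fun x _ => harc x)
          (cq.intervalIntegrable _ _), intervalIntegral.integral_const]
      simp only [smul_eq_mul]; ring
    _ ≤ _ := by
      have a1 := Real.arctan_lt_pi_div_two (ψ' r / √l)
      have a2 := Real.neg_pi_div_two_lt_arctan (ψ' (-r) / √l)
      have : Real.arctan (ψ' r / √l) / √l - Real.arctan (ψ' (-r) / √l) / √l ≤ Real.pi / √l := by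
        rw [← sub_div]
        exact div_le_div_of_nonneg_right (by linarith) hsl.le
      calc _ ≤ 2 * B * (Real.pi / √l) + 2 * r * (B' / (2 * √l)) := by gcongr
        _ = _ := by field_simp

/-- Intermediate value theorem: a sign change would force a zero. -/
theorem forall_le_or_forall_le_neg {h : ℝ → ℝ} (hc : Continuous h) {δ : ℝ} (hδ : 0 < δ)
    (hb : ∀ x, δ ≤ |h x|) : (∀ x, δ ≤ h x) ∨ (∀ x, h x ≤ -δ) := by
  by_contra hcon
  push Not at hcon
  obtain ⟨⟨x, hx⟩, ⟨y, hy⟩⟩ := hcon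
  have hx' : h x ≤ 0 := by
    rcases le_abs.1 (hb x) with h1 | h1 <;> linarith
  have hy' : 0 ≤ h y := by
    rcases le_abs.1 (hb y) with h1 | h1 <;> linarith
  obtain ⟨z, hz⟩ := mem_range_of_exists_le_of_exists_ge hc ⟨x, hx'⟩ ⟨y, hy'⟩
  have := hb z
  rw [hz, abs_zero] at this
  linarith

/-- The second derivative has a constant sign, and complex conjugation exchanges concave and convex
phases. -/
theorem norm_integral_exp_mul_le {ψ ψ' ψ'' : ℝ → ℝ} (h1 : ∀ x, HasDerivAt ψ (ψ' x) x)
    (h2 : ∀ x, HasDerivAt ψ' (ψ'' x) x) (hcont : Continuous ψ'') {l : ℝ} (hl : 0 < l)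
    (h : ∀ x, l ≤ |ψ'' x|) {χ χ' : ℝ → ℂ} (hχ : ∀ x, HasDerivAt χ (χ' x) x) (hχ' : Continuous χ')
    {r B B' : ℝ} (hr : 0 ≤ r) (hsupp : ∀ x, r ≤ |x| → χ x = 0) (hB : ∀ x, ‖χ x‖ ≤ B)
    (hB' : ∀ x, ‖χ' x‖ ≤ B') :
    ‖∫ x, Complex.exp (Complex.I * ψ x) * χ x‖ ≤ (2 * Real.pi * B + r * B') / √l := by
  rcases forall_le_or_forall_le_neg hcont hl h with hp | hn
  · exact norm_integral_exp_mul_le_of_le_deriv2 h1 h2 hcont hl hp hχ hχ' hr hsupp hB hB'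
  · have := norm_integral_exp_mul_le_of_le_deriv2 (ψ := fun x => -ψ x) (ψ' := fun x => -ψ' x)
      (ψ'' := fun x => -ψ'' x) (χ := fun x => conj (χ x)) (χ' := fun x => conj (χ' x))
      (fun x => (h1 x).neg) (fun x => (h2 x).neg) hcont.neg hl
      (fun x => by linarith [hn x]) (fun x => (hχ x).star_conj) (by fun_prop) hr
      (fun x hx => by simp [hsupp x hx]) (by simpa using hB) (by simpa using hB')
    rw [← RCLike.norm_conj, ← integral_conj]
    refine le_trans (le_of_eq ?_) this
    congr 1
    refine integral_congr_ae (.of_forall fun x => ?_)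
    simp [← Complex.exp_conj]

/-- Decay of the localized linear propagator. -/
theorem exists_norm_fourierExtension_exp_mul_le {a : ℝ → ℝ} (ha : ContDiff ℝ ∞ a)
    (ha2 : BoundedAwayFromZero (iteratedDeriv 2 a)) {χ : ℝ → ℂ} (hχ : ContDiff ℝ ∞ χ)
    (hs : HasCompactSupport χ) :
    ∃ C : ℝ, 0 ≤ C ∧ ∀ x t : ℝ, t ≠ 0 →
      ‖fourierExtension (fun ξ => Complex.exp (Complex.I * t * a ξ) * χ ξ) x‖ ≤ C / √|t| := by
  obtain ⟨δ, hδ, hd⟩ := ha2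
  obtain ⟨r, hr, hrs⟩ : ∃ r : ℝ, 0 ≤ r ∧ ∀ x, r ≤ |x| → χ x = 0 := by
    obtain ⟨r, hr⟩ := hs.isBounded.subset_ball 0
    refine ⟨max r 0, le_max_right _ _, fun x hx => image_eq_zero_of_notMem_tsupport fun hx' => ?_⟩
    have := hr hx'
    rw [mem_ball_zero_iff, Real.norm_eq_abs] at this
    exact absurd ((le_max_left r 0).trans hx) (not_le.2 this)
  have cχ' : Continuous (deriv χ) := hχ.continuous_deriv (by simp)
  obtain ⟨B, hB⟩ := hs.exists_bound_of_continuous hχ.continuous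
  obtain ⟨B', hB'⟩ := hs.deriv.exists_bound_of_continuous cχ'
  have hB0 : 0 ≤ B := (norm_nonneg _).trans (hB 0)
  have hB0' : 0 ≤ B' := (norm_nonneg _).trans (hB' 0)
  refine ⟨(2 * Real.pi * B + r * B') / √δ, by positivity, fun x t ht => ?_⟩
  have e2 : iteratedDeriv 2 a = deriv (deriv a) := by
    rw [iteratedDeriv_succ, iteratedDeriv_one]
  have ha1 : ContDiff ℝ ∞ (deriv a) := by
    exact (contDiff_infty_iff_deriv.1 ha).2
  have hda : ∀ ξ, HasDerivAt a (deriv a ξ) ξ := fun ξ =>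
    (ha.differentiable (by simp) ξ).hasDerivAt
  have hda' : ∀ ξ, HasDerivAt (deriv a) (deriv (deriv a) ξ) ξ := fun ξ =>
    (ha1.differentiable (by simp) ξ).hasDerivAt
  -- The position `x` enters the phase linearly and drops out of the second derivative, so the bound
  -- is uniform in `x`.
  have key := norm_integral_exp_mul_le (ψ := fun ξ => x * ξ + t * a ξ)
    (ψ' := fun ξ => x * 1 + t * deriv a ξ) (ψ'' := fun ξ => t * deriv (deriv a) ξ)
    (l := |t| * δ) (χ := χ) (χ' := deriv χ)
    (fun ξ => ((hasDerivAt_id ξ).const_mul x).add ((hda ξ).const_mul t))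
    (fun ξ => ((hda' ξ).const_mul t).const_add _)
    (continuous_const.mul (ha1.continuous_deriv (by simp))) (by positivity)
    (fun ξ => by
      rw [abs_mul]
      exact mul_le_mul_of_nonneg_left (by rw [← e2]; exact hd ξ) (abs_nonneg t))
    (fun ξ => (hχ.differentiable (by simp) ξ).hasDerivAt) cχ' hr hrs hB hB'
  rw [div_div, ← Real.sqrt_mul hδ.le, mul_comm δ]
  refine le_trans (le_of_eq ?_) key
  rw [fourierExtension]
  congr 1
  refine integral_congr_ae (.of_forall fun ξ => ?_)
  simp only
  rw [← mul_assoc, ← Complex.exp_add]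
  push_cast
  ring_nf

/-! ### Bilinear extensions: densities in the output frequency and superpositions of translates -/

/-- A smooth compactly supported symbol is an absolutely convergent superposition of characters. -/
theorem exists_superposition {m : ℝ × ℝ → ℂ} (hm : ContDiff ℝ ∞ m) (hs : HasCompactSupport m) :
    ∃ (M : EuclideanSpace ℝ (Fin 2) → ℂ) (y z : EuclideanSpace ℝ (Fin 2) → ℝ), Integrable M ∧
      Continuous y ∧ Continuous z ∧
      ∀ p, m p = ∫ q, Complex.exp (Complex.I * (y q * p.1 + z q * p.2)) * M q := by
  -- The product carries the sup norm, so the Fourier transform is taken on Euclidean space. The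
  -- weight `M` is the transform of `m`, integrable because it is Schwartz.
  let L : EuclideanSpace ℝ (Fin 2) ≃L[ℝ] ℝ × ℝ :=
    (EuclideanSpace.equiv (Fin 2) ℝ).trans (ContinuousLinearEquiv.finTwoArrow ℝ ℝ)
  let S : SchwartzMap (EuclideanSpace ℝ (Fin 2)) ℂ :=
    (hs.comp_homeomorph L.toHomeomorph).toSchwartzMap (hm.comp L.contDiff)
  have hS : ∀ v, S v = m (v 0, v 1) := fun v => rfl
  let T : SchwartzMap (EuclideanSpace ℝ (Fin 2)) ℂ := 𝓕 S
  refine ⟨T, fun q => 2 * Real.pi * q 0, fun q => 2 * Real.pi * q 1, T.integrable,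
    by fun_prop, by fun_prop, fun p => ?_⟩
  have h : 𝓕⁻ T = S := FourierTransform.fourierInv_fourier_eq S
  have h2 := congrArg (fun T : SchwartzMap _ _ => T (!₂[p.1, p.2])) h
  simp only [SchwartzMap.fourierInv_coe, hS] at h2
  rw [Real.fourierInv_eq'] at h2
  rw [show p = (p.1, p.2) from rfl]
  have h3 : m (p.1, p.2) = m (!₂[p.1, p.2] 0, !₂[p.1, p.2] 1) := by simp
  rw [h3, ← h2]
  refine integral_congr_ae (.of_forall fun q => ?_)
  simp only [smul_eq_mul, PiLp.inner_apply, Fin.sum_univ_two, RCLike.inner_apply, conj_trivial]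
  congr 2
  simp
  ring

/-- The `L²` norm of a function, as a real number. -/
def l2norm {α : Type*} [MeasureSpace α] (F : α → ℂ) : ℝ := √(∫ x, ‖F x‖ ^ 2)

section l2norm

variable {α : Type*} [MeasureSpace α] {F G : α → ℂ}

theorem l2norm_nonneg : 0 ≤ l2norm F := Real.sqrt_nonneg _

theorem l2norm_sq : l2norm F ^ 2 = ∫ x, ‖F x‖ ^ 2 :=
  Real.sq_sqrt (integral_nonneg fun _ => sq_nonneg _)

theorem l2norm_le_of_sq_le {A : ℝ} (hA : 0 ≤ A) (h : ∫ x, ‖F x‖ ^ 2 ≤ A ^ 2) : l2norm F ≤ A :=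
  Real.sqrt_le_iff.2 ⟨hA, h⟩

theorem l2norm_congr_norm (h : ∀ x, ‖F x‖ = ‖G x‖) : l2norm F = l2norm G := by
  simp only [l2norm, h]

theorem integrable_norm_mul_norm (hF : MemLp F 2) (hG : MemLp G 2) :
    Integrable fun x => ‖F x‖ * ‖G x‖ :=
  hF.norm.integrable_mul hG.norm

theorem integral_norm_mul_norm_le (hF : MemLp F 2) (hG : MemLp G 2) :
    ∫ x, ‖F x‖ * ‖G x‖ ≤ l2norm F * l2norm G := by
  have := integral_mul_le_Lp_mul_Lq_of_nonneg (μ := volume) (p := 2) (q := 2)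
    (Real.HolderConjugate.two_two) (f := fun x => ‖F x‖) (g := fun x => ‖G x‖)
    (.of_forall fun x => norm_nonneg _) (.of_forall fun x => norm_nonneg _)
    (by simpa using hF.norm) (by simpa using hG.norm)
  simpa [l2norm, Real.sqrt_eq_rpow] using this

theorem norm_integral_mul_le (hF : MemLp F 2) (hG : MemLp G 2) :
    ‖∫ x, F x * G x‖ ≤ l2norm F * l2norm G :=
  (norm_integral_le_integral_norm _).trans (by
    simpa only [norm_mul] using integral_norm_mul_norm_le hF hG)

end l2norm

theorem l2norm_fourierExtension {F : ℝ → ℂ} (hF : Integrable F) (hF2 : MemLp F 2) :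
    l2norm (fourierExtension F) = √(2 * Real.pi) * l2norm F := by
  rw [l2norm, integral_norm_sq_fourierExtension hF hF2, Real.sqrt_mul (by positivity)]; rfl

theorem l2norm_fourierL2 (h : L2) : l2norm (fourierL2 h) = ‖h‖ := by
  rw [l2norm, integral_norm_sq_fourierL2, Real.sqrt_sq (norm_nonneg _)]

theorem l2norm_comp_add (F : ℝ → ℂ) (y : ℝ) : l2norm (fun x => F (x + y)) = l2norm F := by
  rw [l2norm, integral_add_right_eq_self (fun x => ‖F x‖ ^ 2)]; rfl

/-- `∫∫ e^{ix(ξ+η)} F(ξ) G(η) μ(ξ,η) dξ dη`. -/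
def bilinearExtension (μ : ℝ × ℝ → ℂ) (F G : ℝ → ℂ) (x : ℝ) : ℂ :=
  ∫ p : ℝ × ℝ, Complex.exp (Complex.I * x * (p.1 + p.2)) * F p.1 * G p.2 * μ p

theorem bilinearMultiplier_eq (m : ℝ × ℝ → ℂ) (f g : L2) :
    bilinearMultiplier m f g = bilinearExtension m (fourierL2 f) (fourierL2 g) := rfl

/-- The density of `F ⊗ G · μ` along the level sets of `ξ + η`. -/
def twistedConvolution (μ : ℝ × ℝ → ℂ) (F G : ℝ → ℂ) (ζ : ℝ) : ℂ :=
  ∫ ξ : ℝ, F ξ * G (ζ - ξ) * μ (ξ, ζ - ξ)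

section bilinear

variable {μ : ℝ × ℝ → ℂ} {F G : ℝ → ℂ} {B : ℝ}

theorem integrable_mul_mul_symbol (hF : Integrable F) (hG : Integrable G) (hμ : Continuous μ)
    (hB : ∀ p, ‖μ p‖ ≤ B) : Integrable fun p : ℝ × ℝ => F p.1 * G p.2 * μ p :=
  (hF.mul_prod hG).mul_bdd hμ.aestronglyMeasurable (.of_forall hB)

theorem integrable_shear (hF : Integrable F) (hG : Integrable G) (hμ : Continuous μ)
    (hB : ∀ p, ‖μ p‖ ≤ B) :
    Integrable fun p : ℝ × ℝ => F p.1 * G (p.2 - p.1) * μ (p.1, p.2 - p.1) := by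
  have := (measurePreserving_prod_sub (volume : Measure ℝ) volume).integrable_comp_of_integrable
    (integrable_mul_mul_symbol hF hG hμ hB)
  exact this

theorem integrable_twistedConvolution (hF : Integrable F) (hG : Integrable G) (hμ : Continuous μ)
    (hB : ∀ p, ‖μ p‖ ≤ B) : Integrable (twistedConvolution μ F G) :=
  (integrable_shear hF hG hμ hB).integral_prod_right

/-- Fubini after the measure-preserving shear `(ξ, η) ↦ (ξ, ξ + η)`. It lets any bounded function of
the output frequency pass between the density and the double integral. -/
theorem integral_mul_twistedConvolution (hF : Integrable F) (hG : Integrable G) (hμ : Continuous μ)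
    (hB : ∀ p, ‖μ p‖ ≤ B) {κ : ℝ → ℂ} (hκ : AEStronglyMeasurable κ) {A : ℝ}
    (hA : ∀ ζ, ‖κ ζ‖ ≤ A) :
    ∫ ζ, κ ζ * twistedConvolution μ F G ζ =
      ∫ p : ℝ × ℝ, κ (p.1 + p.2) * (F p.1 * G p.2 * μ p) := by
  have h1 : Integrable fun p : ℝ × ℝ => κ p.2 * (F p.1 * G (p.2 - p.1) * μ (p.1, p.2 - p.1)) :=
    (integrable_shear hF hG hμ hB).bdd_mul hκ.comp_snd (.of_forall fun p => hA p.2)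
  have h2 : ∫ ζ, κ ζ * twistedConvolution μ F G ζ =
      ∫ p : ℝ × ℝ, κ p.2 * (F p.1 * G (p.2 - p.1) * μ (p.1, p.2 - p.1)) := by
    rw [Measure.volume_eq_prod, integral_prod_symm _ h1]
    refine integral_congr_ae (.of_forall fun ζ => ?_)
    simp only [twistedConvolution]
    rw [← integral_const_mul]
  rw [h2]
  have := (measurePreserving_prod_sub (volume : Measure ℝ) volume).integral_comp
    (MeasurableEquiv.shearSubRight ℝ).measurableEmbedding
    (fun p : ℝ × ℝ => κ (p.1 + p.2) * (F p.1 * G p.2 * μ p))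
  simpa [Measure.volume_eq_prod] using this

/-- Young's inequality `L¹ * L¹ → L¹`, with the symbol estimated by its supremum. -/
theorem integral_norm_twistedConvolution_le (hF : Integrable F) (hG : Integrable G)
    (hμ : Continuous μ) (hB : ∀ p, ‖μ p‖ ≤ B) :
    ∫ ζ, ‖twistedConvolution μ F G ζ‖ ≤ B * ((∫ ξ, ‖F ξ‖) * ∫ ξ, ‖G ξ‖) := by
  have h1 := integrable_shear hF hG hμ hB
  calc ∫ ζ, ‖twistedConvolution μ F G ζ‖
      ≤ ∫ ζ, ∫ ξ, ‖F ξ * G (ζ - ξ) * μ (ξ, ζ - ξ)‖ :=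
        integral_mono (integrable_twistedConvolution hF hG hμ hB).norm
          h1.norm.integral_prod_right fun ζ => norm_integral_le_integral_norm _
    _ = ∫ p : ℝ × ℝ, ‖F p.1 * G (p.2 - p.1) * μ (p.1, p.2 - p.1)‖ := by
        rw [Measure.volume_eq_prod, integral_prod_symm _ h1.norm]
    _ = ∫ p : ℝ × ℝ, ‖F p.1 * G p.2 * μ p‖ :=
        (measurePreserving_prod_sub (volume : Measure ℝ) volume).integral_comp
          (MeasurableEquiv.shearSubRight ℝ).measurableEmbedding
          (fun p : ℝ × ℝ => ‖F p.1 * G p.2 * μ p‖)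
    _ ≤ ∫ p : ℝ × ℝ, B * (‖F p.1‖ * ‖G p.2‖) := by
        refine integral_mono (integrable_mul_mul_symbol hF hG hμ hB).norm
          ((hF.norm.mul_prod hG.norm).const_mul B) fun p => ?_
        simp only [norm_mul]
        rw [mul_comm]
        exact mul_le_mul_of_nonneg_right (hB p) (by positivity)
    _ = _ := by
        rw [integral_const_mul, Measure.volume_eq_prod,
          integral_prod_mul (fun ξ => ‖F ξ‖) (fun ξ => ‖G ξ‖)]

/-- Cauchy-Schwarz in the integration variable: the endpoint `L² * L² → L^∞`. -/
theorem norm_twistedConvolution_le (hF : MemLp F 2) (hG : MemLp G 2) (hB : ∀ p, ‖μ p‖ ≤ B)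
    (ζ : ℝ) : ‖twistedConvolution μ F G ζ‖ ≤ B * (l2norm F * l2norm G) := by
  have hG' : MemLp (fun ξ => G (ζ - ξ)) 2 :=
    hG.comp_measurePreserving (Measure.measurePreserving_sub_left volume ζ)
  have hl : l2norm (fun ξ => G (ζ - ξ)) = l2norm G := by
    rw [l2norm, integral_sub_left_eq_self (fun x => ‖G x‖ ^ 2) volume ζ]; rfl
  have hB0 : 0 ≤ B := (norm_nonneg _).trans (hB 0)
  calc ‖twistedConvolution μ F G ζ‖ ≤ ∫ ξ, B * (‖F ξ‖ * ‖G (ζ - ξ)‖) := by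
        refine norm_integral_le_of_norm_le ((integrable_norm_mul_norm hF hG').const_mul B)
          (.of_forall fun ξ => ?_)
        simp only [norm_mul]
        rw [mul_comm]
        exact mul_le_mul_of_nonneg_right (hB _) (by positivity)
    _ ≤ _ := by
        rw [integral_const_mul, ← hl]
        exact mul_le_mul_of_nonneg_left (integral_norm_mul_norm_le hF hG') hB0

theorem integrable_norm_sq_twistedConvolution (hF : Integrable F) (hF2 : MemLp F 2)
    (hG : Integrable G) (hG2 : MemLp G 2) (hμ : Continuous μ) (hB : ∀ p, ‖μ p‖ ≤ B) :
    Integrable fun ζ => ‖twistedConvolution μ F G ζ‖ ^ 2 := by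
  have h1 := integrable_twistedConvolution hF hG hμ hB
  simp_rw [sq]
  exact h1.norm.mul_bdd (c := B * (l2norm F * l2norm G)) h1.norm.aestronglyMeasurable
    (.of_forall fun ζ => by simpa using norm_twistedConvolution_le hF2 hG2 hB ζ)

theorem memLp_twistedConvolution (hF : Integrable F) (hF2 : MemLp F 2)
    (hG : Integrable G) (hG2 : MemLp G 2) (hμ : Continuous μ) (hB : ∀ p, ‖μ p‖ ≤ B) :
    MemLp (twistedConvolution μ F G) 2 :=
  (memLp_two_iff_integrable_sq_norm
    (integrable_twistedConvolution hF hG hμ hB).aestronglyMeasurable).2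
    (integrable_norm_sq_twistedConvolution hF hF2 hG hG2 hμ hB)

/-- Interpolates the two preceding endpoints through `‖R‖₂² ≤ ‖R‖_∞ ‖R‖₁`. -/
theorem integral_norm_sq_twistedConvolution_le (hF : Integrable F) (hF2 : MemLp F 2)
    (hG : Integrable G) (hG2 : MemLp G 2) (hμ : Continuous μ) (hB : ∀ p, ‖μ p‖ ≤ B) :
    ∫ ζ, ‖twistedConvolution μ F G ζ‖ ^ 2 ≤
      B ^ 2 * (l2norm F * l2norm G) * ((∫ ξ, ‖F ξ‖) * ∫ ξ, ‖G ξ‖) := by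
  have h1 := integrable_twistedConvolution hF hG hμ hB
  have hB0 : 0 ≤ B := (norm_nonneg _).trans (hB 0)
  calc ∫ ζ, ‖twistedConvolution μ F G ζ‖ ^ 2
      ≤ ∫ ζ, B * (l2norm F * l2norm G) * ‖twistedConvolution μ F G ζ‖ := by
        refine integral_mono (integrable_norm_sq_twistedConvolution hF hF2 hG hG2 hμ hB)
          (h1.norm.const_mul _) fun ζ => ?_
        simp only [sq]
        exact mul_le_mul_of_nonneg_right (norm_twistedConvolution_le hF2 hG2 hB ζ) (norm_nonneg _)
    _ ≤ B * (l2norm F * l2norm G) * (B * ((∫ ξ, ‖F ξ‖) * ∫ ξ, ‖G ξ‖)) := by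
        rw [integral_const_mul]
        exact mul_le_mul_of_nonneg_left (integral_norm_twistedConvolution_le hF hG hμ hB)
          (mul_nonneg hB0 (mul_nonneg l2norm_nonneg l2norm_nonneg))
    _ = _ := by ring

theorem fourierExtension_twistedConvolution (hF : Integrable F) (hG : Integrable G)
    (hμ : Continuous μ) (hB : ∀ p, ‖μ p‖ ≤ B) :
    fourierExtension (twistedConvolution μ F G) = bilinearExtension μ F G := by
  funext x
  rw [fourierExtension, integral_mul_twistedConvolution hF hG hμ hB
    (Continuous.aestronglyMeasurable (by fun_prop)) (A := 1)
    (fun ζ => by rw [mul_assoc, mul_comm, ← Complex.ofReal_mul, Complex.norm_exp_ofReal_mul_I]),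
    bilinearExtension]
  refine integral_congr_ae (.of_forall fun p => ?_)
  push_cast
  ring

end bilinear

/-- Duality bound for the `L¹`-`L^∞` pairing on the Fourier side. -/
theorem norm_integral_mul_conj_le {R κ : ℝ → ℂ} (hR : Integrable R) (hR2 : MemLp R 2)
    (hκ : Integrable κ) (hκ2 : MemLp κ 2) {A : ℝ} (hA : ∀ x, ‖fourierExtension κ x‖ ≤ A)
    (hE : Integrable (fourierExtension R)) :
    ‖∫ ζ, R ζ * conj (κ ζ)‖ ≤ A * ∫ x, ‖fourierExtension R x‖ := by
  have h1 := integral_fourierExtension_mul_conj hR hR2 hκ hκ2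
  have h2 : ‖∫ x, fourierExtension R x * conj (fourierExtension κ x)‖ ≤
      A * ∫ x, ‖fourierExtension R x‖ := by
    rw [← integral_const_mul]
    refine norm_integral_le_of_norm_le (hE.norm.const_mul A) (.of_forall fun x => ?_)
    rw [norm_mul, RCLike.norm_conj, mul_comm]
    exact mul_le_mul_of_nonneg_right (hA x) (norm_nonneg _)
  refine le_trans ?_ h2
  rw [h1, norm_mul, Complex.norm_real, Real.norm_of_nonneg Real.two_pi_pos.le]
  -- The Parseval factor `2π` is on the favourable side and is simply discarded.
  have : 1 ≤ 2 * Real.pi := by linarith [Real.pi_gt_three]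
  exact le_mul_of_one_le_left (norm_nonneg _) this

section superposition

variable {m : ℝ × ℝ → ℂ} {Q : Type*} [MeasureSpace Q] [SFinite (volume : Measure Q)]
  [TopologicalSpace Q] [SecondCountableTopology Q] [OpensMeasurableSpace Q]
  {M : Q → ℂ} {y z : Q → ℝ} {F G : ℝ → ℂ}

/-- A character in `(ξ, η)` translates the two factors independently, so the multiplier becomes a
weighted average of products of translates. -/
theorem bilinearExtension_eq_integral (hM : Integrable M) (hy : Continuous y) (hz : Continuous z)
    (h : ∀ p, m p = ∫ q, Complex.exp (Complex.I * (y q * p.1 + z q * p.2)) * M q)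
    (hF : Integrable F) (hG : Integrable G) (x : ℝ) :
    bilinearExtension m F G x =
      ∫ q, M q * (fourierExtension F (x + y q) * fourierExtension G (x + z q)) := by
  let Φ : ℝ × ℝ → Q → ℂ := fun p q =>
    (Complex.exp (Complex.I * x * (p.1 + p.2)) * F p.1 * G p.2) *
      (Complex.exp (Complex.I * (y q * p.1 + z q * p.2)) * M q)
  have hΦ : Integrable (Function.uncurry Φ) (volume.prod volume) := by
    have h1 : Integrable (fun w : (ℝ × ℝ) × Q => (F w.1.1 * G w.1.2) * M w.2)
        (volume.prod volume) := (hF.mul_prod hG).mul_prod hM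
    have h2 := h1.bdd_mul (c := 1) (f := fun w : (ℝ × ℝ) × Q =>
      Complex.exp (((x * (w.1.1 + w.1.2) + (y w.2 * w.1.1 + z w.2 * w.1.2) : ℝ) : ℂ) * Complex.I))
      (Continuous.aestronglyMeasurable (by fun_prop))
      (.of_forall fun w => (Complex.norm_exp_ofReal_mul_I _).le)
    refine h2.congr (.of_forall fun w => ?_)
    simp only [Function.uncurry, Φ]
    have e : Complex.exp (((x * (w.1.1 + w.1.2) + (y w.2 * w.1.1 + z w.2 * w.1.2) : ℝ) : ℂ) *
        Complex.I) = Complex.exp (Complex.I * x * (w.1.1 + w.1.2)) *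
        Complex.exp (Complex.I * (y w.2 * w.1.1 + z w.2 * w.1.2)) := by
      rw [← Complex.exp_add]; congr 1; push_cast; ring
    rw [e]; ring
  calc bilinearExtension m F G x = ∫ p, ∫ q, Φ p q := by
        rw [bilinearExtension]
        refine integral_congr_ae (.of_forall fun p => ?_)
        simp only [Φ]
        rw [integral_const_mul, h]
    _ = ∫ q, ∫ p, Φ p q := integral_integral_swap hΦ
    _ = _ := by
        refine integral_congr_ae (.of_forall fun q => ?_)
        simp only [fourierExtension]
        rw [Measure.volume_eq_prod, ← integral_prod_mul, ← integral_const_mul]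
        refine integral_congr_ae (.of_forall fun p => ?_)
        have e : Complex.exp (Complex.I * x * (p.1 + p.2)) *
          Complex.exp (Complex.I * (y q * p.1 + z q * p.2)) =
          Complex.exp (Complex.I * ((x + y q : ℝ) : ℂ) * p.1) *
          Complex.exp (Complex.I * ((x + z q : ℝ) : ℂ) * p.2) := by
          rw [← Complex.exp_add, ← Complex.exp_add]; congr 1; push_cast; ring
        simp only [Φ]
        linear_combination (F p.1 * G p.2 * M q) * e

theorem norm_bilinearExtension_le (hM : Integrable M) (hy : Continuous y) (hz : Continuous z)
    (h : ∀ p, m p = ∫ q, Complex.exp (Complex.I * (y q * p.1 + z q * p.2)) * M q)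
    (hF : Integrable F) (hG : Integrable G) {A A' : ℝ} (hA : ∀ x, ‖fourierExtension F x‖ ≤ A)
    (hA' : ∀ x, ‖fourierExtension G x‖ ≤ A') (x : ℝ) :
    ‖bilinearExtension m F G x‖ ≤ (∫ q, ‖M q‖) * (A * A') := by
  rw [bilinearExtension_eq_integral hM hy hz h hF hG, ← integral_mul_const]
  refine norm_integral_le_of_norm_le (hM.norm.mul_const _) (.of_forall fun q => ?_)
  rw [norm_mul, norm_mul]
  have := (norm_nonneg _).trans (hA 0)
  gcongr
  exacts [hA _, hA' _]

/-- Translation preserves `L²` norms, so Cauchy-Schwarz bounds every product of translates in `L¹`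
alike, and averaging against `M` keeps the bound. The factor `2π` comes from two applications of
Plancherel. -/
theorem integrable_bilinearExtension (hM : Integrable M) (hy : Continuous y) (hz : Continuous z)
    (h : ∀ p, m p = ∫ q, Complex.exp (Complex.I * (y q * p.1 + z q * p.2)) * M q)
    (hF : Integrable F) (hF2 : MemLp F 2) (hG : Integrable G) (hG2 : MemLp G 2) :
    Integrable (bilinearExtension m F G) ∧ ∫ x, ‖bilinearExtension m F G x‖ ≤
      (2 * Real.pi * ∫ q, ‖M q‖) * (l2norm F * l2norm G) := by
  let Ψ : ℝ → Q → ℂ := fun x q =>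
    M q * (fourierExtension F (x + y q) * fourierExtension G (x + z q))
  have cF := continuous_fourierExtension hF
  have cG := continuous_fourierExtension hG
  have mF := memLp_fourierExtension hF hF2
  have mG := memLp_fourierExtension hG hG2
  have mF' : ∀ r, MemLp (fun x => fourierExtension F (x + r)) 2 := fun r =>
    mF.comp_measurePreserving (measurePreserving_add_right volume r)
  have mG' : ∀ r, MemLp (fun x => fourierExtension G (x + r)) 2 := fun r =>
    mG.comp_measurePreserving (measurePreserving_add_right volume r)
  have hmeas : AEStronglyMeasurable (Function.uncurry Ψ) (volume.prod volume) := by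
    refine (hM.aestronglyMeasurable.comp_snd).mul (Continuous.aestronglyMeasurable ?_)
    fun_prop
  have hin : ∀ q, ∫ x, ‖Ψ x q‖ ≤ ‖M q‖ * (2 * Real.pi * (l2norm F * l2norm G)) := by
    intro q
    simp only [Ψ, norm_mul]
    rw [integral_const_mul]
    refine mul_le_mul_of_nonneg_left ?_ (norm_nonneg _)
    refine (integral_norm_mul_norm_le (mF' (y q)) (mG' (z q))).trans (le_of_eq ?_)
    rw [l2norm_comp_add, l2norm_comp_add, l2norm_fourierExtension hF hF2,
      l2norm_fourierExtension hG hG2]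
    have : √(2 * Real.pi) * √(2 * Real.pi) = 2 * Real.pi := Real.mul_self_sqrt (by positivity)
    linear_combination (l2norm F * l2norm G) * this
  have hint : Integrable (fun q => ∫ x, ‖Ψ x q‖) := by
    refine (hM.norm.mul_const (2 * Real.pi * (l2norm F * l2norm G))).mono'
      hmeas.norm.prod_swap.integral_prod_right' (.of_forall fun q => ?_)
    rw [Real.norm_of_nonneg (integral_nonneg fun x => norm_nonneg _)]
    exact hin q
  have hΨ : Integrable (Function.uncurry Ψ) (volume.prod volume) := by
    rw [integrable_prod_iff' hmeas]
    refine ⟨.of_forall fun q => ?_, hint⟩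
    exact ((mF' (y q)).integrable_mul (mG' (z q))).const_mul (M q)
  have hbil : bilinearExtension m F G = fun x => ∫ q, Ψ x q := by
    funext x
    exact bilinearExtension_eq_integral hM hy hz h hF hG x
  rw [hbil]
  refine ⟨hΨ.integral_prod_left, ?_⟩
  calc ∫ x, ‖∫ q, Ψ x q‖ ≤ ∫ x, ∫ q, ‖Ψ x q‖ :=
        integral_mono hΨ.integral_prod_left.norm hΨ.norm.integral_prod_left
          fun x => norm_integral_le_integral_norm _
    _ = ∫ q, ∫ x, ‖Ψ x q‖ := integral_integral_swap hΨ.norm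
    _ ≤ ∫ q, ‖M q‖ * (2 * Real.pi * (l2norm F * l2norm G)) :=
        integral_mono hint (hM.norm.mul_const _) hin
    _ = _ := by rw [integral_mul_const]; ring

end superposition

/-! ### Weak solutions tested in the moving frame, and the free evolution -/

theorem norm_exp_I_mul_mul (s r : ℝ) : ‖Complex.exp (Complex.I * s * r)‖ = 1 := by
  rw [mul_assoc, mul_comm, ← Complex.ofReal_mul, Complex.norm_exp_ofReal_mul_I]

theorem conj_exp_I_mul_mul (s r : ℝ) :
    conj (Complex.exp (Complex.I * s * r)) = Complex.exp (-(Complex.I * s * r)) := by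
  rw [← Complex.exp_conj]
  simp

/-- The linear evolution `e^{ita} χ` on the Fourier side. -/
def propagate (a : ℝ → ℝ) (t : ℝ) (χ : ℝ → ℂ) (ξ : ℝ) : ℂ :=
  Complex.exp (Complex.I * t * a ξ) * χ ξ

section propagate

variable {a : ℝ → ℝ} {χ : ℝ → ℂ} {t s : ℝ}

theorem norm_propagate (ξ : ℝ) : ‖propagate a t χ ξ‖ = ‖χ ξ‖ := by
  rw [propagate, norm_mul, norm_exp_I_mul_mul, one_mul]

theorem l2norm_propagate : l2norm (propagate a t χ) = l2norm χ :=
  l2norm_congr_norm norm_propagate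

theorem propagate_propagate : propagate a t (propagate a s χ) = propagate a (t + s) χ := by
  funext ξ
  simp only [propagate]
  rw [← mul_assoc, ← Complex.exp_add]
  push_cast
  ring_nf

theorem propagate_zero : propagate a 0 χ = χ := by
  funext ξ
  simp [propagate]

theorem aestronglyMeasurable_propagate (ha : Continuous a) (hχ : AEStronglyMeasurable χ) :
    AEStronglyMeasurable (propagate a t χ) :=
  (Continuous.aestronglyMeasurable (by fun_prop)).mul hχ

theorem integrable_propagate (ha : Continuous a) (hχ : Integrable χ) :
    Integrable (propagate a t χ) :=
  hχ.congr' (aestronglyMeasurable_propagate ha hχ.aestronglyMeasurable)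
    (.of_forall fun ξ => (norm_propagate ξ).symm)

theorem memLp_propagate (ha : Continuous a) (hχ : MemLp χ 2) : MemLp (propagate a t χ) 2 :=
  hχ.congr_norm (aestronglyMeasurable_propagate ha hχ.aestronglyMeasurable)
    (.of_forall fun ξ => (norm_propagate ξ).symm)

theorem contDiff_propagate (ha : ContDiff ℝ ∞ a) (hχ : ContDiff ℝ ∞ χ) :
    ContDiff ℝ ∞ (propagate a t χ) := by
  have : ContDiff ℝ ∞ fun ξ => (a ξ : ℂ) := Complex.ofRealCLM.contDiff.comp ha
  exact ((contDiff_const.mul this).cexp).mul hχ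

theorem hasCompactSupport_propagate (hs : HasCompactSupport χ) :
    HasCompactSupport (propagate a t χ) :=
  hs.mul_left

end propagate

theorem l2norm_le_of_norm_le {F G : ℝ → ℂ} (hG : MemLp G 2) {c : ℝ} (hc : 0 ≤ c)
    (h : ∀ x, ‖F x‖ ≤ c * ‖G x‖) : l2norm F ≤ c * l2norm G := by
  refine l2norm_le_of_sq_le (mul_nonneg hc l2norm_nonneg) ?_
  rw [mul_pow, l2norm_sq, ← integral_const_mul]
  refine integral_mono_of_nonneg (.of_forall fun x => sq_nonneg _)
    (((memLp_two_iff_integrable_sq_norm hG.aestronglyMeasurable).1 hG).const_mul _)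
    (.of_forall fun x => ?_)
  simp only
  rw [← mul_pow]
  exact pow_le_pow_left₀ (norm_nonneg _) (h x) 2

theorem continuousWithinAt_pairing {u : ℝ → L2} {t : ℝ} (hu : ContinuousWithinAt u (Ici 0) t)
    {χ : ℝ → ℂ} (h1 : Integrable χ) (h2 : MemLp χ 2) :
    ContinuousWithinAt (fun s => pairing (u s) (invFourier χ)) (Ici 0) t := by
  have : (fun s => pairing (u s) (invFourier χ)) =
      fun s => inner ℂ ((memLp_invFourier h1 h2).toLp) (u s) := by
    funext s
    exact integral_mul_conj_eq_inner (u s) _ .rfl (memLp_invFourier h1 h2).coeFn_toLp.symm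
  rw [this]
  exact continuousWithinAt_const.inner hu

theorem integrable_of_contDiff {χ : ℝ → ℂ} (hχ : ContDiff ℝ ∞ χ) (hs : HasCompactSupport χ) :
    Integrable χ := hχ.continuous.integrable_of_hasCompactSupport hs

theorem memLp_of_contDiff {χ : ℝ → ℂ} (hχ : ContDiff ℝ ∞ χ) (hs : HasCompactSupport χ) :
    MemLp χ 2 := hχ.continuous.memLp_of_hasCompactSupport hs

/-- A weak solution may be tested against the moving frame `e^{isa} χ`. -/
theorem IsWeakSolution.hasDerivWithinAt_pairing_propagate {a : ℝ → ℝ} (ha : ContDiff ℝ ∞ a)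
    {F : ℝ → ℝ → ℂ} {u₀ : L2} {u : ℝ → L2} (hu : IsWeakSolution a F u₀ u) {χ : ℝ → ℂ}
    (hχ : ContDiff ℝ ∞ χ) (hs : HasCompactSupport χ) {t : ℝ} (ht : 0 ≤ t) :
    HasDerivWithinAt (fun s => pairing (u s) (invFourier (propagate a s χ)))
      (-Complex.I * pairing (F t) (invFourier (propagate a t χ))) (Ici 0) t := by
  have hca : ContDiff ℝ ∞ fun ξ => (a ξ : ℂ) := Complex.ofRealCLM.contDiff.comp ha
  set ψ := propagate a t χ with hψdef
  have hψ : ContDiff ℝ ∞ ψ := contDiff_propagate ha hχ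
  have hψs : HasCompactSupport ψ := hasCompactSupport_propagate hs
  set ν : ℝ → ℂ := fun ξ => (a ξ : ℂ) * ψ ξ with hνdef
  have hν : ContDiff ℝ ∞ ν := hca.mul hψ
  have hνs : HasCompactSupport ν := hψs.mul_left
  set κ : ℝ → ℂ := fun ξ => (a ξ : ℂ) * ν ξ with hκdef
  have hκ : ContDiff ℝ ∞ κ := hca.mul hν
  have hκs : HasCompactSupport κ := hνs.mul_left
  have mκ := memLp_of_contDiff hκ hκs
  -- The symbol may be unbounded on the line, but only its size on the support of `χ` matters; this
  -- is what band limitation of the test functions provides.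
  obtain ⟨A, hA⟩ : ∃ A, ∀ ξ ∈ tsupport χ, ‖a ξ‖ ≤ A :=
    hs.isCompact.exists_bound_of_continuousOn ha.continuous.continuousOn
  obtain ⟨d, hd, hde⟩ := hu.equation ψ hψ hψs t ht
  have hut : ContinuousWithinAt u (Ici 0) t := hu.continuousOn t ht
  set w : ℝ → ℂ := fun s => pairing (u s) (invFourier ν) with hw
  have hwc : ContinuousWithinAt w (Ici 0) t :=
    continuousWithinAt_pairing hut (integrable_of_contDiff hν hνs) (memLp_of_contDiff hν hνs)
  -- The product rule is carried out by hand, since `u` is only continuous: the pairing with the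
  -- frozen test function `ψ` is differentiated by the equation, and `z` collects the motion of the
  -- test function.
  set z : ℝ → ℂ := fun s =>
    pairing (u s) (invFourier (propagate a s χ)) - pairing (u s) (invFourier ψ) with hz
  -- Second-order Taylor remainder of `e^{isa}χ` at `s = t`; it is bounded by `|s - t|²` times `|κ|
  -- = |a²ψ|`. The factor `i` becomes `-i` in the pairing, which is antilinear in its second slot.
  let ρ : ℝ → ℝ → ℂ := fun s ξ => propagate a s χ ξ - ψ ξ - Complex.I * (s - t : ℝ) * ν ξ
  have hzrem : ∀ s, z s = -Complex.I * (s - t : ℝ) * w s + ∫ ξ, fourierL2 (u s) ξ * conj (ρ s ξ) := by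
    intro s
    have hs1 := contDiff_propagate (t := s) ha hχ
    have hs2 := hasCompactSupport_propagate (a := a) (t := s) hs
    have i1 : ∀ {η : ℝ → ℂ}, MemLp η 2 → Integrable fun ξ => fourierL2 (u s) ξ * conj (η ξ) :=
      fun h => (memLp_fourierL2 (u s)).integrable_mul h.star
    have m1 := memLp_of_contDiff hs1 hs2
    have m2 := memLp_of_contDiff hψ hψs
    have m3 := memLp_of_contDiff hν hνs
    simp only [hz, hw]
    rw [pairing_invFourier _ (integrable_of_contDiff hs1 hs2) m1,
      pairing_invFourier _ (integrable_of_contDiff hψ hψs) m2,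
      pairing_invFourier _ (integrable_of_contDiff hν hνs) m3]
    have e : ∀ ξ, fourierL2 (u s) ξ * conj (ρ s ξ) = fourierL2 (u s) ξ * conj (propagate a s χ ξ) -
        fourierL2 (u s) ξ * conj (ψ ξ) +
        Complex.I * (s - t : ℝ) * (fourierL2 (u s) ξ * conj (ν ξ)) := by
      intro ξ
      simp only [ρ, map_sub, map_mul, Complex.conj_I, Complex.conj_ofReal]
      ring
    simp_rw [e]
    have i2 : Integrable fun ξ => fourierL2 (u s) ξ * conj (propagate a s χ ξ) -
        fourierL2 (u s) ξ * conj (ψ ξ) := (i1 m1).sub (i1 m2)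
    rw [integral_add i2 ((i1 m3).const_mul _), integral_sub (i1 m1) (i1 m2),
      integral_const_mul]
    ring
  have hrem : ∀ s, |s - t| * A ≤ 1 →
      ‖∫ ξ, fourierL2 (u s) ξ * conj (ρ s ξ)‖ ≤ ‖u s‖ * (|s - t| ^ 2 * l2norm κ) := by
    intro s hsA
    have hs1 := contDiff_propagate (t := s) ha hχ
    have hs2 := hasCompactSupport_propagate (a := a) (t := s) hs
    have mρ : MemLp (ρ s) 2 := ((memLp_of_contDiff hs1 hs2).sub (memLp_of_contDiff hψ hψs)).sub
      ((memLp_of_contDiff hν hνs).const_mul _)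
    have h1 := norm_integral_mul_le (memLp_fourierL2 (u s)) mρ.star
    have h2 : l2norm (star (ρ s)) ≤ |s - t| ^ 2 * l2norm κ := by
      refine l2norm_le_of_norm_le mκ (by positivity) fun ξ => ?_
      rw [Pi.star_apply, norm_star]
      by_cases hξ : ξ ∈ tsupport χ
      · have e1 : propagate a s χ ξ = Complex.exp (Complex.I * (s - t : ℝ) * a ξ) * ψ ξ := by
          rw [show propagate a s χ = propagate a (s - t) ψ by
            rw [hψdef, propagate_propagate, sub_add_cancel]]
          rfl
        have e2 : ρ s ξ = (Complex.exp (Complex.I * (s - t : ℝ) * a ξ) - 1 -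
            Complex.I * (s - t : ℝ) * a ξ) * ψ ξ := by
          simp only [ρ, e1, hνdef]; ring
        have e3 : ‖Complex.I * ((s - t : ℝ) : ℂ) * (a ξ : ℂ)‖ = |s - t| * |a ξ| := by
          simp only [norm_mul, Complex.norm_I, one_mul, Complex.norm_real, Real.norm_eq_abs]
        have hle : ‖Complex.I * ((s - t : ℝ) : ℂ) * (a ξ : ℂ)‖ ≤ 1 := by
          rw [e3]
          exact (mul_le_mul_of_nonneg_left (hA ξ hξ) (abs_nonneg _)).trans hsA
        rw [e2, norm_mul]
        refine (mul_le_mul_of_nonneg_right (Complex.norm_exp_sub_one_sub_id_le hle)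
          (norm_nonneg _)).trans (le_of_eq ?_)
        rw [e3]
        simp only [hκdef, hνdef, norm_mul, Complex.norm_real, Real.norm_eq_abs]
        ring
      · have h0 : χ ξ = 0 := image_eq_zero_of_notMem_tsupport hξ
        have : ρ s ξ = 0 := by
          simp [ρ, hνdef, hψdef, propagate, h0]
        rw [this, norm_zero]
        positivity
    refine h1.trans ?_
    rw [l2norm_fourierL2]
    exact mul_le_mul_of_nonneg_left h2 (norm_nonneg _)
  have hzd : HasDerivWithinAt z (-Complex.I * w t) (Ici 0) t := by
    have hsub : Filter.Tendsto (fun s => s - t) (nhdsWithin t (Ici 0)) (nhds 0) := by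
      have : Filter.Tendsto (fun s => s - t) (nhds t) (nhds (t - t)) := by
        exact (continuous_id.sub continuous_const).tendsto t
      rw [sub_self] at this
      exact this.mono_left nhdsWithin_le_nhds
    rw [hasDerivWithinAt_iff_isLittleO]
    have hzt : z t = 0 := by simp [hz, hψdef]
    -- Only continuity of `w` is needed here, because a factor `s - t` is already present.
    have l1 : (fun s => -Complex.I * ((s - t : ℝ) : ℂ) * (w s - w t)) =o[nhdsWithin t (Ici 0)]
        fun s => s - t := by
      have : (fun s => ((s - t : ℝ) : ℂ) * (-Complex.I * (w s - w t))) =o[nhdsWithin t (Ici 0)]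
          fun s => ((s - t : ℝ)) * (1 : ℝ) := by
        refine Asymptotics.IsBigO.mul_isLittleO ?_ ?_
        · exact Asymptotics.IsBigO.of_bound 1 (.of_forall fun s => by
            rw [Complex.norm_real, one_mul])
        · rw [Asymptotics.isLittleO_one_iff]
          have h5 : Filter.Tendsto (fun s => -Complex.I * (w s - w t)) (nhdsWithin t (Ici 0))
              (nhds (-Complex.I * (w t - w t))) :=
            (Filter.Tendsto.sub hwc tendsto_const_nhds).const_mul _
          simpa using h5
      refine (this.congr_right fun s => mul_one _).congr_left fun s => ?_
      ring
    have l2 : (fun s => ∫ ξ, fourierL2 (u s) ξ * conj (ρ s ξ)) =o[nhdsWithin t (Ici 0)]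
        fun s => s - t := by
      have b1 : (fun s => ∫ ξ, fourierL2 (u s) ξ * conj (ρ s ξ)) =O[nhdsWithin t (Ici 0)]
          fun s => (s - t) * ((s - t) * (‖u s‖ * l2norm κ)) := by
        have ev : ∀ᶠ s in nhdsWithin t (Ici 0), |s - t| * A ≤ 1 := by
          have : Filter.Tendsto (fun s => |s - t| * A) (nhdsWithin t (Ici 0)) (nhds (|(0:ℝ)| * A)) :=
            (hsub.abs).mul_const A
          rw [abs_zero, zero_mul] at this
          exact (this.eventually (gt_mem_nhds one_pos)).mono fun s h => h.le
        refine Asymptotics.IsBigO.of_bound 1 (ev.mono fun s h => (hrem s h).trans (le_of_eq ?_))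
        rw [one_mul, Real.norm_eq_abs, abs_mul, abs_mul, abs_mul, abs_of_nonneg (norm_nonneg _),
          abs_of_nonneg l2norm_nonneg]
        ring
      refine b1.trans_isLittleO ?_
      have b2 : (fun s => (s - t) * (‖u s‖ * l2norm κ)) =o[nhdsWithin t (Ici 0)]
          fun _ => (1 : ℝ) := by
        rw [Asymptotics.isLittleO_one_iff]
        have : Filter.Tendsto (fun s => (s - t) * (‖u s‖ * l2norm κ)) (nhdsWithin t (Ici 0))
            (nhds (0 * (‖u t‖ * l2norm κ))) := hsub.mul (hut.norm.mul_const _)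
        simpa using this
      exact ((Asymptotics.isBigO_refl (fun s => s - t) _).mul_isLittleO b2).congr_right
        fun s => mul_one _
    refine (l1.add l2).congr_left fun s => ?_
    rw [hzrem s, hzt, Complex.real_smul]
    ring
  refine ((hd.add hzd).congr_deriv ?_).congr_of_eventuallyEq (.of_forall fun s => ?_) ?_
  · rw [← hde]
    simp only [hw, hνdef]
    linear_combination d * Complex.I_mul_I
  · simp [hz]
  · simp [hz]

theorem eq_of_hasDerivWithinAt_zero {y : ℝ → ℂ}
    (h : ∀ t, 0 ≤ t → HasDerivWithinAt y 0 (Ici 0) t) {t : ℝ} (ht : 0 ≤ t) : y t = y 0 :=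
  constant_of_has_deriv_right_zero
    (fun s hs => ((h s hs.1).continuousWithinAt.mono Icc_subset_Ici_self))
    (fun s hs => (h s hs.1).mono (Ici_subset_Ici.2 hs.1)) t ⟨ht, le_rfl⟩

/-- Real test functions already determine a locally integrable function, and for them the
conjugation is invisible. -/
theorem ae_eq_of_integral_mul_conj_eq {F G : ℝ → ℂ} (hF : LocallyIntegrable F)
    (hG : LocallyIntegrable G) (h : ∀ χ : ℝ → ℂ, ContDiff ℝ ∞ χ → HasCompactSupport χ →
      ∫ ξ, F ξ * conj (χ ξ) = ∫ ξ, G ξ * conj (χ ξ)) : F =ᵐ[volume] G := by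
  refine ae_eq_of_integral_contDiff_smul_eq hF hG fun g hg hgs => ?_
  have := h (fun ξ => (g ξ : ℂ)) (Complex.ofRealCLM.contDiff.comp hg)
    (hgs.comp_left (g := fun r : ℝ => (r : ℂ)) (by simp))
  simpa [mul_comm] using this

/-- Solutions of the free equation are given by the Fourier multiplier `e^{itb}`. -/
theorem IsWeakSolution.fourierL2_eq_propagate {b : ℝ → ℝ} (hb : ContDiff ℝ ∞ b) {f : L2}
    {v : ℝ → L2} (hv : IsWeakSolution b (fun _ _ => 0) f v) {t : ℝ} (ht : 0 ≤ t) :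
    fourierL2 (v t) =ᵐ[volume] propagate b t (fourierL2 f) := by
  refine ae_eq_of_integral_mul_conj_eq ((memLp_fourierL2 _).locallyIntegrable (by norm_num))
    ((memLp_propagate hb.continuous (memLp_fourierL2 f)).locallyIntegrable (by norm_num))
    fun χ hχ hs => ?_
  have hχ' := contDiff_propagate (t := -t) hb hχ
  have hs' := hasCompactSupport_propagate (a := b) (t := -t) hs
  -- The profile `e^{-itb}χ` is chosen so that the moving test function is `χ` at time `t` and
  -- `e^{-itb}χ` at time `0`; the pairing is conserved in between.
  have key := eq_of_hasDerivWithinAt_zero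
    (y := fun s => pairing (v s) (invFourier (propagate b s (propagate b (-t) χ))))
    (fun s h0 => by
      simpa [pairing] using hv.hasDerivWithinAt_pairing_propagate hb hχ' hs' h0) ht
  simp only [propagate_propagate, add_neg_cancel, zero_add, propagate_zero, hv.initial] at key
  rw [pairing_invFourier _ (integrable_of_contDiff hχ hs) (memLp_of_contDiff hχ hs),
    pairing_invFourier _ (integrable_of_contDiff hχ' hs') (memLp_of_contDiff hχ' hs')] at key
  rw [key]
  refine integral_congr_ae (.of_forall fun ξ => ?_)
  simp only [propagate, map_mul, conj_exp_I_mul_mul]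
  push_cast
  ring_nf

/-! ### Frequency cutoffs and Duhamel's formula -/

section congruence

variable {μ : ℝ × ℝ → ℂ} {F G F' G' : ℝ → ℂ}

theorem bilinearExtension_congr_ae (hF : F =ᵐ[volume] F') (hG : G =ᵐ[volume] G') :
    bilinearExtension μ F G = bilinearExtension μ F' G' := by
  funext x
  refine integral_congr_ae ?_
  have h1 := Measure.quasiMeasurePreserving_fst (μ := (volume : Measure ℝ))
    (ν := (volume : Measure ℝ)) |>.ae hF
  have h2 := Measure.quasiMeasurePreserving_snd (μ := (volume : Measure ℝ))
    (ν := (volume : Measure ℝ)) |>.ae hG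
  filter_upwards [h1, h2] with p e1 e2
  rw [e1, e2]

/-- Replaces merely square-integrable profiles by ones that are also integrable, without changing
the output. -/
theorem bilinearExtension_cutoff {χ : ℝ → ℂ} (h : ∀ p, μ p ≠ 0 → χ p.1 = 1 ∧ χ p.2 = 1) :
    bilinearExtension μ F G =
      bilinearExtension μ (fun ξ => χ ξ * F ξ) (fun ξ => χ ξ * G ξ) := by
  funext x
  refine integral_congr_ae (.of_forall fun p => ?_)
  by_cases hp : μ p = 0
  · simp [hp]
  · simp [h p hp]

end congruence

section cutoff

variable {χ : ℝ → ℂ} {F : ℝ → ℂ}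

theorem integrable_cutoff_mul (hχ : ContDiff ℝ ∞ χ) (hs : HasCompactSupport χ) (hF : MemLp F 2) :
    Integrable fun ξ => χ ξ * F ξ :=
  (memLp_of_contDiff hχ hs).integrable_mul hF

theorem integral_norm_cutoff_mul_le (hχ : ContDiff ℝ ∞ χ) (hs : HasCompactSupport χ)
    (hF : MemLp F 2) : ∫ ξ, ‖χ ξ * F ξ‖ ≤ l2norm χ * l2norm F := by
  simp only [norm_mul]
  exact integral_norm_mul_norm_le (memLp_of_contDiff hχ hs) hF

theorem memLp_cutoff_mul (hχ : ContDiff ℝ ∞ χ) (h1 : ∀ ξ, ‖χ ξ‖ ≤ 1) (hF : MemLp F 2) :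
    MemLp (fun ξ => χ ξ * F ξ) 2 :=
  hF.mono (hχ.continuous.aestronglyMeasurable.mul hF.aestronglyMeasurable)
    (.of_forall fun ξ => by
      rw [norm_mul]
      exact mul_le_of_le_one_left (norm_nonneg _) (h1 ξ))

theorem l2norm_cutoff_mul_le (h1 : ∀ ξ, ‖χ ξ‖ ≤ 1) (hF : MemLp F 2) :
    l2norm (fun ξ => χ ξ * F ξ) ≤ l2norm F := by
  have := l2norm_le_of_norm_le (F := fun ξ => χ ξ * F ξ) hF zero_le_one fun ξ => by
    rw [norm_mul]
    exact mul_le_mul_of_nonneg_right (h1 ξ) (norm_nonneg _)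
  rwa [one_mul] at this

end cutoff

/-- The symbol of the Duhamel integral: `u(t) = T_{m Φ_t}(f, g)`. -/
def duhamelSymbol (a b c : ℝ → ℝ) (t : ℝ) (p : ℝ × ℝ) : ℂ :=
  -Complex.I * ∫ s in (0 : ℝ)..t,
    Complex.exp (Complex.I * ((t - s) * a (p.1 + p.2) + s * (b p.1 + c p.2) : ℝ))

section duhamelSymbol

variable {a b c : ℝ → ℝ}

theorem continuous_duhamelSymbol (ha : Continuous a) (hb : Continuous b) (hc : Continuous c)
    (t : ℝ) : Continuous (duhamelSymbol a b c t) := by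
  refine continuous_const.mul ?_
  refine intervalIntegral.continuous_parametric_intervalIntegral_of_continuous' ?_ 0 t
  fun_prop

theorem norm_duhamelSymbol_le (t : ℝ) (p : ℝ × ℝ) : ‖duhamelSymbol a b c t p‖ ≤ |t| := by
  rw [duhamelSymbol, norm_mul, norm_neg, Complex.norm_I, one_mul]
  have := intervalIntegral.norm_integral_le_of_norm_le_const (a := 0) (b := t) (C := 1)
    (f := fun s => Complex.exp (Complex.I * ((t - s) * a (p.1 + p.2) + s * (b p.1 + c p.2) : ℝ)))
    fun s _ => by rw [mul_comm, Complex.norm_exp_ofReal_mul_I]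
  simpa using this

/-- Pulling out the linear flow of `a` leaves an integral oscillating with the resonance phase
alone. -/
theorem duhamelSymbol_eq (t : ℝ) (p : ℝ × ℝ) :
    duhamelSymbol a b c t p = Complex.exp (Complex.I * t * a (p.1 + p.2)) *
      (-Complex.I * ∫ s in (0 : ℝ)..t, Complex.exp (Complex.I * s * phase a b c p)) := by
  rw [duhamelSymbol, mul_left_comm (Complex.exp _),
    ← intervalIntegral.integral_const_mul (Complex.exp _)]
  congr 1
  apply intervalIntegral.integral_congr
  intro s _
  simp only
  rw [← Complex.exp_add, phase]
  push_cast
  ring_nf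

end duhamelSymbol

theorem sqrt_two_pi_ne_zero : ((√(2 * Real.pi) : ℝ) : ℂ) ≠ 0 := by
  simp [Real.sqrt_eq_zero', Real.pi_pos]

theorem sqrt_two_pi_mul_self :
    ((√(2 * Real.pi) : ℝ) : ℂ) * ((√(2 * Real.pi) : ℝ) : ℂ) = (2 * Real.pi : ℝ) := by
  rw [← Complex.ofReal_mul, Real.mul_self_sqrt (by positivity)]

/-- The constant is `2π` from Parseval times `(2π)^{-1/2}` from the normalization of the test
function. -/
theorem pairing_bilinearExtension {μ : ℝ × ℝ → ℂ} {F G : ℝ → ℂ} {B : ℝ} (hF : Integrable F)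
    (hF2 : MemLp F 2) (hG : Integrable G) (hG2 : MemLp G 2) (hμ : Continuous μ)
    (hB : ∀ p, ‖μ p‖ ≤ B) {ψ : ℝ → ℂ} (hψ : ContDiff ℝ ∞ ψ) (hs : HasCompactSupport ψ) :
    pairing (bilinearExtension μ F G) (invFourier ψ) = ((√(2 * Real.pi) : ℝ) : ℂ) *
      ∫ p : ℝ × ℝ, conj (ψ (p.1 + p.2)) * (F p.1 * G p.2 * μ p) := by
  obtain ⟨A, hA⟩ := hs.exists_bound_of_continuous hψ.continuous
  have h1 := integral_mul_twistedConvolution hF hG hμ hB (κ := fun ζ => conj (ψ ζ)) (A := A)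
    (Complex.continuous_conj.comp hψ.continuous).aestronglyMeasurable (by simpa using hA)
  have h2 := integral_fourierExtension_mul_conj (integrable_twistedConvolution hF hG hμ hB)
    (memLp_twistedConvolution hF hF2 hG hG2 hμ hB) (integrable_of_contDiff hψ hs)
    (memLp_of_contDiff hψ hs)
  rw [← h1, ← fourierExtension_twistedConvolution hF hG hμ hB, pairing]
  simp only [invFourier_eq, map_mul, map_inv₀, Complex.conj_ofReal]
  simp only [mul_left_comm _ ((√(2 * Real.pi) : ℝ) : ℂ)⁻¹ _]
  rw [integral_const_mul, h2, ← sqrt_two_pi_mul_self, mul_assoc,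
    inv_mul_cancel_left₀ sqrt_two_pi_ne_zero]
  simp_rw [mul_comm (conj (ψ _))]

/-- Duhamel's formula for the system. -/
theorem IsSolution.eq_bilinearExtension {a b c : ℝ → ℝ} {m : ℝ × ℝ → ℂ} (ha : ContDiff ℝ ∞ a)
    (hb : ContDiff ℝ ∞ b) (hc : ContDiff ℝ ∞ c) (hm : Continuous m) {B : ℝ} (hB : ∀ p, ‖m p‖ ≤ B)
    {χ₀ : ℝ → ℂ} (hχ₀ : ContDiff ℝ ∞ χ₀) (hs₀ : HasCompactSupport χ₀) (h1 : ∀ ξ, ‖χ₀ ξ‖ ≤ 1)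
    (hm₀ : ∀ p, m p ≠ 0 → χ₀ p.1 = 1 ∧ χ₀ p.2 = 1) {f g : L2} {u v w : ℝ → L2}
    (h : IsSolution a b c m f g u v w) {t : ℝ} (ht : 0 ≤ t) :
    u t =ᵐ[volume] bilinearExtension (fun p => m p * duhamelSymbol a b c t p)
      (fun ξ => χ₀ ξ * fourierL2 f ξ) (fun ξ => χ₀ ξ * fourierL2 g ξ) := by
  set F : ℝ → ℂ := fun ξ => χ₀ ξ * fourierL2 f ξ with hFdef
  set G : ℝ → ℂ := fun ξ => χ₀ ξ * fourierL2 g ξ with hGdef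
  have iF : Integrable F := integrable_cutoff_mul hχ₀ hs₀ (memLp_fourierL2 f)
  have iG : Integrable G := integrable_cutoff_mul hχ₀ hs₀ (memLp_fourierL2 g)
  have mF : MemLp F 2 := memLp_cutoff_mul hχ₀ h1 (memLp_fourierL2 f)
  have mG : MemLp G 2 := memLp_cutoff_mul hχ₀ h1 (memLp_fourierL2 g)
  have cφ : Continuous (phase a b c) := by
    have := ha.continuous; have := hb.continuous; have := hc.continuous
    unfold phase; fun_prop
  have forcing : ∀ s, 0 ≤ s → bilinearMultiplier m (v s) (w s) =
      bilinearExtension m (propagate b s F) (propagate c s G) := by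
    intro s hs
    rw [bilinearMultiplier_eq, bilinearExtension_congr_ae (h.left.fourierL2_eq_propagate hb hs)
      (h.right.fourierL2_eq_propagate hc hs), bilinearExtension_cutoff hm₀]
    congr 1
    all_goals
      funext ξ
      simp only [propagate, hFdef, hGdef]
      ring
  have iH : Integrable fun p : ℝ × ℝ => F p.1 * G p.2 * m p := integrable_mul_mul_symbol iF iG hm hB
  -- Duhamel's formula in weak form and in the moving frame, where the linear term of the equation
  -- has disappeared and only the forcing is left to integrate in time.
  have dual : ∀ χ : ℝ → ℂ, ContDiff ℝ ∞ χ → HasCompactSupport χ → ∀ t, 0 ≤ t →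
      pairing (u t) (invFourier (propagate a t χ)) = ((√(2 * Real.pi) : ℝ) : ℂ) *
        ∫ p : ℝ × ℝ, (conj (χ (p.1 + p.2)) * (F p.1 * G p.2 * m p)) *
          (-Complex.I * ∫ s in (0 : ℝ)..t, Complex.exp (Complex.I * s * phase a b c p)) := by
    intro χ hχ hs
    obtain ⟨A, hA⟩ := hs.exists_bound_of_continuous hχ.continuous
    have cχ : Continuous fun p : ℝ × ℝ => conj (χ (p.1 + p.2)) := by
      have := hχ.continuous
      fun_prop
    have iK : Integrable fun p : ℝ × ℝ => conj (χ (p.1 + p.2)) * (F p.1 * G p.2 * m p) :=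
      iH.bdd_mul (c := A) cχ.aestronglyMeasurable (.of_forall fun p => by simpa using hA _)
    have cΘ : ∀ t : ℝ, Continuous fun p : ℝ × ℝ => -Complex.I *
        ∫ s in (0 : ℝ)..t, Complex.exp (Complex.I * s * phase a b c p) := fun t => by
      refine continuous_const.mul ?_
      refine intervalIntegral.continuous_parametric_intervalIntegral_of_continuous' ?_ 0 t
      fun_prop
    have cE : ∀ p, Continuous fun s : ℝ => Complex.exp (Complex.I * s * phase a b c p) :=
      fun p => by fun_prop
    have dΘ : ∀ (p : ℝ × ℝ) (t : ℝ), HasDerivAt (fun t : ℝ => -Complex.I *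
        ∫ s in (0 : ℝ)..t, Complex.exp (Complex.I * s * phase a b c p))
        (-Complex.I * Complex.exp (Complex.I * t * phase a b c p)) t := fun p t =>
      (intervalIntegral.integral_hasDerivAt_right ((cE p).intervalIntegrable _ _)
        ((cE p).stronglyMeasurableAtFilter _ _) (cE p).continuousAt).const_mul _
    have nΘ : ∀ (t : ℝ) (p : ℝ × ℝ), ‖-Complex.I *
        ∫ s in (0 : ℝ)..t, Complex.exp (Complex.I * s * phase a b c p)‖ ≤ |t| := fun t p => by
      rw [norm_mul, norm_neg, Complex.norm_I, one_mul]
      have := intervalIntegral.norm_integral_le_of_norm_le_const (a := 0) (b := t) (C := 1)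
        (f := fun s : ℝ => Complex.exp (Complex.I * s * phase a b c p))
        fun s _ => (norm_exp_I_mul_mul s _).le
      simpa using this
    -- Differentiation under the integral: the time derivative of the inner factor has modulus one,
    -- so the rest of the integrand is a dominating function for all times.
    have dY : ∀ t : ℝ, HasDerivAt (fun t => ∫ p : ℝ × ℝ,
        (conj (χ (p.1 + p.2)) * (F p.1 * G p.2 * m p)) *
          (-Complex.I * ∫ s in (0 : ℝ)..t, Complex.exp (Complex.I * s * phase a b c p)))
        (∫ p : ℝ × ℝ, (conj (χ (p.1 + p.2)) * (F p.1 * G p.2 * m p)) *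
          (-Complex.I * Complex.exp (Complex.I * t * phase a b c p))) t := fun t =>
      (hasDerivAt_integral_of_dominated_loc_of_deriv_le (s := univ) Filter.univ_mem
        (F' := fun t p => (conj (χ (p.1 + p.2)) * (F p.1 * G p.2 * m p)) *
          (-Complex.I * Complex.exp (Complex.I * t * phase a b c p)))
        (bound := fun p => ‖conj (χ (p.1 + p.2)) * (F p.1 * G p.2 * m p)‖)
        (.of_forall fun t => iK.aestronglyMeasurable.mul (cΘ t).aestronglyMeasurable)
        (iK.mul_bdd (cΘ t).aestronglyMeasurable (.of_forall (nΘ t)))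
        (iK.aestronglyMeasurable.mul (Continuous.aestronglyMeasurable (by fun_prop)))
        (.of_forall fun p s _ => by
          rw [norm_mul, norm_mul (-Complex.I), norm_exp_I_mul_mul, norm_neg, Complex.norm_I,
            one_mul, mul_one])
        iK.norm (.of_forall fun p s _ => (dΘ p s).const_mul _)).2
    intro t ht
    have key := eq_of_hasDerivWithinAt_zero
      (y := fun t => pairing (u t) (invFourier (propagate a t χ)) - ((√(2 * Real.pi) : ℝ) : ℂ) *
        ∫ p : ℝ × ℝ, (conj (χ (p.1 + p.2)) * (F p.1 * G p.2 * m p)) *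
          (-Complex.I * ∫ s in (0 : ℝ)..t, Complex.exp (Complex.I * s * phase a b c p)))
      (fun s h0 => by
        refine ((h.interaction.hasDerivWithinAt_pairing_propagate ha hχ hs h0).sub
          ((dY s).hasDerivWithinAt.const_mul _)).congr_deriv ?_
        rw [forcing s h0, pairing_bilinearExtension (integrable_propagate hb.continuous iF)
          (memLp_propagate hb.continuous mF) (integrable_propagate hc.continuous iG)
          (memLp_propagate hc.continuous mG) hm hB (contDiff_propagate ha hχ)
          (hasCompactSupport_propagate hs), sub_eq_zero, mul_left_comm, ← integral_const_mul]
        congr 1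
        refine integral_congr_ae (.of_forall fun p => ?_)
        have e : Complex.exp (-(Complex.I * s * a (p.1 + p.2))) *
            Complex.exp (Complex.I * s * b p.1) * Complex.exp (Complex.I * s * c p.2) =
            Complex.exp (Complex.I * s * phase a b c p) := by
          rw [← Complex.exp_add, ← Complex.exp_add, phase]
          push_cast
          ring_nf
        simp only [propagate, map_mul, conj_exp_I_mul_mul]
        rw [← e]
        ring) ht
    simp only [intervalIntegral.integral_same, mul_zero, integral_zero, sub_zero,
      h.interaction.initial] at key
    rw [sub_eq_iff_eq_add] at key
    rw [key, propagate_zero, pairing_invFourier _ (integrable_of_contDiff hχ hs)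
      (memLp_of_contDiff hχ hs)]
    have z0 : fourierL2 (0 : L2) =ᵐ[volume] 0 := by
      have h2 : ∫ ξ, ‖fourierL2 (0 : L2) ξ‖ ^ 2 = 0 := by
        rw [integral_norm_sq_fourierL2]; simp
      rw [integral_eq_zero_iff_of_nonneg (fun ξ => sq_nonneg _)
        ((memLp_two_iff_integrable_sq_norm (memLp_fourierL2 _).aestronglyMeasurable).1
          (memLp_fourierL2 _))] at h2
      filter_upwards [h2] with ξ hξ
      simpa using hξ
    rw [integral_congr_ae (g := fun _ => (0 : ℂ)) (by
      filter_upwards [z0] with ξ hξ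
      rw [hξ]; simp)]
    simp
  set μ : ℝ × ℝ → ℂ := fun p => m p * duhamelSymbol a b c t p with hμdef
  have cμ : Continuous μ :=
    hm.mul (continuous_duhamelSymbol ha.continuous hb.continuous hc.continuous t)
  have bμ : ∀ p, ‖μ p‖ ≤ B * |t| := fun p => by
    rw [norm_mul]
    exact mul_le_mul (hB p) (norm_duhamelSymbol_le t p) (norm_nonneg _)
      ((norm_nonneg _).trans (hB p))
  have iR := integrable_twistedConvolution iF iG cμ bμ
  have mR := memLp_twistedConvolution iF mF iG mG cμ bμ
  have hhat : fourierL2 (u t) =ᵐ[volume]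
      fun ζ => ((√(2 * Real.pi) : ℝ) : ℂ) * twistedConvolution μ F G ζ := by
    refine ae_eq_of_integral_mul_conj_eq ((memLp_fourierL2 _).locallyIntegrable (by norm_num))
      (iR.const_mul _).locallyIntegrable fun χ hχ hs => ?_
    obtain ⟨A, hA⟩ := hs.exists_bound_of_continuous hχ.continuous
    -- Testing with `e^{-ita}χ` undoes the moving frame at time `t` and restores the factor
    -- `e^{ita(ξ+η)}` of the Duhamel symbol.
    have key := dual _ (contDiff_propagate (t := -t) ha hχ)
      (hasCompactSupport_propagate (a := a) (t := -t) hs) t ht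
    rw [propagate_propagate, add_neg_cancel, propagate_zero, pairing_invFourier _
      (integrable_of_contDiff hχ hs) (memLp_of_contDiff hχ hs)] at key
    rw [key]
    simp_rw [mul_assoc (((√(2 * Real.pi) : ℝ) : ℂ))]
    rw [integral_const_mul]
    congr 1
    simp_rw [mul_comm (twistedConvolution μ F G _)]
    rw [integral_mul_twistedConvolution iF iG cμ bμ (κ := fun ζ => conj (χ ζ)) (A := A)
      (Complex.continuous_conj.comp hχ.continuous).aestronglyMeasurable (by simpa using hA)]
    refine integral_congr_ae (.of_forall fun p => ?_)
    have e : Complex.exp (-(Complex.I * ((-t : ℝ) : ℂ) * a (p.1 + p.2))) =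
        Complex.exp (Complex.I * t * a (p.1 + p.2)) := by
      congr 1; push_cast; ring
    simp only [hμdef, duhamelSymbol_eq, propagate, map_mul, conj_exp_I_mul_mul]
    rw [e]
    ring
  refine (eq_invFourier_of_fourierL2_eq (iR.const_mul _) (mR.const_mul _) hhat).trans ?_
  refine .of_forall fun x => ?_
  rw [← fourierExtension_twistedConvolution iF iG cμ bμ, invFourier_eq, fourierExtension,
    fourierExtension, ← integral_const_mul]
  refine integral_congr_ae (.of_forall fun ξ => ?_)
  simp only
  rw [mul_left_comm (Complex.exp _), inv_mul_cancel_left₀ sqrt_two_pi_ne_zero]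

theorem exists_cutoff {K : Set ℝ} (hK : IsCompact K) : ∃ χ : ℝ → ℂ, ContDiff ℝ ∞ χ ∧
    HasCompactSupport χ ∧ (∀ ξ, ‖χ ξ‖ ≤ 1) ∧ ∀ ξ ∈ K, χ ξ = 1 := by
  obtain ⟨r, hr⟩ := hK.isBounded.subset_closedBall 0
  let φ : ContDiffBump (0 : ℝ) := ⟨max r 1, max r 1 + 1, by positivity, by linarith⟩
  refine ⟨fun ξ => (φ ξ : ℂ), Complex.ofRealCLM.contDiff.comp φ.contDiff,
    φ.hasCompactSupport.comp_left (g := fun r : ℝ => (r : ℂ)) (by simp), fun ξ => ?_,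
    fun ξ hξ => ?_⟩
  · rw [Complex.norm_real, Real.norm_of_nonneg φ.nonneg]
    exact φ.le_one
  · have : φ ξ = 1 := φ.one_of_mem_closedBall
      (Metric.closedBall_subset_closedBall (le_max_left r 1) (hr hξ))
    simp [this]

theorem exists_cutoff_symbol {m : ℝ × ℝ → ℂ} (hs : HasCompactSupport m) : ∃ χ : ℝ → ℂ,
    ContDiff ℝ ∞ χ ∧ HasCompactSupport χ ∧ (∀ ξ, ‖χ ξ‖ ≤ 1) ∧
      (∀ p, m p ≠ 0 → χ p.1 = 1 ∧ χ p.2 = 1) ∧ ∀ p, m p ≠ 0 → χ (p.1 + p.2) = 1 := by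
  have hK : IsCompact ((Prod.fst '' tsupport m ∪ Prod.snd '' tsupport m) ∪
      (fun p : ℝ × ℝ => p.1 + p.2) '' tsupport m) :=
    ((hs.isCompact.image continuous_fst).union (hs.isCompact.image continuous_snd)).union
      (hs.isCompact.image (by fun_prop))
  obtain ⟨χ, h1, h2, h3, h4⟩ := exists_cutoff hK
  refine ⟨χ, h1, h2, h3, fun p hp => ⟨h4 _ ?_, h4 _ ?_⟩, fun p hp => h4 _ ?_⟩
  · exact .inl (.inl ⟨p, subset_tsupport m hp, rfl⟩)
  · exact .inl (.inr ⟨p, subset_tsupport m hp, rfl⟩)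
  · exact .inr ⟨p, subset_tsupport m hp, rfl⟩

/-! ### Dispersive and energy bounds for the Duhamel term -/

/-- The factor depends only on `ξ + η`, hence is constant on each line of integration: it acts as a
linear propagator on the output. -/
theorem twistedConvolution_mul_exp {μ : ℝ × ℝ → ℂ} {F G : ℝ → ℂ} (a : ℝ → ℝ) (t : ℝ) :
    twistedConvolution (fun p => μ p * Complex.exp (Complex.I * t * a (p.1 + p.2))) F G =
      propagate a t (twistedConvolution μ F G) := by
  funext ζ
  rw [propagate, twistedConvolution, twistedConvolution, ← integral_const_mul]
  refine integral_congr_ae (.of_forall fun ξ => ?_)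
  simp only [add_sub_cancel]
  ring

theorem bilinearExtension_propagate {μ : ℝ × ℝ → ℂ} {F G : ℝ → ℂ} (b c : ℝ → ℝ) (t : ℝ) :
    bilinearExtension μ (propagate b t F) (propagate c t G) =
      bilinearExtension (fun p => μ p * Complex.exp (Complex.I * (t * (b p.1 + c p.2) : ℝ))) F G := by
  funext x
  refine integral_congr_ae (.of_forall fun p => ?_)
  have e : Complex.exp (Complex.I * (t * (b p.1 + c p.2) : ℝ)) =
      Complex.exp (Complex.I * t * b p.1) * Complex.exp (Complex.I * t * c p.2) := by
    rw [← Complex.exp_add]; congr 1; push_cast; ring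
  simp only [propagate, e]
  ring

/-- `L¹` bound for the bilinear multiplier, uniformly in `F` and `G`. -/
theorem exists_integral_norm_bilinearExtension_le {m : ℝ × ℝ → ℂ} (hm : ContDiff ℝ ∞ m)
    (hs : HasCompactSupport m) : ∃ C : ℝ, 0 ≤ C ∧ ∀ F G : ℝ → ℂ, Integrable F → MemLp F 2 →
      Integrable G → MemLp G 2 → Integrable (bilinearExtension m F G) ∧
        ∫ x, ‖bilinearExtension m F G x‖ ≤ C * (l2norm F * l2norm G) := by
  obtain ⟨M, y, z, hM, hy, hz, h⟩ := exists_superposition hm hs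
  exact ⟨2 * Real.pi * ∫ q, ‖M q‖,
    mul_nonneg Real.two_pi_pos.le (integral_nonneg fun _ => norm_nonneg _),
    fun F G iF mF iG mG => integrable_bilinearExtension hM hy hz h iF mF iG mG⟩

/-- Dispersive estimate for the bilinear multiplier. -/
theorem exists_norm_bilinearExtension_exp_le {a : ℝ → ℝ} (ha : ContDiff ℝ ∞ a)
    (ha2 : BoundedAwayFromZero (iteratedDeriv 2 a)) {m : ℝ × ℝ → ℂ} (hm : ContDiff ℝ ∞ m)
    (hs : HasCompactSupport m) : ∃ C : ℝ, 0 ≤ C ∧ ∀ F G : ℝ → ℂ, Integrable F → MemLp F 2 →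
      Integrable G → MemLp G 2 → ∀ x t : ℝ, t ≠ 0 →
        ‖bilinearExtension (fun p => m p * Complex.exp (Complex.I * t * a (p.1 + p.2))) F G x‖ ≤
          C / √|t| * (l2norm F * l2norm G) := by
  obtain ⟨χ, hχ, hχs, hχ1, -, hχm⟩ := exists_cutoff_symbol hs
  obtain ⟨C₁, hC₁, h1⟩ := exists_norm_fourierExtension_exp_mul_le ha ha2 hχ hχs
  obtain ⟨C₂, hC₂, h2⟩ := exists_integral_norm_bilinearExtension_le hm hs
  obtain ⟨B, hB⟩ := hs.exists_bound_of_continuous hm.continuous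
  refine ⟨C₁ * C₂, mul_nonneg hC₁ hC₂, fun F G iF mF iG mG x t ht => ?_⟩
  have cm := hm.continuous
  have ca := ha.continuous
  set R := twistedConvolution m F G with hR
  have iR : Integrable R := integrable_twistedConvolution iF iG cm hB
  have mR : MemLp R 2 := memLp_twistedConvolution iF mF iG mG cm hB
  have hER : fourierExtension R = bilinearExtension m F G :=
    fourierExtension_twistedConvolution iF iG cm hB
  -- The density lives on sums of frequencies from the support of `m`, where `χ = 1`. A cutoff can
  -- thus be inserted for free, and it is the localized propagator that decays.
  have hRχ : ∀ ζ, R ζ * conj (χ ζ) = R ζ := by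
    intro ζ
    by_cases hζ : χ ζ = 1
    · simp [hζ]
    · have : R ζ = 0 := by
        rw [hR, twistedConvolution]
        refine integral_eq_zero_of_ae (.of_forall fun ξ => ?_)
        by_cases hp : m (ξ, ζ - ξ) = 0
        · simp [hp]
        · have := hχm _ hp
          simp only [add_sub_cancel] at this
          exact absurd this hζ
      simp [this]
  -- Evaluation of the evolved output at `x` is a pairing with `κ`, whose Fourier integral is the
  -- propagator kernel translated by `x`.
  let κ : ℝ → ℂ := fun ζ => Complex.exp (Complex.I * (-x : ℝ) * ζ) * propagate a (-t) χ ζ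
  have iκ : Integrable κ :=
    integrable_propagate (a := id) continuous_id (t := -x)
      (integrable_propagate ca (integrable_of_contDiff hχ hχs))
  have mκ : MemLp κ 2 :=
    memLp_propagate (a := id) continuous_id (t := -x)
      (memLp_propagate ca (memLp_of_contDiff hχ hχs))
  have hκ : ∀ y, ‖fourierExtension κ y‖ ≤ C₁ / √|t| := by
    intro y
    have := h1 (y - x) (-t) (neg_ne_zero.2 ht)
    rw [abs_neg] at this
    refine le_trans (le_of_eq ?_) this
    simp only [fourierExtension, κ]
    congr 1
    refine integral_congr_ae (.of_forall fun ζ => ?_)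
    simp only [propagate]
    rw [← mul_assoc, ← Complex.exp_add]
    push_cast
    ring_nf
  have bE : ∀ p : ℝ × ℝ, ‖m p * Complex.exp (Complex.I * t * a (p.1 + p.2))‖ ≤ B := fun p => by
    rw [norm_mul, norm_exp_I_mul_mul, mul_one]; exact hB p
  rw [← fourierExtension_twistedConvolution iF iG (by fun_prop) bE, twistedConvolution_mul_exp,
    fourierExtension]
  have e : ∀ ζ : ℝ, Complex.exp (Complex.I * x * ζ) * propagate a t (twistedConvolution m F G) ζ =
      R ζ * conj (κ ζ) := by
    intro ζ
    have e1 : Complex.exp (-(Complex.I * ((-x : ℝ) : ℂ) * ζ)) = Complex.exp (Complex.I * x * ζ) := by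
      congr 1; push_cast; ring
    have e2 : Complex.exp (-(Complex.I * ((-t : ℝ) : ℂ) * a ζ)) =
        Complex.exp (Complex.I * t * a ζ) := by
      congr 1; push_cast; ring
    simp only [κ, propagate, map_mul, conj_exp_I_mul_mul]
    rw [e1, e2, ← hR]
    linear_combination (-(Complex.exp (Complex.I * x * ζ) * Complex.exp (Complex.I * t * a ζ))) *
      hRχ ζ
  simp_rw [e]
  obtain ⟨h3, h4⟩ := h2 F G iF mF iG mG
  have := norm_integral_mul_conj_le iR mR iκ mκ hκ (by rw [hER]; exact h3)
  rw [hER] at this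
  refine this.trans ((mul_le_mul_of_nonneg_left h4 (by positivity)).trans (le_of_eq ?_))
  ring

theorem intervalIntegrable_inv_sqrt_of_nonneg {r : ℝ} (hr : 0 ≤ r) :
    IntervalIntegrable (fun s : ℝ => 1 / √|s|) volume 0 r ∧
      ∫ s in (0 : ℝ)..r, 1 / √|s| = 2 * √r := by
  have e : EqOn (fun s : ℝ => s ^ (-(1 / 2) : ℝ)) (fun s : ℝ => 1 / √|s|) (uIcc 0 r) := by
    intro s hs
    rw [uIcc_of_le hr] at hs
    simp only
    rw [abs_of_nonneg hs.1, Real.rpow_neg hs.1, Real.sqrt_eq_rpow, one_div ((_ : ℝ) ^ _)]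
  constructor
  · refine (intervalIntegral.intervalIntegrable_rpow' (r := -(1 / 2)) (by norm_num)).congr ?_
    exact fun s hs => e (uIoc_subset_uIcc hs)
  · rw [← intervalIntegral.integral_congr e, integral_rpow (.inl (by norm_num)),
      Real.sqrt_eq_rpow, Real.zero_rpow (by norm_num)]
    norm_num
    ring

/-- The two sides of the singularity give `2√r + 2√(t - r)`, so its location in `[0, t]` is
immaterial. This uniformity is what the energy estimate exploits. -/
theorem intervalIntegrable_inv_sqrt_sub {r t : ℝ} (hr : 0 ≤ r) (hrt : r ≤ t) :
    IntervalIntegrable (fun s : ℝ => 1 / √|r - s|) volume 0 t ∧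
      ∫ s in (0 : ℝ)..t, 1 / √|r - s| ≤ 4 * √t := by
  have h1 := intervalIntegrable_inv_sqrt_of_nonneg hr
  have h2 := intervalIntegrable_inv_sqrt_of_nonneg (sub_nonneg.2 hrt)
  have i1 : IntervalIntegrable (fun s : ℝ => 1 / √|r - s|) volume 0 r := by
    have := (h1.1.comp_sub_left r).symm
    simpa using this
  have i2 : IntervalIntegrable (fun s : ℝ => 1 / √|r - s|) volume r t := by
    have := h2.1.comp_sub_right r
    simp only [zero_add, sub_add_cancel] at this
    simpa only [abs_sub_comm] using this
  refine ⟨i1.trans i2, ?_⟩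
  rw [← intervalIntegral.integral_add_adjacent_intervals i1 i2]
  have e1 : ∫ s in (0 : ℝ)..r, 1 / √|r - s| = 2 * √r := by
    rw [intervalIntegral.integral_comp_sub_left (fun s => 1 / √|s|) r, sub_self, sub_zero, h1.2]
  have e2 : ∫ s in r..t, 1 / √|r - s| = 2 * √(t - r) := by
    simp_rw [abs_sub_comm r]
    rw [intervalIntegral.integral_comp_sub_right (fun s => 1 / √|s|) r, sub_self, h2.2]
  rw [e1, e2]
  have := Real.sqrt_le_sqrt hrt
  have := Real.sqrt_le_sqrt (show t - r ≤ t by linarith)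
  linarith

theorem integral_mul_duhamelSymbol {a b c : ℝ → ℝ} (ha : Continuous a) (hb : Continuous b)
    (hc : Continuous c) {K : ℝ × ℝ → ℂ} (hK : Integrable K) (t : ℝ) :
    ∫ p, K p * duhamelSymbol a b c t p = -Complex.I * ∫ s in (0 : ℝ)..t, ∫ p : ℝ × ℝ,
      K p * Complex.exp (Complex.I * ((t - s) * a (p.1 + p.2) + s * (b p.1 + c p.2) : ℝ)) := by
  rw [intervalIntegral_integral_swap, ← integral_const_mul]
  · refine integral_congr_ae (.of_forall fun p => ?_)
    simp only [duhamelSymbol]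
    rw [intervalIntegral.integral_const_mul]
    ring
  · have h1 : Integrable (fun w : ℝ × (ℝ × ℝ) => (1 : ℂ) * K w.2)
        ((volume.restrict (uIoc 0 t)).prod volume) := by
      refine Integrable.mul_prod (f := fun _ : ℝ => (1 : ℂ)) ?_ hK
      rw [uIoc]; exact integrable_const _
    refine (h1.mul_bdd (c := 1) (Continuous.aestronglyMeasurable (f := fun w : ℝ × (ℝ × ℝ) =>
      Complex.exp (Complex.I * ((t - w.1) * a (w.2.1 + w.2.2) + w.1 * (b w.2.1 + c w.2.2) : ℝ)))
      (by fun_prop)) (.of_forall fun w => ?_)).congr (.of_forall fun w => ?_)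
    · rw [mul_comm, Complex.norm_exp_ofReal_mul_I]
    · simp [Function.uncurry]

section duhamel

variable {a b c : ℝ → ℝ} {m : ℝ × ℝ → ℂ}

/-- Uniform bound for the Duhamel term, evolved backwards by a time `θ ∈ [0, t]`. -/
theorem exists_norm_bilinearExtension_duhamel_le (ha : ContDiff ℝ ∞ a) (hb : ContDiff ℝ ∞ b)
    (hc : ContDiff ℝ ∞ c) (ha2 : BoundedAwayFromZero (iteratedDeriv 2 a)) (hm : ContDiff ℝ ∞ m)
    (hs : HasCompactSupport m) : ∃ C : ℝ, 0 ≤ C ∧ ∀ F G : ℝ → ℂ, Integrable F → MemLp F 2 →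
      Integrable G → MemLp G 2 → ∀ t θ : ℝ, 0 ≤ θ → θ ≤ t → ∀ x,
        ‖bilinearExtension (fun p => m p * duhamelSymbol a b c t p *
          Complex.exp (Complex.I * (-θ : ℝ) * a (p.1 + p.2))) F G x‖ ≤
          C * √t * (l2norm F * l2norm G) := by
  obtain ⟨C, hC, h⟩ := exists_norm_bilinearExtension_exp_le ha ha2 hm hs
  obtain ⟨B, hB⟩ := hs.exists_bound_of_continuous hm.continuous
  refine ⟨C * 4, by positivity, fun F G iF mF iG mG t θ h0 hθ x => ?_⟩
  have cm := hm.continuous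
  have ca := ha.continuous
  have cb := hb.continuous
  have cc := hc.continuous
  have ht : 0 ≤ t := h0.trans hθ
  let K : ℝ × ℝ → ℂ := fun p => (Complex.exp (Complex.I * x * (p.1 + p.2)) *
    Complex.exp (Complex.I * (-θ : ℝ) * a (p.1 + p.2))) * (F p.1 * G p.2 * m p)
  have iK : Integrable K := by
    refine (integrable_mul_mul_symbol iF iG cm hB).bdd_mul (c := 1)
      (Continuous.aestronglyMeasurable (by fun_prop)) (.of_forall fun p => ?_)
    rw [norm_mul, norm_exp_I_mul_mul, ← Complex.ofReal_add, norm_exp_I_mul_mul, one_mul]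
  have e1 : bilinearExtension (fun p => m p * duhamelSymbol a b c t p *
      Complex.exp (Complex.I * (-θ : ℝ) * a (p.1 + p.2))) F G x =
      ∫ p, K p * duhamelSymbol a b c t p := by
    refine integral_congr_ae (.of_forall fun p => ?_)
    simp only [K]
    ring
  -- At each `s` the integrand is a bilinear term in the free waves at time `s`, evolved by `a` for
  -- the time `t - θ - s`, which may have either sign.
  have e2 : ∀ s : ℝ, ∫ p : ℝ × ℝ,
      K p * Complex.exp (Complex.I * ((t - s) * a (p.1 + p.2) + s * (b p.1 + c p.2) : ℝ)) =
      bilinearExtension (fun p => m p * Complex.exp (Complex.I * (t - θ - s : ℝ) * a (p.1 + p.2)))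
        (propagate b s F) (propagate c s G) x := by
    intro s
    rw [bilinearExtension_propagate]
    refine integral_congr_ae (.of_forall fun p => ?_)
    have e : Complex.exp (Complex.I * (-θ : ℝ) * a (p.1 + p.2)) *
        Complex.exp (Complex.I * ((t - s) * a (p.1 + p.2) + s * (b p.1 + c p.2) : ℝ)) =
        Complex.exp (Complex.I * (t - θ - s : ℝ) * a (p.1 + p.2)) *
        Complex.exp (Complex.I * (s * (b p.1 + c p.2) : ℝ)) := by
      rw [← Complex.exp_add, ← Complex.exp_add]
      congr 1
      push_cast
      ring
    simp only [K]
    linear_combination (Complex.exp (Complex.I * x * (p.1 + p.2)) * (F p.1 * G p.2 * m p)) * e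
  obtain ⟨h1, h2⟩ := intervalIntegrable_inv_sqrt_sub (sub_nonneg.2 hθ) (sub_le_self t h0)
  rw [e1, integral_mul_duhamelSymbol ca cb cc iK, norm_mul, norm_neg, Complex.norm_I, one_mul]
  simp_rw [e2]
  calc _ ≤ ∫ s in (0 : ℝ)..t, (C * (l2norm F * l2norm G)) * (1 / √|t - θ - s|) := by
        refine intervalIntegral.norm_integral_le_of_norm_le ht ?_ (h1.const_mul _)
        have hne : ∀ᵐ s : ℝ, s ≠ t - θ := by
          simp [ae_iff]
        filter_upwards [hne] with s hs _
        refine (h _ _ (integrable_propagate cb iF) (memLp_propagate cb mF)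
          (integrable_propagate cc iG) (memLp_propagate cc mG) x (t - θ - s)
          (sub_ne_zero.2 hs.symm)).trans (le_of_eq ?_)
        rw [l2norm_propagate, l2norm_propagate]
        ring
    _ = (C * (l2norm F * l2norm G)) * ∫ s in (0 : ℝ)..t, 1 / √|t - θ - s| :=
        intervalIntegral.integral_const_mul _ _
    _ ≤ (C * (l2norm F * l2norm G)) * (4 * √t) :=
        mul_le_mul_of_nonneg_left h2 (mul_nonneg hC (mul_nonneg l2norm_nonneg l2norm_nonneg))
    _ = _ := by ring

/-- Energy bound for the Duhamel term. -/
theorem exists_integral_norm_sq_duhamel_le (ha : ContDiff ℝ ∞ a) (hb : ContDiff ℝ ∞ b)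
    (hc : ContDiff ℝ ∞ c) (ha2 : BoundedAwayFromZero (iteratedDeriv 2 a)) (hm : ContDiff ℝ ∞ m)
    (hs : HasCompactSupport m) : ∃ C : ℝ, 0 ≤ C ∧ ∀ F G : ℝ → ℂ, Integrable F → MemLp F 2 →
      Integrable G → MemLp G 2 → ∀ t : ℝ, 0 ≤ t →
        ∫ ζ, ‖twistedConvolution (fun p => m p * duhamelSymbol a b c t p) F G ζ‖ ^ 2 ≤
          C * (√t * t) * (l2norm F * l2norm G) ^ 2 := by
  obtain ⟨C₁, hC₁, h1⟩ := exists_norm_bilinearExtension_duhamel_le ha hb hc ha2 hm hs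
  obtain ⟨C₂, hC₂, h2⟩ := exists_integral_norm_bilinearExtension_le hm hs
  obtain ⟨B, hB⟩ := hs.exists_bound_of_continuous hm.continuous
  refine ⟨C₁ * C₂, mul_nonneg hC₁ hC₂, fun F G iF mF iG mG t ht => ?_⟩
  have cm := hm.continuous
  have ca := ha.continuous
  have cb := hb.continuous
  have cc := hc.continuous
  set μ : ℝ × ℝ → ℂ := fun p => m p * duhamelSymbol a b c t p with hμdef
  have cμ : Continuous μ := cm.mul (continuous_duhamelSymbol ca cb cc t)
  have bμ : ∀ p, ‖μ p‖ ≤ B * |t| := fun p => by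
    rw [norm_mul]
    exact mul_le_mul (hB p) (norm_duhamelSymbol_le t p) (norm_nonneg _)
      ((norm_nonneg _).trans (hB p))
  set R := twistedConvolution μ F G with hR
  have iR : Integrable R := integrable_twistedConvolution iF iG cμ bμ
  have mR : MemLp R 2 := memLp_twistedConvolution iF mF iG mG cμ bμ
  have bR : ∀ ζ, ‖R ζ‖ ≤ B * |t| * (l2norm F * l2norm G) := norm_twistedConvolution_le mF mG bμ
  have hadd : Measure.QuasiMeasurePreserving (fun p : ℝ × ℝ => p.1 + p.2) volume volume := by
    have := (Measure.quasiMeasurePreserving_snd (μ := (volume : Measure ℝ))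
      (ν := (volume : Measure ℝ))).comp
      (measurePreserving_prod_add (volume : Measure ℝ) (volume : Measure ℝ)).quasiMeasurePreserving
    exact this
  let K : ℝ × ℝ → ℂ := fun p => conj (R (p.1 + p.2)) * (F p.1 * G p.2 * m p)
  have iK : Integrable K :=
    (integrable_mul_mul_symbol iF iG cm hB).bdd_mul (c := B * |t| * (l2norm F * l2norm G))
      (iR.aestronglyMeasurable.star.comp_quasiMeasurePreserving hadd)
      (.of_forall fun p => by rw [RCLike.norm_conj]; exact bR _)
  -- Only one copy of `R` is expanded by Duhamel; the other is kept as a test function.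
  have e1 : ((∫ ζ, ‖R ζ‖ ^ 2 : ℝ) : ℂ) = ∫ p, K p * duhamelSymbol a b c t p := by
    rw [integral_norm_sq_eq]
    simp_rw [mul_comm (R _)]
    rw [hR, integral_mul_twistedConvolution iF iG cμ bμ (κ := fun ζ => conj (R ζ))
      iR.aestronglyMeasurable.star (A := B * |t| * (l2norm F * l2norm G))
      (fun ζ => by rw [RCLike.norm_conj]; exact bR ζ)]
    refine integral_congr_ae (.of_forall fun p => ?_)
    simp only [K, hμdef]
    ring
  have e2 : ∀ s : ℝ, ∫ p : ℝ × ℝ,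
      K p * Complex.exp (Complex.I * ((t - s) * a (p.1 + p.2) + s * (b p.1 + c p.2) : ℝ)) =
      ∫ ζ, twistedConvolution m (propagate b s F) (propagate c s G) ζ *
        conj (propagate a (-(t - s)) R ζ) := by
    intro s
    simp_rw [mul_comm (twistedConvolution m _ _ _)]
    rw [integral_mul_twistedConvolution (integrable_propagate cb iF) (integrable_propagate cc iG)
      cm hB (κ := fun ζ => conj (propagate a (-(t - s)) R ζ))
      (aestronglyMeasurable_propagate ca iR.aestronglyMeasurable).star
      (A := B * |t| * (l2norm F * l2norm G))
      (fun ζ => by rw [RCLike.norm_conj, norm_propagate]; exact bR ζ)]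
    refine integral_congr_ae (.of_forall fun p => ?_)
    have e : Complex.exp (Complex.I * ((t - s) * a (p.1 + p.2) + s * (b p.1 + c p.2) : ℝ)) =
        Complex.exp (-(Complex.I * (-(t - s) : ℝ) * a (p.1 + p.2))) *
        Complex.exp (Complex.I * s * b p.1) * Complex.exp (Complex.I * s * c p.2) := by
      rw [← Complex.exp_add, ← Complex.exp_add]
      congr 1
      push_cast
      ring
    simp only [K, propagate, map_mul, conj_exp_I_mul_mul]
    rw [e]
    ring
  -- Duality of `L¹` and `L^∞` at each time: the forcing is bounded in `L¹`, and the solution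
  -- evolved back by `θ = t - s` is `O(√t)` in `L^∞`. Integrating over `[0, t]` yields `t^{3/2}` for
  -- the squared norm.
  have hbound : ∀ s ∈ uIoc 0 t, ‖∫ ζ, twistedConvolution m (propagate b s F) (propagate c s G) ζ *
        conj (propagate a (-(t - s)) R ζ)‖ ≤ C₁ * √t * (l2norm F * l2norm G) *
          (C₂ * (l2norm F * l2norm G)) := by
    intro s hs
    rw [uIoc_of_le ht] at hs
    have i1 := integrable_propagate (t := s) cb iF
    have i2 := integrable_propagate (t := s) cc iG
    have m1 := memLp_propagate (t := s) cb mF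
    have m2 := memLp_propagate (t := s) cc mG
    obtain ⟨h3, h4⟩ := h2 _ _ i1 m1 i2 m2
    have hER := fourierExtension_twistedConvolution i1 i2 cm hB
    have hA : ∀ x, ‖fourierExtension (propagate a (-(t - s)) R) x‖ ≤
        C₁ * √t * (l2norm F * l2norm G) := by
      intro x
      rw [hR, ← twistedConvolution_mul_exp, fourierExtension_twistedConvolution iF iG
        (by fun_prop) (B := B * |t|) (fun p => by
          rw [norm_mul, norm_exp_I_mul_mul, mul_one]; exact bμ p)]
      exact h1 F G iF mF iG mG t (t - s) (sub_nonneg.2 hs.2) (sub_le_self t hs.1.le) x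
    have := norm_integral_mul_conj_le (integrable_twistedConvolution i1 i2 cm hB)
      (memLp_twistedConvolution i1 m1 i2 m2 cm hB) (integrable_propagate (t := -(t - s)) ca iR)
      (memLp_propagate ca mR) hA (by rw [hER]; exact h3)
    rw [hER] at this
    rw [l2norm_propagate, l2norm_propagate] at h4
    exact this.trans (mul_le_mul_of_nonneg_left h4 ((norm_nonneg _).trans (hA 0)))
  have e3 : ∫ ζ, ‖R ζ‖ ^ 2 = ‖((∫ ζ, ‖R ζ‖ ^ 2 : ℝ) : ℂ)‖ := by
    rw [Complex.norm_real, Real.norm_of_nonneg (integral_nonneg fun _ => sq_nonneg _)]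
  rw [e3, e1, integral_mul_duhamelSymbol ca cb cc iK, norm_mul, norm_neg, Complex.norm_I, one_mul]
  simp_rw [e2]
  refine (intervalIntegral.norm_integral_le_of_norm_le_const hbound).trans (le_of_eq ?_)
  rw [sub_zero, abs_of_nonneg ht]
  ring

end duhamel

/-! ### Interpolation and the growth bound -/

/-- Interpolation between `L²` and `L^∞`. -/
theorem eLpNorm_le_of_le {h : ℝ → ℂ} {A B : ℝ} (hA : 0 ≤ A) (hB : 0 ≤ B)
    (hbd : ∀ᵐ x, ‖h x‖ ≤ A) (hi : MemLp h 2) (h2 : ∫ x, ‖h x‖ ^ 2 ≤ B ^ 2) {q : ℝ≥0∞}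
    (hq : 2 ≤ q) :
    eLpNorm h q volume ≤
      ENNReal.ofReal (B ^ (2 * (q⁻¹).toReal) * A ^ (1 - 2 * (q⁻¹).toReal)) := by
  have hbd' : ∀ᵐ x, ‖h x‖ₑ ≤ ENNReal.ofReal A := by
    filter_upwards [hbd] with x hx
    rw [← ofReal_norm]
    exact ENNReal.ofReal_le_ofReal hx
  rcases eq_or_ne q ∞ with rfl | hqt
  · simp only [ENNReal.inv_top, ENNReal.toReal_zero, mul_zero, Real.rpow_zero, one_mul, sub_zero,
      Real.rpow_one, eLpNorm_exponent_top]
    exact essSup_le_of_ae_le _ hbd'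
  · set r := q.toReal with hr
    have hq0 : q ≠ 0 := by rintro rfl; simp at hq
    have hr2 : 2 ≤ r := by
      have := ENNReal.toReal_mono hqt hq
      simpa using this
    have hinv : (q⁻¹).toReal = r⁻¹ := by rw [ENNReal.toReal_inv]
    have hl2 : ∫⁻ x, ‖h x‖ₑ ^ (2 : ℝ) ≤ ENNReal.ofReal (B ^ 2) := by
      refine le_trans (le_of_eq ?_) (ENNReal.ofReal_le_ofReal h2)
      rw [ofReal_integral_eq_lintegral_ofReal
        ((memLp_two_iff_integrable_sq_norm hi.aestronglyMeasurable).1 hi)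
        (.of_forall fun x => sq_nonneg _)]
      refine lintegral_congr fun x => ?_
      rw [← ofReal_norm, ENNReal.ofReal_rpow_of_nonneg (norm_nonneg _) (by norm_num)]
      norm_num
    rw [eLpNorm_eq_lintegral_rpow_enorm_toReal hq0 hqt, hinv, ← hr]
    -- Interpolation reduces to the pointwise inequality `|h|^r ≤ A^{r-2} |h|²`.
    have key : ∫⁻ x, ‖h x‖ₑ ^ r ≤ ENNReal.ofReal (B ^ 2 * A ^ (r - 2)) := by
      calc ∫⁻ x, ‖h x‖ₑ ^ r ≤ ∫⁻ x, ENNReal.ofReal A ^ (r - 2) * ‖h x‖ₑ ^ (2 : ℝ) := by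
            refine lintegral_mono_ae ?_
            filter_upwards [hbd'] with x hx
            calc ‖h x‖ₑ ^ r = ‖h x‖ₑ ^ (r - 2) * ‖h x‖ₑ ^ (2 : ℝ) := by
                  rw [← ENNReal.rpow_add_of_nonneg _ _ (by linarith) (by norm_num),
                    sub_add_cancel]
              _ ≤ _ := mul_le_mul_left (ENNReal.rpow_le_rpow hx (by linarith)) _
        _ = ENNReal.ofReal A ^ (r - 2) * ∫⁻ x, ‖h x‖ₑ ^ (2 : ℝ) :=
            lintegral_const_mul' _ _ (ENNReal.rpow_ne_top_of_nonneg (by linarith) (by simp))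
        _ ≤ ENNReal.ofReal A ^ (r - 2) * ENNReal.ofReal (B ^ 2) := by gcongr
        _ = _ := by
            rw [ENNReal.ofReal_rpow_of_nonneg hA (by linarith), mul_comm,
              ENNReal.ofReal_mul (by positivity)]
    calc (∫⁻ x, ‖h x‖ₑ ^ r) ^ (1 / r)
        ≤ ENNReal.ofReal (B ^ 2 * A ^ (r - 2)) ^ (1 / r) :=
          ENNReal.rpow_le_rpow key (by positivity)
      _ = ENNReal.ofReal ((B ^ 2 * A ^ (r - 2)) ^ (1 / r)) :=
          ENNReal.ofReal_rpow_of_nonneg (by positivity) (by positivity)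
      _ = _ := by
          congr 1
          rw [Real.mul_rpow (by positivity) (by positivity), ← Real.rpow_natCast,
            ← Real.rpow_mul hB, ← Real.rpow_mul hA]
          congr 2
          · push_cast; ring
          · field_simp

/-- Growth bound for the solution of the system. -/
theorem exists_eLpNorm_solution_le {a b c : ℝ → ℝ} {m : ℝ × ℝ → ℂ}
    (ha : ContDiff ℝ ∞ a) (hb : ContDiff ℝ ∞ b) (hc : ContDiff ℝ ∞ c)
    (ha2 : BoundedAwayFromZero (iteratedDeriv 2 a)) (hm : ContDiff ℝ ∞ m)
    (hs : HasCompactSupport m) :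
    ∃ C : ℝ, ∀ q : ℝ≥0∞, 2 ≤ q → ∀ (f g : L2) (u v w : ℝ → L2),
      IsSolution a b c m f g u v w → ∀ t : ℝ, 0 ≤ t →
        eLpNorm (u t) q volume ≤
          ENNReal.ofReal (C * t ^ (1 / 2 + (q⁻¹).toReal / 2) * ‖f‖ * ‖g‖) := by
  obtain ⟨C₁, hC₁, h1⟩ := exists_norm_bilinearExtension_duhamel_le ha hb hc ha2 hm hs
  obtain ⟨C₂, hC₂, h2⟩ := exists_integral_norm_sq_duhamel_le ha hb hc ha2 hm hs
  obtain ⟨B, hB⟩ := hs.exists_bound_of_continuous hm.continuous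
  obtain ⟨χ, hχ, hχs, hχ1, hχm, -⟩ := exists_cutoff_symbol hs
  -- One constant for both endpoints, which makes the final constant independent of `q`; the `2π`
  -- comes from Plancherel.
  set C := max C₁ (√(2 * Real.pi * C₂)) with hCdef
  have hC : 0 ≤ C := hC₁.trans (le_max_left _ _)
  have hC2 : 2 * Real.pi * C₂ ≤ C ^ 2 := by
    rw [← Real.sqrt_le_left hC]
    exact le_max_right _ _
  refine ⟨C, fun q hq f g u v w hsol t ht => ?_⟩
  set F : ℝ → ℂ := fun ξ => χ ξ * fourierL2 f ξ with hFdef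
  set G : ℝ → ℂ := fun ξ => χ ξ * fourierL2 g ξ with hGdef
  have iF : Integrable F := integrable_cutoff_mul hχ hχs (memLp_fourierL2 f)
  have iG : Integrable G := integrable_cutoff_mul hχ hχs (memLp_fourierL2 g)
  have mF : MemLp F 2 := memLp_cutoff_mul hχ hχ1 (memLp_fourierL2 f)
  have mG : MemLp G 2 := memLp_cutoff_mul hχ hχ1 (memLp_fourierL2 g)
  have nFG : l2norm F * l2norm G ≤ ‖f‖ * ‖g‖ := by
    rw [← l2norm_fourierL2 f, ← l2norm_fourierL2 g]
    exact mul_le_mul (l2norm_cutoff_mul_le hχ1 (memLp_fourierL2 f))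
      (l2norm_cutoff_mul_le hχ1 (memLp_fourierL2 g)) l2norm_nonneg l2norm_nonneg
  have hFG0 : 0 ≤ l2norm F * l2norm G := mul_nonneg l2norm_nonneg l2norm_nonneg
  set N := ‖f‖ * ‖g‖ with hN
  have cμ : Continuous fun p => m p * duhamelSymbol a b c t p := hm.continuous.mul
    (continuous_duhamelSymbol ha.continuous hb.continuous hc.continuous t)
  have bμ : ∀ p, ‖m p * duhamelSymbol a b c t p‖ ≤ B * |t| := fun p => by
    rw [norm_mul]
    exact mul_le_mul (hB p) (norm_duhamelSymbol_le t p) (norm_nonneg _)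
      ((norm_nonneg _).trans (hB p))
  have hu := hsol.eq_bilinearExtension ha hb hc hm.continuous hB hχ hχs hχ1 hχm ht
  rw [← hFdef, ← hGdef] at hu
  have hR := fourierExtension_twistedConvolution iF iG cμ bμ
  have iR := integrable_twistedConvolution iF iG cμ bμ
  have mR := memLp_twistedConvolution iF mF iG mG cμ bμ
  rw [eLpNorm_congr_ae hu]
  have hsup : ∀ x, ‖bilinearExtension (fun p => m p * duhamelSymbol a b c t p) F G x‖ ≤
      C * N * t ^ (1 / 2 : ℝ) := by
    intro x
    have := h1 F G iF mF iG mG t 0 le_rfl ht x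
    simp only [neg_zero, Complex.ofReal_zero, mul_zero, zero_mul, Complex.exp_zero, mul_one] at this
    refine this.trans ?_
    rw [← Real.sqrt_eq_rpow]
    calc C₁ * √t * (l2norm F * l2norm G) ≤ C * √t * N := by
          gcongr
          exact le_max_left _ _
      _ = _ := by ring
  have hL2 : ∫ x, ‖bilinearExtension (fun p => m p * duhamelSymbol a b c t p) F G x‖ ^ 2 ≤
      (C * N * t ^ (3 / 4 : ℝ)) ^ 2 := by
    rw [← hR, integral_norm_sq_fourierExtension iR mR]
    have e : (t ^ (3 / 4 : ℝ)) ^ 2 = √t * t := by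
      rw [← Real.rpow_natCast, ← Real.rpow_mul ht, Real.sqrt_eq_rpow]
      nth_rewrite 3 [← Real.rpow_one t]
      rw [← Real.rpow_add_of_nonneg ht (by norm_num) (by norm_num)]
      norm_num
    calc _ ≤ 2 * Real.pi * (C₂ * (√t * t) * (l2norm F * l2norm G) ^ 2) :=
          mul_le_mul_of_nonneg_left (h2 F G iF mF iG mG t ht) Real.two_pi_pos.le
      _ = (2 * Real.pi * C₂) * (√t * t) * (l2norm F * l2norm G) ^ 2 := by ring
      _ ≤ C ^ 2 * (√t * t) * N ^ 2 := by gcongr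
      _ = _ := by rw [mul_pow, mul_pow, e]; ring
  have := eLpNorm_le_of_le (by positivity) (by positivity) (.of_forall hsup)
    (by rw [← hR]; exact memLp_fourierExtension iR mR) hL2 hq
  refine this.trans (le_of_eq ?_)
  congr 1
  set θ := (q⁻¹).toReal with hθ
  have hθ0 : 0 ≤ θ := ENNReal.toReal_nonneg
  have hθ2 : 2 * θ ≤ 1 := by
    have h3 : q⁻¹ ≤ 2⁻¹ := ENNReal.inv_le_inv.2 hq
    have h4 := ENNReal.toReal_mono (by simp) h3
    rw [ENNReal.toReal_inv 2] at h4
    simp only [ENNReal.toReal_ofNat] at h4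
    linarith
  -- The powers of time combine as `(3/4)(2θ) + (1/2)(1 - 2θ) = 1/2 + θ/2` with `θ = 1/q`, and those
  -- of `C * N` add up to one.
  rw [Real.mul_rpow (x := C * N) (by positivity) (by positivity),
    Real.mul_rpow (x := C * N) (by positivity) (by positivity),
    ← Real.rpow_mul ht, ← Real.rpow_mul ht, mul_mul_mul_comm,
    ← Real.rpow_add_of_nonneg (by positivity) (by linarith) (by linarith),
    ← Real.rpow_add_of_nonneg ht (by linarith) (by linarith),
    show 2 * θ + (1 - 2 * θ) = 1 by ring, Real.rpow_one,
    show 3 / 4 * (2 * θ) + 1 / 2 * (1 - 2 * θ) = 1 / 2 + θ / 2 by ring]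
  ring

/-! ### Almost orthogonality and a nonendpoint Strichartz estimate -/

theorem sum_range_inv_sqrt_le (N : ℕ) :
    ∑ j ∈ Finset.range N, 1 / √((j : ℝ) + 1) ≤ 2 * √(N : ℝ) := by
  induction N with
  | zero => simp
  | succ N ih =>
    rw [Finset.sum_range_succ]
    have h1 : 0 < √((N : ℝ) + 1) := Real.sqrt_pos.2 (by positivity)
    have h2 : √((N : ℝ) + 1) ^ 2 = N + 1 := Real.sq_sqrt (by positivity)
    have h3 : √(N : ℝ) ^ 2 = N := Real.sq_sqrt (by positivity)
    have h4 : 1 / √((N : ℝ) + 1) ≤ 2 * (√((N : ℝ) + 1) - √(N : ℝ)) := by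
      rw [div_le_iff₀ h1]
      nlinarith [sq_nonneg (√((N : ℝ) + 1) - √(N : ℝ))]
    push_cast
    linarith

/-- Sums of the kernel `(1 + |n - k|)^{-1/2}` over a finite set of integers. -/
theorem sum_inv_sqrt_dist_le (S : Finset ℕ) (n : ℕ) :
    ∑ k ∈ S, 1 / √((Nat.dist n k : ℝ) + 1) ≤ 5 * √(S.card : ℝ) := by
  set N := S.card with hN
  let f : ℕ → ℝ := fun j => 1 / √((j : ℝ) + 1)
  have hf0 : ∀ j, 0 ≤ f j := fun j => by positivity
  -- On either side of `n` the distances are distinct, so near points contribute at most `2√N` per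
  -- side. The at most `N` far points contribute `1/√N` each, whence `5 = 2 + 2 + 1`.
  have near : ∀ T : Finset ℕ, (∀ k ∈ T, Nat.dist n k < N) →
      Set.InjOn (fun k => Nat.dist n k) T → ∑ k ∈ T, f (Nat.dist n k) ≤ 2 * √(N : ℝ) := by
    intro T hT hinj
    rw [← Finset.sum_image (f := f) hinj]
    refine le_trans (Finset.sum_le_sum_of_subset_of_nonneg (fun j hj => ?_)
      fun j _ _ => hf0 j) (sum_range_inv_sqrt_le N)
    obtain ⟨k, hk, rfl⟩ := Finset.mem_image.1 hj
    exact Finset.mem_range.2 (hT k hk)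
  have h1 := near (S.filter fun k => n ≤ k ∧ Nat.dist n k < N)
    (fun k hk => (Finset.mem_filter.1 hk).2.2) (by
      intro k hk l hl h
      have hk := (Finset.mem_filter.1 hk).2.1
      have hl := (Finset.mem_filter.1 hl).2.1
      simp only [Nat.dist] at h
      omega)
  have h2 := near (S.filter fun k => ¬ n ≤ k ∧ Nat.dist n k < N)
    (fun k hk => (Finset.mem_filter.1 hk).2.2) (by
      intro k hk l hl h
      have hk := (Finset.mem_filter.1 hk).2.1
      have hl := (Finset.mem_filter.1 hl).2.1
      simp only [Nat.dist] at h
      omega)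
  have h3 : ∑ k ∈ S.filter (fun k => ¬ Nat.dist n k < N), f (Nat.dist n k) ≤ √(N : ℝ) := by
    have hb : ∀ k ∈ S.filter (fun k => ¬ Nat.dist n k < N), f (Nat.dist n k) ≤ 1 / √(N : ℝ) := by
      intro k hk
      have hkS := (Finset.mem_filter.1 hk).1
      have hk := not_lt.1 (Finset.mem_filter.1 hk).2
      have hNpos : 0 < N := Finset.card_pos.2 ⟨k, hkS⟩
      have : (N : ℝ) ≤ (Nat.dist n k : ℝ) + 1 := by
        have : (N : ℝ) ≤ Nat.dist n k := by exact_mod_cast hk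
        linarith
      exact one_div_le_one_div_of_le (Real.sqrt_pos.2 (by exact_mod_cast hNpos))
        (Real.sqrt_le_sqrt this)
    refine (Finset.sum_le_card_nsmul _ _ _ hb).trans ?_
    rw [nsmul_eq_mul]
    calc ((S.filter (fun k => ¬ Nat.dist n k < N)).card : ℝ) * (1 / √(N : ℝ))
        ≤ N * (1 / √(N : ℝ)) := by
          gcongr
          exact Finset.card_filter_le _ _
      _ = √(N : ℝ) := by rw [mul_one_div, Real.div_sqrt]
  have hsplit : ∑ k ∈ S, f (Nat.dist n k) =
      ∑ k ∈ S.filter (fun k => n ≤ k ∧ Nat.dist n k < N), f (Nat.dist n k) +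
      ∑ k ∈ S.filter (fun k => ¬ n ≤ k ∧ Nat.dist n k < N), f (Nat.dist n k) +
      ∑ k ∈ S.filter (fun k => ¬ Nat.dist n k < N), f (Nat.dist n k) := by
    rw [← Finset.sum_filter_add_sum_filter_not S (fun k => Nat.dist n k < N)]
    congr 1
    rw [← Finset.sum_filter_add_sum_filter_not (S.filter _) (fun k => n ≤ k),
      Finset.filter_filter, Finset.filter_filter]
    simp only [and_comm]
  change ∑ k ∈ S, f (Nat.dist n k) ≤ _
  rw [hsplit]
  linarith

/-- The wave packets `χ(ξ) e^{ixξ} e^{itb(ξ)}` are almost orthogonal. -/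
theorem exists_norm_integral_packet_le {b : ℝ → ℝ} (hb : ContDiff ℝ ∞ b)
    (hb2 : BoundedAwayFromZero (iteratedDeriv 2 b)) {χ : ℝ → ℂ} (hχ : ContDiff ℝ ∞ χ)
    (hs : HasCompactSupport χ) : ∃ C : ℝ, 0 ≤ C ∧ ∀ (n k : ℕ) (t t' x x' : ℝ),
      t ∈ Icc (n : ℝ) (n + 1) → t' ∈ Icc (k : ℝ) (k + 1) →
      ‖∫ ξ : ℝ, (Complex.exp (Complex.I * x * ξ) * propagate b t χ ξ) *
        conj (Complex.exp (Complex.I * x' * ξ) * propagate b t' χ ξ)‖ ≤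
        C * (1 / √((Nat.dist n k : ℝ) + 1)) := by
  have hω : ContDiff ℝ ∞ fun ξ => χ ξ * conj (χ ξ) :=
    hχ.mul (Complex.conjCLE.contDiff.comp hχ)
  have hωs : HasCompactSupport fun ξ => χ ξ * conj (χ ξ) := hs.mul_right
  obtain ⟨C₁, hC₁, h1⟩ := exists_norm_fourierExtension_exp_mul_le hb hb2 hω hωs
  set C₀ := ∫ ξ, ‖χ ξ * conj (χ ξ)‖ with hC₀
  have hC₀0 : 0 ≤ C₀ := integral_nonneg fun _ => norm_nonneg _
  refine ⟨2 * (C₀ + C₁), by positivity, fun n k t t' x x' ht ht' => ?_⟩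
  have e : ∀ ξ : ℝ, (Complex.exp (Complex.I * x * ξ) * propagate b t χ ξ) *
      conj (Complex.exp (Complex.I * x' * ξ) * propagate b t' χ ξ) =
      Complex.exp (Complex.I * (x - x' : ℝ) * ξ) *
        (Complex.exp (Complex.I * (t - t' : ℝ) * b ξ) * (χ ξ * conj (χ ξ))) := by
    intro ξ
    have e1 : Complex.exp (Complex.I * (x - x' : ℝ) * ξ) =
        Complex.exp (Complex.I * x * ξ) * Complex.exp (-(Complex.I * x' * ξ)) := by
      rw [← Complex.exp_add]; congr 1; push_cast; ring
    have e2 : Complex.exp (Complex.I * (t - t' : ℝ) * b ξ) =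
        Complex.exp (Complex.I * t * b ξ) * Complex.exp (-(Complex.I * t' * b ξ)) := by
      rw [← Complex.exp_add]; congr 1; push_cast; ring
    simp only [propagate, map_mul, conj_exp_I_mul_mul]
    rw [e1, e2]
    ring
  simp_rw [e]
  have hsq : 0 < √((Nat.dist n k : ℝ) + 1) := Real.sqrt_pos.2 (by positivity)
  rw [mul_one_div]
  -- For equal or adjacent intervals `t - t'` may vanish and only the trivial bound is available. At
  -- distance `d ≥ 2` one has `|t - t'| ≥ d - 1 ≥ (d + 1)/4`.
  rcases Nat.lt_or_ge (Nat.dist n k) 2 with hd | hd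
  · have h3 : ‖∫ ξ : ℝ, Complex.exp (Complex.I * (x - x' : ℝ) * ξ) *
        (Complex.exp (Complex.I * (t - t' : ℝ) * b ξ) * (χ ξ * conj (χ ξ)))‖ ≤ C₀ := by
      refine (norm_integral_le_integral_norm _).trans (le_of_eq ?_)
      simp only [norm_mul, norm_exp_I_mul_mul, one_mul, hC₀]
    have h4 : √((Nat.dist n k : ℝ) + 1) ≤ 2 := by
      rw [Real.sqrt_le_left (by norm_num)]
      have : (Nat.dist n k : ℝ) ≤ 1 := by exact_mod_cast Nat.lt_succ_iff.1 hd
      linarith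
    rw [le_div_iff₀ hsq]
    calc _ ≤ C₀ * 2 := mul_le_mul h3 h4 hsq.le hC₀0
      _ ≤ _ := by linarith
  · have hdR : (2 : ℝ) ≤ Nat.dist n k := by exact_mod_cast hd
    have hdist : (Nat.dist n k : ℝ) = |(n : ℝ) - k| := by
      rcases le_total n k with h | h
      · rw [Nat.dist_eq_sub_of_le h, Nat.cast_sub h, abs_of_nonpos]
        · ring
        · have : (n : ℝ) ≤ k := by exact_mod_cast h
          linarith
      · rw [Nat.dist_eq_sub_of_le_right h, Nat.cast_sub h, abs_of_nonneg]
        have : (k : ℝ) ≤ n := by exact_mod_cast h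
        linarith
    have h5 : (Nat.dist n k : ℝ) - 1 ≤ |t - t'| := by
      rw [hdist]
      have : |(n : ℝ) - k| ≤ |t - t'| + 1 := by
        have h6 : (n : ℝ) - k = (t - t') + ((t' - k) - (t - n)) := by ring
        have h7 : |(t' - k) - (t - n)| ≤ 1 := by
          rw [abs_le]
          constructor <;> linarith [ht.1, ht.2, ht'.1, ht'.2]
        calc |(n : ℝ) - k| ≤ |t - t'| + |(t' - k) - (t - n)| := by rw [h6]; exact abs_add_le _ _
          _ ≤ _ := by linarith
      linarith
    have h8 : ((Nat.dist n k : ℝ) + 1) / 4 ≤ |t - t'| := by linarith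
    have hne : t - t' ≠ 0 := by
      intro h0
      rw [h0, abs_zero] at h8
      linarith
    have h9 := h1 (x - x') (t - t') hne
    rw [fourierExtension] at h9
    refine h9.trans ?_
    have h10 : √((Nat.dist n k : ℝ) + 1) / 2 ≤ √|t - t'| := by
      have := Real.sqrt_le_sqrt h8
      rw [Real.sqrt_div (by positivity), show (4 : ℝ) = 2 ^ 2 by norm_num,
        Real.sqrt_sq (by norm_num)] at this
      exact this
    calc C₁ / √|t - t'| ≤ C₁ / (√((Nat.dist n k : ℝ) + 1) / 2) :=
          div_le_div_of_nonneg_left hC₁ (by positivity) h10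
      _ = (2 * C₁) / √((Nat.dist n k : ℝ) + 1) := by field_simp
      _ ≤ _ := by gcongr; linarith

/-- Weak-type space-time bound for the localized linear evolution, sampled once per unit of time. -/
theorem exists_card_le_of_lt_norm {b : ℝ → ℝ} (hb : ContDiff ℝ ∞ b)
    (hb2 : BoundedAwayFromZero (iteratedDeriv 2 b)) {χ : ℝ → ℂ} (hχ : ContDiff ℝ ∞ χ)
    (hs : HasCompactSupport χ) : ∃ C : ℝ, 0 ≤ C ∧ ∀ F : ℝ → ℂ, MemLp F 2 →
      ∀ (S : Finset ℕ) (t x : ℕ → ℝ) (l : ℝ), 0 < l → (∀ n ∈ S, t n ∈ Icc (n : ℝ) (n + 1) ∧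
        l ≤ ‖fourierExtension (propagate b (t n) fun ξ => χ ξ * F ξ) (x n)‖) →
        (S.card : ℝ) ≤ C * l2norm F ^ 4 / l ^ 4 := by
  obtain ⟨C, hC, h⟩ := exists_norm_integral_packet_le hb hb2 hχ hs
  refine ⟨(5 * C) ^ 2, by positivity, fun F mF S t x l hl hS => ?_⟩
  set V : ℕ → ℂ := fun n => fourierExtension (propagate b (t n) fun ξ => χ ξ * F ξ) (x n) with hV
  let e : ℕ → ℝ → ℂ := fun n ξ => Complex.exp (Complex.I * x n * ξ) * propagate b (t n) χ ξ
  have me : ∀ n, MemLp (e n) 2 := fun n =>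
    memLp_propagate (a := id) continuous_id (t := x n)
      (memLp_propagate hb.continuous (memLp_of_contDiff hχ hs))
  have hVe : ∀ n, V n = ∫ ξ, e n ξ * F ξ := by
    intro n
    refine integral_congr_ae (.of_forall fun ξ => ?_)
    simp only [e, propagate]
    ring
  -- Unimodular factors aligning the samples turn the sum of their moduli into a single pairing of
  -- `F` with the packet `W`.
  choose θ hθ1 hθ2 using fun n => (show ∃ θ : ℂ, ‖θ‖ = 1 ∧ θ * V n = ‖V n‖ by
    by_cases h0 : V n = 0
    · exact ⟨1, by simp, by simp [h0]⟩
    · refine ⟨conj (V n) / ‖V n‖, ?_, ?_⟩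
      · simp [h0]
      · have : (‖V n‖ : ℂ) ≠ 0 := by simpa using h0
        rw [div_mul_eq_mul_div, Complex.conj_mul', div_eq_iff this]
        ring)
  let W : ℝ → ℂ := fun ξ => ∑ n ∈ S, θ n * e n ξ
  have mW : MemLp W 2 := by
    have := memLp_finsetSum' S (f := fun n ξ => θ n * e n ξ) (p := 2) (μ := volume)
      fun n _ => (me n).const_mul (θ n)
    refine this.ae_eq (.of_forall fun ξ => ?_)
    simp [W]
  have hsum : ((∑ n ∈ S, ‖V n‖ : ℝ) : ℂ) = ∫ ξ, W ξ * F ξ := by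
    push_cast
    simp only [W, Finset.sum_mul]
    have hi : ∀ n, Integrable fun ξ => θ n * e n ξ * F ξ :=
      fun n => ((me n).const_mul (θ n)).integrable_mul mF
    rw [integral_finsetSum _ fun n _ => hi n]
    refine Finset.sum_congr rfl fun n _ => ?_
    rw [← hθ2, hVe, ← integral_const_mul]
    refine integral_congr_ae (.of_forall fun ξ => ?_)
    ring
  have hle : ∑ n ∈ S, ‖V n‖ ≤ l2norm W * l2norm F := by
    have := norm_integral_mul_le mW mF
    rw [← hsum, Complex.norm_real, Real.norm_of_nonneg (Finset.sum_nonneg fun _ _ => norm_nonneg _)]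
      at this
    exact this
  -- The `TT*` step: `‖W‖²` is a double sum with kernel `(1 + |n - k|)^{-1/2}`, hence `O(N^{3/2})`
  -- rather than the trivial `O(N²)`.
  have hWW : l2norm W ^ 2 ≤ S.card * (C * (5 * √(S.card : ℝ))) := by
    have h1 : ((l2norm W ^ 2 : ℝ) : ℂ) =
        ∑ n ∈ S, ∑ k ∈ S, θ n * conj (θ k) * ∫ ξ, e n ξ * conj (e k ξ) := by
      rw [l2norm_sq, integral_norm_sq_eq]
      have : ∀ ξ, W ξ * conj (W ξ) =
          ∑ n ∈ S, ∑ k ∈ S, θ n * conj (θ k) * (e n ξ * conj (e k ξ)) := by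
        intro ξ
        simp only [W, map_sum, Finset.sum_mul_sum, map_mul]
        refine Finset.sum_congr rfl fun n _ => Finset.sum_congr rfl fun k _ => ?_
        ring
      simp_rw [this]
      have hi : ∀ n k, Integrable fun ξ => θ n * conj (θ k) * (e n ξ * conj (e k ξ)) :=
        fun n k => ((me n).integrable_mul (me k).star).const_mul _
      rw [integral_finsetSum _ fun n _ => integrable_finsetSum _ fun k _ => hi n k]
      refine Finset.sum_congr rfl fun n _ => ?_
      rw [integral_finsetSum _ fun k _ => hi n k]
      refine Finset.sum_congr rfl fun k _ => ?_
      rw [integral_const_mul]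
    have h2 : l2norm W ^ 2 = ‖((l2norm W ^ 2 : ℝ) : ℂ)‖ := by
      rw [Complex.norm_real, Real.norm_of_nonneg (sq_nonneg _)]
    rw [h2, h1]
    calc _ ≤ ∑ n ∈ S, ∑ k ∈ S, ‖θ n * conj (θ k) * ∫ ξ, e n ξ * conj (e k ξ)‖ :=
          (norm_sum_le _ _).trans (Finset.sum_le_sum fun n _ => norm_sum_le _ _)
      _ ≤ ∑ n ∈ S, ∑ k ∈ S, C * (1 / √((Nat.dist n k : ℝ) + 1)) := by
          refine Finset.sum_le_sum fun n hn => Finset.sum_le_sum fun k hk => ?_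
          rw [norm_mul, norm_mul, RCLike.norm_conj, hθ1, hθ1, one_mul, one_mul]
          exact h n k (t n) (t k) (x n) (x k) (hS n hn).1 (hS k hk).1
      _ ≤ ∑ n ∈ S, C * (5 * √(S.card : ℝ)) := by
          refine Finset.sum_le_sum fun n _ => ?_
          rw [← Finset.mul_sum]
          exact mul_le_mul_of_nonneg_left (sum_inv_sqrt_dist_le S n) hC
      _ = _ := by rw [Finset.sum_const, nsmul_eq_mul]
  have hlow : S.card * l ≤ ∑ n ∈ S, ‖V n‖ := by
    have := Finset.card_nsmul_le_sum S (fun n => ‖V n‖) l fun n hn => (hS n hn).2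
    rwa [nsmul_eq_mul] at this
  set N : ℝ := (S.card : ℝ) with hN
  have hN0 : 0 ≤ N := Nat.cast_nonneg _
  rcases hN0.eq_or_lt with h0 | hNpos
  · rw [← h0]
    positivity
  set r := √N with hr
  have hrN : r ^ 2 = N := Real.sq_sqrt hN0
  have h3 : (N * l) ^ 2 ≤ (N * (C * (5 * r))) * l2norm F ^ 2 := by
    calc (N * l) ^ 2 ≤ (l2norm W * l2norm F) ^ 2 :=
          pow_le_pow_left₀ (by positivity) (hlow.trans hle) 2
      _ = l2norm W ^ 2 * l2norm F ^ 2 := by ring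
      _ ≤ _ := mul_le_mul_of_nonneg_right hWW (sq_nonneg _)
  -- From `N l ≤ ‖W‖ ‖F‖` and `‖W‖² ≤ 5 C N^{3/2}`, after cancelling `N^{3/2}`. Squaring gives the
  -- weak `ℓ⁴` bound.
  have h4 : r * l ^ 2 ≤ 5 * C * l2norm F ^ 2 := by
    have h5 : (N * r) * (r * l ^ 2) ≤ (N * r) * (5 * C * l2norm F ^ 2) := by
      calc (N * r) * (r * l ^ 2) = N * r ^ 2 * l ^ 2 := by ring
        _ = (N * l) ^ 2 := by rw [hrN]; ring
        _ ≤ _ := h3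
        _ = _ := by ring
    exact le_of_mul_le_mul_left h5 (by positivity)
  rw [le_div_iff₀ (by positivity)]
  calc N * l ^ 4 = (r * l ^ 2) ^ 2 := by rw [mul_pow, hrN]; ring
    _ ≤ (5 * C * l2norm F ^ 2) ^ 2 := pow_le_pow_left₀ (by positivity) h4 2
    _ = _ := by ring

/-- A weak-type `ℓ⁴` bound and a sup bound give `ℓ^ρ` for `ρ > 4`. -/
theorem tsum_rpow_le_of_card_le {s : ℕ → ℝ≥0∞} {A D r : ℝ} (hA : 0 ≤ A) (hD : 0 ≤ D)
    (hr : 4 < r) (hs : ∀ n, s n ≤ ENNReal.ofReal A)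
    (hcard : ∀ (S : Finset ℕ) (l : ℝ), 0 < l → (∀ n ∈ S, ENNReal.ofReal l < s n) →
      (S.card : ℝ) ≤ D / l ^ 4) :
    ∑' n, s n ^ r ≤ ENNReal.ofReal (r * (D * (A ^ (r - 4) / (r - 4)))) := by
  have hst : ∀ n, s n ≠ ⊤ := fun n => ((hs n).trans_lt ENNReal.ofReal_lt_top).ne
  have hr0 : 0 < r := by linarith
  have h1 : ∑' n, s n ^ r = ∫⁻ n, ENNReal.ofReal ((s n).toReal ^ r) ∂Measure.count := by
    rw [lintegral_count]
    refine tsum_congr fun n => ?_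
    rw [← ENNReal.ofReal_rpow_of_nonneg ENNReal.toReal_nonneg hr0.le, ENNReal.ofReal_toReal (hst n)]
  have hcount : ∀ t : ℝ, 0 < t → Measure.count {n | t < (s n).toReal} ≤
      ENNReal.ofReal (D / t ^ 4) := by
    intro t ht
    have hS : ∀ S : Finset ℕ, (S : Set ℕ) ⊆ {n | t < (s n).toReal} → (S.card : ℝ) ≤ D / t ^ 4 :=
      fun S hS => hcard S t ht fun n hn => by
        have : t < (s n).toReal := hS hn
        rwa [ENNReal.ofReal_lt_iff_lt_toReal ht.le (hst n)]
    have hfin : {n | t < (s n).toReal}.Finite := by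
      by_contra hinf
      obtain ⟨S, hS1, hS2⟩ := Set.Infinite.exists_subset_card_eq hinf (⌊D / t ^ 4⌋₊ + 1)
      have := hS S hS1
      rw [hS2] at this
      have h3 := Nat.lt_floor_add_one (D / t ^ 4)
      push_cast at this
      linarith
    rw [Measure.count_apply_finite _ hfin, ← ENNReal.ofReal_natCast]
    exact ENNReal.ofReal_le_ofReal (hS _ (by simp))
  rw [h1, lintegral_rpow_eq_lintegral_meas_lt_mul _ (.of_forall fun n => ENNReal.toReal_nonneg)
    (measurable_of_countable _).aemeasurable hr0, ENNReal.ofReal_mul hr0.le]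
  refine mul_le_mul_right ?_ _
  -- In the layer-cake integral the level sets are empty above `A`, and below it the integrand is `D
  -- t^{r-5}`, integrable at zero because `r > 4`.
  have h4 : ∀ t ∈ Ioi (0 : ℝ), Measure.count {n | t < (s n).toReal} * ENNReal.ofReal (t ^ (r - 1)) ≤
      (Iic A).indicator (fun t => ENNReal.ofReal (D * t ^ (r - 5))) t := by
    intro t ht
    have ht : 0 < t := ht
    by_cases htA : t ≤ A
    · rw [indicator_of_mem (show t ∈ Iic A from htA)]
      refine (mul_le_mul_left (hcount t ht) _).trans (le_of_eq ?_)
      rw [← ENNReal.ofReal_mul (by positivity)]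
      congr 1
      rw [show r - 1 = (r - 5) + (4 : ℕ) by push_cast; ring, Real.rpow_add_natCast ht.ne']
      field_simp
    · have : {n | t < (s n).toReal} = ∅ := by
        ext n
        simp only [mem_ofPred_eq, mem_empty_iff_false, iff_false, not_lt]
        refine le_trans ?_ (not_le.1 htA).le
        exact ENNReal.toReal_le_of_le_ofReal hA (hs n)
      rw [this]
      simp
  refine (setLIntegral_mono' measurableSet_Ioi h4).trans (le_of_eq ?_)
  rw [lintegral_indicator measurableSet_Iic, Measure.restrict_restrict measurableSet_Iic,
    show Iic A ∩ Ioi (0 : ℝ) = Ioc 0 A by ext; simp [and_comm],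
    ← ofReal_integral_eq_lintegral_ofReal]
  · rw [← intervalIntegral.integral_of_le hA, intervalIntegral.integral_const_mul,
      integral_rpow (.inl (by linarith)), show r - 5 + 1 = r - 4 by ring,
      Real.zero_rpow (by linarith), sub_zero]
  · have := (intervalIntegral.intervalIntegrable_rpow' (a := 0) (b := A) (r := r - 5)
      (by linarith)).const_mul D
    rwa [intervalIntegrable_iff_integrableOn_Ioc_of_le hA] at this
  · filter_upwards [ae_restrict_mem measurableSet_Ioc] with t ht
    have := ht.1
    positivity

/-- The largest value of `|e^{itb(D)} χ(D) f|` over a unit time interval, where `f̂ = F`. -/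
def packetSup (b : ℝ → ℝ) (χ F : ℝ → ℂ) (n : ℕ) : ℝ≥0∞ :=
  ⨆ (t : ℝ) (_ : t ∈ Icc (n : ℝ) (n + 1)) (x : ℝ),
    ‖fourierExtension (propagate b t fun ξ => χ ξ * F ξ) x‖ₑ

section packetSup

variable {b : ℝ → ℝ} {χ F : ℝ → ℂ}

theorem enorm_le_packetSup {n : ℕ} {t : ℝ} (ht : t ∈ Icc (n : ℝ) (n + 1)) (x : ℝ) :
    ‖fourierExtension (propagate b t fun ξ => χ ξ * F ξ) x‖ₑ ≤ packetSup b χ F n :=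
  le_iSup₂_of_le t ht (le_iSup_of_le x le_rfl)

theorem packetSup_le (hχ : ContDiff ℝ ∞ χ) (hs : HasCompactSupport χ) (mF : MemLp F 2) (n : ℕ) :
    packetSup b χ F n ≤ ENNReal.ofReal (l2norm χ * l2norm F) := by
  refine iSup₂_le fun t _ => iSup_le fun x => ?_
  rw [← ofReal_norm]
  refine ENNReal.ofReal_le_ofReal ((norm_integral_le_integral_norm _).trans ?_)
  refine le_trans (le_of_eq ?_) (integral_norm_cutoff_mul_le hχ hs mF)
  refine integral_congr_ae (.of_forall fun ξ => ?_)
  simp only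
  rw [norm_mul, norm_exp_I_mul_mul, one_mul, norm_propagate]

/-- Strichartz estimate, away from the endpoint, for the localized linear evolution. -/
theorem exists_tsum_packetSup_rpow_le (hb : ContDiff ℝ ∞ b)
    (hb2 : BoundedAwayFromZero (iteratedDeriv 2 b)) (hχ : ContDiff ℝ ∞ χ)
    (hs : HasCompactSupport χ) {r : ℝ} (hr : 4 < r) : ∃ C : ℝ, 0 ≤ C ∧ ∀ F : ℝ → ℂ, MemLp F 2 →
      ∑' n, packetSup b χ F n ^ r ≤ ENNReal.ofReal (C * l2norm F ^ r) := by
  obtain ⟨C, hC, h⟩ := exists_card_le_of_lt_norm hb hb2 hχ hs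
  have hχ0 : 0 ≤ l2norm χ := l2norm_nonneg
  have hr4 : 0 < r - 4 := by linarith
  refine ⟨r * (C * (l2norm χ ^ (r - 4) / (r - 4))), by positivity, fun F mF => ?_⟩
  have hF0 : 0 ≤ l2norm F := l2norm_nonneg
  refine (tsum_rpow_le_of_card_le (A := l2norm χ * l2norm F) (D := C * l2norm F ^ 4)
    (by positivity) (by positivity) hr (packetSup_le hχ hs mF) fun S l hl hS => ?_).trans
    (le_of_eq ?_)
  -- The suprema need not be attained, but the strict inequality supplies a sampling point above the
  -- level in every interval of `S`.
  · have hex : ∀ n, ∃ tx : ℝ × ℝ, n ∈ S → tx.1 ∈ Icc (n : ℝ) (n + 1) ∧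
        l ≤ ‖fourierExtension (propagate b tx.1 fun ξ => χ ξ * F ξ) tx.2‖ := by
      intro n
      by_cases hn : n ∈ S
      · have := hS n hn
        simp only [packetSup, lt_iSup_iff] at this
        obtain ⟨t, ht, x, hx⟩ := this
        refine ⟨(t, x), fun _ => ⟨ht, ?_⟩⟩
        rw [← ofReal_norm] at hx
        exact (ENNReal.ofReal_lt_ofReal_iff'.1 hx).1.le
      · exact ⟨0, fun h => absurd h hn⟩
    choose tx htx using hex
    exact h F mF S (fun n => (tx n).1) (fun n => (tx n).2) l hl htx
  · congr 1
    rw [Real.mul_rpow hχ0 hF0]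
    have : l2norm F ^ r = l2norm F ^ 4 * l2norm F ^ (r - 4) := by
      rw [← Real.rpow_natCast, ← Real.rpow_add_of_nonneg hF0 (by positivity) hr4.le]
      congr 1
      push_cast
      ring
    rw [this]
    ring

end packetSup

/-! ### Normal form and global space-time bounds -/

theorem tsum_mul_rpow_le (s s' : ℕ → ℝ≥0∞) {r : ℝ} (hr : 0 ≤ r) :
    ∑' n, (s n * s' n) ^ r ≤
      (∑' n, s n ^ (2 * r)) ^ (1 / 2 : ℝ) * (∑' n, s' n ^ (2 * r)) ^ (1 / 2 : ℝ) := by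
  have := ENNReal.lintegral_mul_le_Lp_mul_Lq (Measure.count : Measure ℕ)
    Real.HolderConjugate.two_two (f := fun n => s n ^ r) (g := fun n => s' n ^ r)
    (measurable_of_countable _).aemeasurable (measurable_of_countable _).aemeasurable
  simp only [lintegral_count, Pi.mul_apply, ← ENNReal.rpow_mul] at this
  simp_rw [ENNReal.mul_rpow_of_nonneg _ _ hr, mul_comm 2 r]
  exact this

theorem setLIntegral_Ioi_floor_le (φ : ℕ → ℝ≥0∞) :
    ∫⁻ t in Ioi (0 : ℝ), φ ⌊t⌋₊ ≤ ∑' n, φ n := by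
  have hsub : Ioi (0 : ℝ) ⊆ ⋃ n : ℕ, Ico (n : ℝ) (n + 1) := fun t ht =>
    mem_iUnion.2 ⟨⌊t⌋₊, Nat.floor_le (le_of_lt ht), Nat.lt_floor_add_one t⟩
  calc ∫⁻ t in Ioi (0 : ℝ), φ ⌊t⌋₊ ≤ ∫⁻ t in ⋃ n : ℕ, Ico (n : ℝ) (n + 1), φ ⌊t⌋₊ :=
        lintegral_mono_set hsub
    _ ≤ ∑' n : ℕ, ∫⁻ t in Ico (n : ℝ) (n + 1), φ ⌊t⌋₊ := lintegral_iUnion_le _ _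
    _ = ∑' n, φ n := by
        refine tsum_congr fun n => ?_
        rw [setLIntegral_congr_fun (g := fun _ => φ n) measurableSet_Ico fun t ht => by
          simp only
          rw [(Nat.floor_eq_iff (n.cast_nonneg.trans ht.1)).2 ⟨ht.1, ht.2⟩]]
        simp

/-- The tail is `t^{-r/2}`, integrable exactly when `r > 2`; near zero the minimum with one removes
the singularity. -/
theorem setLIntegral_min_rpow_lt_top {r : ℝ} (hr : 2 < r) :
    ∫⁻ t in Ioi (0 : ℝ), ENNReal.ofReal (min 1 (1 / √t)) ^ r < ⊤ := by
  rw [← Ioc_union_Ioi_eq_Ioi zero_le_one]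
  refine (lintegral_union_le _ _ _).trans_lt (ENNReal.add_lt_top.2 ⟨?_, ?_⟩)
  · calc ∫⁻ t in Ioc (0 : ℝ) 1, ENNReal.ofReal (min 1 (1 / √t)) ^ r
        ≤ ∫⁻ t in Ioc (0 : ℝ) 1, 1 := by
          refine lintegral_mono fun t => ?_
          refine ENNReal.rpow_le_one ?_ (by linarith)
          rw [← ENNReal.ofReal_one]
          exact ENNReal.ofReal_le_ofReal (min_le_left _ _)
      _ < ⊤ := by simp
  · have hint := integrableOn_Ioi_rpow_of_lt (a := -(r / 2)) (by linarith) one_pos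
    refine lt_of_le_of_lt ?_ hint.lintegral_lt_top
    refine setLIntegral_mono' measurableSet_Ioi fun t ht => ?_
    have ht0 : 0 < t := one_pos.trans ht
    rw [ENNReal.ofReal_rpow_of_nonneg (by positivity) (by linarith)]
    refine ENNReal.ofReal_le_ofReal ?_
    calc min 1 (1 / √t) ^ r ≤ (1 / √t) ^ r :=
          Real.rpow_le_rpow (by positivity) (min_le_right _ _) (by linarith)
      _ = t ^ (-(r / 2)) := by
          rw [Real.sqrt_eq_rpow, one_div, ← Real.rpow_neg ht0.le, ← Real.rpow_mul ht0.le]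
          congr 1
          ring

theorem eLpNorm_rpow_le_of_le {h : ℝ → ℂ} {A B : ℝ} (hA : 0 ≤ A) (hB : 0 ≤ B)
    (hbd : ∀ x, ‖h x‖ ≤ A) (hi : MemLp h 2) (h2 : ∫ x, ‖h x‖ ^ 2 ≤ B ^ 2) {p q : ℝ}
    (hp : 0 ≤ p) (hq : 2 ≤ q) :
    eLpNorm h (ENNReal.ofReal q) volume ^ p ≤
      ENNReal.ofReal B ^ (2 * p / q) * ENNReal.ofReal A ^ (p * (1 - 2 / q)) := by
  have hq0 : 0 < q := by linarith
  have hq2 : (2 : ℝ≥0∞) ≤ ENNReal.ofReal q := by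
    rw [← ENNReal.ofReal_ofNat 2]
    exact ENNReal.ofReal_le_ofReal hq
  have hle : 0 ≤ 1 - 2 * q⁻¹ := by
    rw [← div_eq_mul_inv, sub_nonneg, div_le_one hq0]
    exact hq
  have := eLpNorm_le_of_le hA hB (.of_forall hbd) hi h2 hq2
  rw [ENNReal.toReal_inv, ENNReal.toReal_ofReal hq0.le] at this
  refine (ENNReal.rpow_le_rpow this hp).trans (le_of_eq ?_)
  rw [ENNReal.ofReal_mul (by positivity), ← ENNReal.ofReal_rpow_of_nonneg hB (by positivity),
    ← ENNReal.ofReal_rpow_of_nonneg hA hle, ENNReal.mul_rpow_of_nonneg _ _ hp,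
    ← ENNReal.rpow_mul, ← ENNReal.rpow_mul]
  congr 2 <;> ring

section normalForm

variable {a b c : ℝ → ℝ} {m : ℝ × ℝ → ℂ}

/-- On the closed support the denominator is nonzero, and off it the quotient vanishes in a
neighbourhood. Nonvanishing merely where `m ≠ 0` would not control boundary points of the support.
-/
theorem contDiff_div_phase (ha : ContDiff ℝ ∞ a) (hb : ContDiff ℝ ∞ b) (hc : ContDiff ℝ ∞ c)
    (hm : ContDiff ℝ ∞ m) (hres : timeResonances a b c m = ∅) :
    ContDiff ℝ ∞ fun p => m p / (phase a b c p : ℂ) := by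
  have hφ : ContDiff ℝ ∞ fun p => (phase a b c p : ℂ) := by
    refine Complex.ofRealCLM.contDiff.comp ?_
    exact ((ha.comp (contDiff_fst.add contDiff_snd)).neg.add (hb.comp contDiff_fst)).add
      (hc.comp contDiff_snd)
  rw [contDiff_iff_contDiffAt]
  intro p
  by_cases hp : p ∈ tsupport m
  · have hne : (phase a b c p : ℂ) ≠ 0 := by
      intro h0
      have : p ∈ timeResonances a b c m := ⟨hp, by exact_mod_cast h0⟩
      rw [hres] at this
      exact this
    simp only [div_eq_mul_inv]
    exact hm.contDiffAt.mul (hφ.contDiffAt.inv hne)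
  · have h0 : m =ᶠ[nhds p] 0 := notMem_tsupport_iff_eventuallyEq.1 hp
    refine (contDiffAt_const (c := (0 : ℂ))).congr_of_eventuallyEq ?_
    filter_upwards [h0] with y hy
    simp [hy]

/-- The normal form of the Duhamel symbol off the time resonances. -/
theorem mul_duhamelSymbol_eq (hres : timeResonances a b c m = ∅) (t : ℝ) (p : ℝ × ℝ) :
    m p * duhamelSymbol a b c t p =
      m p / (phase a b c p : ℂ) * Complex.exp (Complex.I * t * a (p.1 + p.2)) -
      m p / (phase a b c p : ℂ) * Complex.exp (Complex.I * (t * (b p.1 + c p.2) : ℝ)) := by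
  by_cases hp : m p = 0
  · simp [hp]
  have hne : (phase a b c p : ℂ) ≠ 0 := by
    intro h0
    have : p ∈ timeResonances a b c m := ⟨subset_tsupport m hp, by exact_mod_cast h0⟩
    rw [hres] at this
    exact this
  have hI : ∫ s in (0 : ℝ)..t, Complex.exp (Complex.I * s * phase a b c p) =
      (Complex.exp (Complex.I * t * phase a b c p) - 1) / (Complex.I * phase a b c p) := by
    have := integral_exp_mul_complex (a := 0) (b := t) (c := Complex.I * phase a b c p)
      (mul_ne_zero Complex.I_ne_zero hne)
    simp only [Complex.ofReal_zero, mul_zero, Complex.exp_zero] at this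
    simp_rw [mul_right_comm Complex.I (_ : ℂ) (phase a b c p : ℂ)]
    exact this
  have e : Complex.exp (Complex.I * (t * (b p.1 + c p.2) : ℝ)) =
      Complex.exp (Complex.I * t * a (p.1 + p.2)) * Complex.exp (Complex.I * t * phase a b c p) := by
    rw [← Complex.exp_add, phase]
    congr 1
    push_cast
    ring
  rw [duhamelSymbol_eq, hI, e]
  field_simp
  ring

theorem bilinearExtension_sub {μ ν : ℝ × ℝ → ℂ} {F G : ℝ → ℂ} {B B' : ℝ} (hF : Integrable F)
    (hG : Integrable G) (hμ : Continuous μ) (hB : ∀ p, ‖μ p‖ ≤ B) (hν : Continuous ν)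
    (hB' : ∀ p, ‖ν p‖ ≤ B') :
    bilinearExtension (fun p => μ p - ν p) F G =
      bilinearExtension μ F G - bilinearExtension ν F G := by
  funext x
  have h : ∀ {κ : ℝ × ℝ → ℂ} {A : ℝ}, Continuous κ → (∀ p, ‖κ p‖ ≤ A) → Integrable
      fun p : ℝ × ℝ => Complex.exp (Complex.I * x * (p.1 + p.2)) * F p.1 * G p.2 * κ p := by
    intro κ A hκ hA
    refine ((integrable_mul_mul_symbol hF hG hκ hA).bdd_mul (c := 1) (f := fun p : ℝ × ℝ =>
      Complex.exp (Complex.I * x * (p.1 + p.2))) (Continuous.aestronglyMeasurable (by fun_prop))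
      (.of_forall fun p => ?_)).congr (.of_forall fun p => ?_)
    · rw [← Complex.ofReal_add, norm_exp_I_mul_mul]
    · simp only
      ring
  rw [Pi.sub_apply, bilinearExtension, bilinearExtension, bilinearExtension,
    ← integral_sub (h hμ hB) (h hν hB')]
  refine integral_congr_ae (.of_forall fun p => ?_)
  simp only
  ring

/-- Only the supremum of the symbol enters, so the bound is uniform in time for both oscillating
symbols of the normal form. -/
theorem integral_norm_sq_bilinearExtension_le {μ : ℝ × ℝ → ℂ} {B : ℝ} (hμ : Continuous μ)
    (hB : ∀ p, ‖μ p‖ ≤ B) {χ F G : ℝ → ℂ} (hχ : ContDiff ℝ ∞ χ) (hs : HasCompactSupport χ)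
    (h1 : ∀ ξ, ‖χ ξ‖ ≤ 1) (mF : MemLp F 2) (mG : MemLp G 2) :
    MemLp (bilinearExtension μ (fun ξ => χ ξ * F ξ) fun ξ => χ ξ * G ξ) 2 ∧
      ∫ x, ‖bilinearExtension μ (fun ξ => χ ξ * F ξ) (fun ξ => χ ξ * G ξ) x‖ ^ 2 ≤
        (√(2 * Real.pi) * B * l2norm χ * (l2norm F * l2norm G)) ^ 2 := by
  have iF := integrable_cutoff_mul hχ hs mF
  have iG := integrable_cutoff_mul hχ hs mG
  have mF' := memLp_cutoff_mul hχ h1 mF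
  have mG' := memLp_cutoff_mul hχ h1 mG
  have iR := integrable_twistedConvolution iF iG hμ hB
  have mR := memLp_twistedConvolution iF mF' iG mG' hμ hB
  rw [← fourierExtension_twistedConvolution iF iG hμ hB]
  refine ⟨memLp_fourierExtension iR mR, ?_⟩
  rw [integral_norm_sq_fourierExtension iR mR]
  have hF0 : 0 ≤ l2norm F := l2norm_nonneg
  have hG0 : 0 ≤ l2norm G := l2norm_nonneg
  have hχ0 : 0 ≤ l2norm χ := l2norm_nonneg
  calc _ ≤ 2 * Real.pi * (B ^ 2 * (l2norm (fun ξ => χ ξ * F ξ) * l2norm (fun ξ => χ ξ * G ξ)) *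
        ((∫ ξ, ‖χ ξ * F ξ‖) * ∫ ξ, ‖χ ξ * G ξ‖)) :=
        mul_le_mul_of_nonneg_left (integral_norm_sq_twistedConvolution_le iF mF' iG mG' hμ hB)
          Real.two_pi_pos.le
    _ ≤ 2 * Real.pi * (B ^ 2 * (l2norm F * l2norm G) *
        ((l2norm χ * l2norm F) * (l2norm χ * l2norm G))) := by
        have e1 := l2norm_cutoff_mul_le h1 mF
        have e2 := l2norm_cutoff_mul_le h1 mG
        have e3 := integral_norm_cutoff_mul_le hχ hs mF
        have e4 := integral_norm_cutoff_mul_le hχ hs mG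
        have e5 : 0 ≤ l2norm (fun ξ => χ ξ * G ξ) := l2norm_nonneg
        gcongr
    _ = √(2 * Real.pi) ^ 2 * (B * l2norm χ * (l2norm F * l2norm G)) ^ 2 := by
        rw [Real.sq_sqrt (by positivity)]; ring
    _ = _ := by ring

/-- Space-time bound for the boundary term at time zero of the normal form. -/
theorem exists_lintegral_freeTerm_le (ha : ContDiff ℝ ∞ a)
    (ha2 : BoundedAwayFromZero (iteratedDeriv 2 a)) (hm : ContDiff ℝ ∞ m)
    (hs : HasCompactSupport m) {χ : ℝ → ℂ} (hχ : ContDiff ℝ ∞ χ) (hχs : HasCompactSupport χ)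
    (hχ1 : ∀ ξ, ‖χ ξ‖ ≤ 1) {p q : ℝ} (hp : 0 ≤ p) (hq : 2 ≤ q) (hpq : 2 < p * (1 - 2 / q)) :
    ∃ C : ℝ≥0∞, C ≠ ⊤ ∧ ∀ F G : ℝ → ℂ, MemLp F 2 → MemLp G 2 → ∃ E : ℝ → ℝ≥0∞, Measurable E ∧
      (∀ t : ℝ, 0 < t → eLpNorm (bilinearExtension (fun p => m p *
        Complex.exp (Complex.I * t * a (p.1 + p.2))) (fun ξ => χ ξ * F ξ) fun ξ => χ ξ * G ξ)
          (ENNReal.ofReal q) volume ^ p ≤ E t) ∧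
      ∫⁻ t in Ioi (0 : ℝ), E t ≤ C * ENNReal.ofReal (l2norm F * l2norm G) ^ p := by
  obtain ⟨C₁, hC₁, h1⟩ := exists_norm_bilinearExtension_exp_le ha ha2 hm hs
  obtain ⟨B, hB⟩ := hs.exists_bound_of_continuous hm.continuous
  have hB0 : 0 ≤ B := (norm_nonneg _).trans (hB 0)
  have hχ0 : 0 ≤ l2norm χ := l2norm_nonneg
  set K : ℝ := max C₁ (B * l2norm χ ^ 2) with hK
  have hK0 : 0 ≤ K := hC₁.trans (le_max_left _ _)
  set D : ℝ := √(2 * Real.pi) * B * l2norm χ with hD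
  have hD0 : 0 ≤ D := by positivity
  set r := p * (1 - 2 / q) with hr
  have hr0 : 0 ≤ r := by linarith
  have hpq0 : 0 ≤ 2 * p / q := by positivity
  refine ⟨ENNReal.ofReal D ^ (2 * p / q) * ENNReal.ofReal K ^ r *
    ∫⁻ t in Ioi (0 : ℝ), ENNReal.ofReal (min 1 (1 / √t)) ^ r, ?_, fun F G mF mG => ?_⟩
  · refine ENNReal.mul_ne_top (ENNReal.mul_ne_top ?_ ?_) (setLIntegral_min_rpow_lt_top hpq).ne
    · exact ENNReal.rpow_ne_top_of_nonneg hpq0 ENNReal.ofReal_ne_top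
    · exact ENNReal.rpow_ne_top_of_nonneg hr0 ENNReal.ofReal_ne_top
  have hF0 : 0 ≤ l2norm F := l2norm_nonneg
  have hG0 : 0 ≤ l2norm G := l2norm_nonneg
  set N := l2norm F * l2norm G with hN
  have hN0 : 0 ≤ N := by positivity
  have iF := integrable_cutoff_mul hχ hχs mF
  have iG := integrable_cutoff_mul hχ hχs mG
  have mF' := memLp_cutoff_mul hχ hχ1 mF
  have mG' := memLp_cutoff_mul hχ hχ1 mG
  -- An explicit measurable majorant in time, so that measurability of the spatial norm itself never
  -- has to be discussed.
  refine ⟨fun t => ENNReal.ofReal (D * N) ^ (2 * p / q) *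
    ENNReal.ofReal (K * N * min 1 (1 / √t)) ^ r, by fun_prop, fun t ht => ?_, ?_⟩
  · have cE : Continuous fun p : ℝ × ℝ => m p * Complex.exp (Complex.I * t * a (p.1 + p.2)) := by
      fun_prop
    have bE : ∀ p : ℝ × ℝ, ‖m p * Complex.exp (Complex.I * t * a (p.1 + p.2))‖ ≤ B := fun p => by
      rw [norm_mul, norm_exp_I_mul_mul, mul_one]; exact hB p
    obtain ⟨h3, h4⟩ := integral_norm_sq_bilinearExtension_le cE bE hχ hχs hχ1 mF mG
    refine eLpNorm_rpow_le_of_le (by positivity) (by positivity) (fun x => ?_) h3 h4 hp hq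
    rw [mul_min_of_nonneg _ _ (by positivity), mul_one]
    refine le_min ?_ ?_
    · have e3 := integral_norm_cutoff_mul_le hχ hχs mF
      have e4 := integral_norm_cutoff_mul_le hχ hχs mG
      rw [← fourierExtension_twistedConvolution iF iG cE bE]
      calc _ ≤ ∫ ζ, ‖twistedConvolution (fun p : ℝ × ℝ => m p *
            Complex.exp (Complex.I * t * a (p.1 + p.2))) (fun ξ => χ ξ * F ξ)
              (fun ξ => χ ξ * G ξ) ζ‖ := by
            refine (norm_integral_le_integral_norm _).trans (le_of_eq ?_)
            simp only [norm_mul, norm_exp_I_mul_mul, one_mul]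
        _ ≤ B * ((∫ ξ, ‖χ ξ * F ξ‖) * ∫ ξ, ‖χ ξ * G ξ‖) :=
            integral_norm_twistedConvolution_le iF iG cE bE
        _ ≤ B * ((l2norm χ * l2norm F) * (l2norm χ * l2norm G)) := by gcongr
        _ = (B * l2norm χ ^ 2) * N := by ring
        _ ≤ K * N := by
            gcongr
            exact le_max_right _ _
    · refine (h1 _ _ iF mF' iG mG' x t ht.ne').trans ?_
      rw [abs_of_pos ht, div_eq_mul_one_div]
      have e1 := l2norm_cutoff_mul_le hχ1 mF
      have e2 := l2norm_cutoff_mul_le hχ1 mG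
      have e5 : 0 ≤ l2norm (fun ξ => χ ξ * G ξ) := l2norm_nonneg
      have e6 : C₁ ≤ K := le_max_left _ _
      have e7 : l2norm (fun ξ => χ ξ * F ξ) * l2norm (fun ξ => χ ξ * G ξ) ≤ N :=
        mul_le_mul e1 e2 e5 hF0
      have e8 : 0 ≤ l2norm (fun ξ => χ ξ * F ξ) := l2norm_nonneg
      calc _ ≤ K * (1 / √t) * N := by
            refine mul_le_mul (mul_le_mul_of_nonneg_right e6 (by positivity)) e7 (by positivity)
              (by positivity)
        _ = _ := by ring
  · have e : ∀ t : ℝ, ENNReal.ofReal (D * N) ^ (2 * p / q) *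
        ENNReal.ofReal (K * N * min 1 (1 / √t)) ^ r =
        (ENNReal.ofReal D ^ (2 * p / q) * ENNReal.ofReal K ^ r * ENNReal.ofReal N ^ p) *
          ENNReal.ofReal (min 1 (1 / √t)) ^ r := by
      intro t
      -- Homogeneity: `2p/q + r = p`, so the energy and sup bounds together carry the right power of
      -- the data.
      have hsplit : ENNReal.ofReal N ^ p =
          ENNReal.ofReal N ^ (2 * p / q) * ENNReal.ofReal N ^ r := by
        rw [← ENNReal.rpow_add_of_nonneg _ _ hpq0 hr0]
        congr 1
        rw [hr]
        ring
      rw [hsplit, ENNReal.ofReal_mul hD0, ENNReal.ofReal_mul (mul_nonneg hK0 hN0),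
        ENNReal.ofReal_mul hK0, ENNReal.mul_rpow_of_nonneg _ _ hpq0,
        ENNReal.mul_rpow_of_nonneg _ _ hr0, ENNReal.mul_rpow_of_nonneg _ _ hr0]
      ring
    simp_rw [e]
    rw [lintegral_const_mul _ (by fun_prop)]
    exact le_of_eq (by ring)

/-- Space-time bound for the bilinear multiplier applied to two free evolutions. -/
theorem exists_lintegral_boundaryTerm_le (hb : ContDiff ℝ ∞ b)
    (hb2 : BoundedAwayFromZero (iteratedDeriv 2 b)) (hc : ContDiff ℝ ∞ c)
    (hc2 : BoundedAwayFromZero (iteratedDeriv 2 c)) (hm : ContDiff ℝ ∞ m)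
    (hs : HasCompactSupport m) {χ : ℝ → ℂ} (hχ : ContDiff ℝ ∞ χ) (hχs : HasCompactSupport χ)
    (hχ1 : ∀ ξ, ‖χ ξ‖ ≤ 1) {p q : ℝ} (hp : 0 ≤ p) (hq : 2 ≤ q) (hpq : 2 < p * (1 - 2 / q)) :
    ∃ C : ℝ≥0∞, C ≠ ⊤ ∧ ∀ F G : ℝ → ℂ, MemLp F 2 → MemLp G 2 → ∃ E : ℝ → ℝ≥0∞, Measurable E ∧
      (∀ t : ℝ, 0 < t → eLpNorm (bilinearExtension (fun p => m p *
        Complex.exp (Complex.I * (t * (b p.1 + c p.2) : ℝ))) (fun ξ => χ ξ * F ξ)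
          fun ξ => χ ξ * G ξ) (ENNReal.ofReal q) volume ^ p ≤ E t) ∧
      ∫⁻ t in Ioi (0 : ℝ), E t ≤ C * ENNReal.ofReal (l2norm F * l2norm G) ^ p := by
  obtain ⟨M, y, z, hM, hy, hz, hMm⟩ := exists_superposition hm hs
  obtain ⟨B, hB⟩ := hs.exists_bound_of_continuous hm.continuous
  have cb := hb.continuous
  have cc := hc.continuous
  have hB0 : 0 ≤ B := (norm_nonneg _).trans (hB 0)
  have hχ0 : 0 ≤ l2norm χ := l2norm_nonneg
  set r := p * (1 - 2 / q) with hr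
  have hr0 : 0 ≤ r := by linarith
  have hpq0 : 0 ≤ 2 * p / q := by positivity
  -- Cauchy-Schwarz in time puts each free wave at the exponent `2r`, and `r > 2` is just the
  -- nonendpoint condition `2r > 4`.
  obtain ⟨Cb, hCb, h1⟩ := exists_tsum_packetSup_rpow_le hb hb2 hχ hχs (r := 2 * r) (by linarith)
  obtain ⟨Cc, hCc, h2⟩ := exists_tsum_packetSup_rpow_le hc hc2 hχ hχs (r := 2 * r) (by linarith)
  set K : ℝ := ∫ q, ‖M q‖ with hK
  have hK0 : 0 ≤ K := integral_nonneg fun _ => norm_nonneg _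
  set D : ℝ := √(2 * Real.pi) * B * l2norm χ with hD
  have hD0 : 0 ≤ D := by positivity
  refine ⟨ENNReal.ofReal D ^ (2 * p / q) * ENNReal.ofReal K ^ r *
    (ENNReal.ofReal Cb ^ (1 / 2 : ℝ) * ENNReal.ofReal Cc ^ (1 / 2 : ℝ)), ?_, fun F G mF mG => ?_⟩
  · refine ENNReal.mul_ne_top (ENNReal.mul_ne_top ?_ ?_) (ENNReal.mul_ne_top ?_ ?_) <;>
    exact ENNReal.rpow_ne_top_of_nonneg (by positivity) ENNReal.ofReal_ne_top
  have hF0 : 0 ≤ l2norm F := l2norm_nonneg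
  have hG0 : 0 ≤ l2norm G := l2norm_nonneg
  set N := l2norm F * l2norm G with hN
  have iF := integrable_cutoff_mul hχ hχs mF
  have iG := integrable_cutoff_mul hχ hχs mG
  set φ : ℕ → ℝ≥0∞ := fun n => ENNReal.ofReal (D * N) ^ (2 * p / q) *
    (ENNReal.ofReal K ^ r * (packetSup b χ F n * packetSup c χ G n) ^ r) with hφ
  refine ⟨fun t => φ ⌊t⌋₊, (measurable_of_countable φ).comp Nat.measurable_floor,
    fun t ht => ?_, ?_⟩
  · have htn : t ∈ Icc (⌊t⌋₊ : ℝ) (⌊t⌋₊ + 1) :=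
      ⟨Nat.floor_le ht.le, (Nat.lt_floor_add_one t).le⟩
    set n := ⌊t⌋₊ with hn
    have cE : Continuous fun p : ℝ × ℝ =>
        m p * Complex.exp (Complex.I * (t * (b p.1 + c p.2) : ℝ)) := by fun_prop
    have bE : ∀ p : ℝ × ℝ, ‖m p * Complex.exp (Complex.I * (t * (b p.1 + c p.2) : ℝ))‖ ≤ B :=
      fun p => by
        rw [norm_mul, mul_comm Complex.I, Complex.norm_exp_ofReal_mul_I, mul_one]; exact hB p
    obtain ⟨h3, h4⟩ := integral_norm_sq_bilinearExtension_le cE bE hχ hχs hχ1 mF mG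
    have hbt : packetSup b χ F n ≠ ⊤ :=
      ((packetSup_le hχ hχs mF n).trans_lt ENNReal.ofReal_lt_top).ne
    have hct : packetSup c χ G n ≠ ⊤ :=
      ((packetSup_le hχ hχs mG n).trans_lt ENNReal.ofReal_lt_top).ne
    have hsup := norm_bilinearExtension_le hM hy hz hMm
      (integrable_propagate (t := t) cb iF) (integrable_propagate (t := t) cc iG)
      (A := (packetSup b χ F n).toReal) (A' := (packetSup c χ G n).toReal)
      (fun x => by
        rw [← ENNReal.ofReal_le_iff_le_toReal hbt, ofReal_norm]
        exact enorm_le_packetSup htn x)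
      (fun x => by
        rw [← ENNReal.ofReal_le_iff_le_toReal hct, ofReal_norm]
        exact enorm_le_packetSup htn x)
    rw [bilinearExtension_propagate] at hsup
    refine (eLpNorm_rpow_le_of_le (by positivity) (by positivity) hsup h3 h4 hp hq).trans
      (le_of_eq ?_)
    simp only [hφ]
    rw [ENNReal.ofReal_mul hK0, ENNReal.ofReal_mul ENNReal.toReal_nonneg,
      ENNReal.ofReal_toReal hbt, ENNReal.ofReal_toReal hct, ENNReal.mul_rpow_of_nonneg _ _ hr0]
  · refine (setLIntegral_Ioi_floor_le φ).trans ?_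
    simp only [hφ]
    rw [ENNReal.tsum_mul_left, ENNReal.tsum_mul_left]
    have hroot : ∀ (C x : ℝ), 0 ≤ C → 0 ≤ x → ENNReal.ofReal (C * x ^ (2 * r)) ^ (1 / 2 : ℝ) =
        ENNReal.ofReal C ^ (1 / 2 : ℝ) * ENNReal.ofReal x ^ r := by
      intro C x hC hx
      rw [ENNReal.ofReal_mul hC, ← ENNReal.ofReal_rpow_of_nonneg hx (by positivity),
        ENNReal.mul_rpow_of_nonneg _ _ (by norm_num), ← ENNReal.rpow_mul]
      congr 2
      ring
    have h5 : ∑' n, (packetSup b χ F n * packetSup c χ G n) ^ r ≤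
        (ENNReal.ofReal Cb ^ (1 / 2 : ℝ) * ENNReal.ofReal Cc ^ (1 / 2 : ℝ)) *
          ENNReal.ofReal N ^ r := by
      refine (tsum_mul_rpow_le _ _ hr0).trans ?_
      refine (mul_le_mul' (ENNReal.rpow_le_rpow (h1 F mF) (by norm_num))
        (ENNReal.rpow_le_rpow (h2 G mG) (by norm_num))).trans (le_of_eq ?_)
      rw [hroot Cb _ hCb hF0, hroot Cc _ hCc hG0, hN, ENNReal.ofReal_mul hF0,
        ENNReal.mul_rpow_of_nonneg _ _ hr0]
      ring
    have hsplit : ENNReal.ofReal N ^ p =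
        ENNReal.ofReal N ^ (2 * p / q) * ENNReal.ofReal N ^ r := by
      rw [← ENNReal.rpow_add_of_nonneg _ _ hpq0 hr0]
      congr 1
      rw [hr]
      ring
    rw [ENNReal.ofReal_mul hD0, ENNReal.mul_rpow_of_nonneg _ _ hpq0, hsplit]
    calc _ ≤ ENNReal.ofReal D ^ (2 * p / q) * ENNReal.ofReal N ^ (2 * p / q) *
          (ENNReal.ofReal K ^ r * ((ENNReal.ofReal Cb ^ (1 / 2 : ℝ) *
            ENNReal.ofReal Cc ^ (1 / 2 : ℝ)) * ENNReal.ofReal N ^ r)) := by gcongr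
      _ = _ := by ring

/-- Global space-time bound for the solution in the absence of time resonances. -/
theorem exists_mixedNorm_solution_le (ha : ContDiff ℝ ∞ a) (hb : ContDiff ℝ ∞ b)
    (hc : ContDiff ℝ ∞ c) (hm : ContDiff ℝ ∞ m) (hs : HasCompactSupport m)
    (ha2 : BoundedAwayFromZero (iteratedDeriv 2 a))
    (hb2 : BoundedAwayFromZero (iteratedDeriv 2 b))
    (hc2 : BoundedAwayFromZero (iteratedDeriv 2 c)) (hres : timeResonances a b c m = ∅) {p q : ℝ}
    (hp : 2 ≤ p) (hq : 2 ≤ q) (hpq : 1 / p + 1 / q < 1 / 2) :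
    ∃ C : ℝ, ∀ (f g : L2) (u v w : ℝ → L2), IsSolution a b c m f g u v w →
      mixedNorm p q u ≤ ENNReal.ofReal (C * ‖f‖ * ‖g‖) := by
  have hp0 : 0 < p := by linarith
  -- The condition on `(p, q)`, rewritten as the requirement on the exponent that interpolation
  -- leaves on the sup norm.
  have hr : 2 < p * (1 - 2 / q) := by
    have h1 : 1 / p < (1 - 2 / q) / 2 := by
      have : 2 / q = 2 * (1 / q) := by ring
      rw [this]
      linarith
    rw [div_lt_iff₀ hp0] at h1
    linarith
  have hn := contDiff_div_phase ha hb hc hm hres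
  have hns : HasCompactSupport fun p => m p / (phase a b c p : ℂ) := by
    simp only [div_eq_mul_inv]
    exact hs.mul_right
  obtain ⟨B, hB⟩ := hs.exists_bound_of_continuous hm.continuous
  obtain ⟨B', hB'⟩ := hns.exists_bound_of_continuous hn.continuous
  obtain ⟨χ, hχ, hχs, hχ1, hχm, -⟩ := exists_cutoff_symbol hs
  obtain ⟨C₁, hC₁, h1⟩ := exists_lintegral_freeTerm_le ha ha2 hn hns hχ hχs hχ1 hp0.le hq hr
  obtain ⟨C₂, hC₂, h2⟩ :=
    exists_lintegral_boundaryTerm_le hb hb2 hc hc2 hn hns hχ hχs hχ1 hp0.le hq hr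
  -- The factor `2^{p-1}` is the convexity constant in `(x + y)^p ≤ 2^{p-1}(x^p + y^p)`, applied to
  -- the two normal-form terms.
  set X : ℝ≥0∞ := (2 ^ (p - 1) * (C₁ + C₂)) ^ (1 / p) with hX
  have hXt : X ≠ ⊤ := ENNReal.rpow_ne_top_of_nonneg (by positivity)
    (ENNReal.mul_ne_top (ENNReal.rpow_ne_top_of_nonneg (by linarith) ENNReal.ofNat_ne_top)
      (ENNReal.add_ne_top.2 ⟨hC₁, hC₂⟩))
  refine ⟨X.toReal, fun f g u v w hsol => ?_⟩
  set F := fourierL2 f with hF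
  set G := fourierL2 g with hG
  have mF : MemLp F 2 := memLp_fourierL2 f
  have mG : MemLp G 2 := memLp_fourierL2 g
  obtain ⟨E₁, hE₁, h3, h4⟩ := h1 F G mF mG
  obtain ⟨E₂, hE₂, h5, h6⟩ := h2 F G mF mG
  rw [hF, hG, l2norm_fourierL2, l2norm_fourierL2] at h4 h6
  set N := ‖f‖ * ‖g‖ with hN
  have hpt : ∀ t ∈ Ioi (0 : ℝ), eLpNorm (u t) (ENNReal.ofReal q) volume ^ p ≤
      2 ^ (p - 1) * (E₁ t + E₂ t) := by
    intro t ht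
    have ht : 0 < t := ht
    have cn := hn.continuous
    have iF := integrable_cutoff_mul hχ hχs mF
    have iG := integrable_cutoff_mul hχ hχs mG
    have c1 : Continuous fun p : ℝ × ℝ => m p / (phase a b c p : ℂ) *
        Complex.exp (Complex.I * t * a (p.1 + p.2)) := cn.mul (by fun_prop)
    have c2 : Continuous fun p : ℝ × ℝ => m p / (phase a b c p : ℂ) *
        Complex.exp (Complex.I * (t * (b p.1 + c p.2) : ℝ)) := cn.mul (by fun_prop)
    have b1 : ∀ p : ℝ × ℝ, ‖m p / (phase a b c p : ℂ) *
        Complex.exp (Complex.I * t * a (p.1 + p.2))‖ ≤ B' := fun p => by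
      rw [norm_mul, norm_exp_I_mul_mul, mul_one]; exact hB' p
    have b2 : ∀ p : ℝ × ℝ, ‖m p / (phase a b c p : ℂ) *
        Complex.exp (Complex.I * (t * (b p.1 + c p.2) : ℝ))‖ ≤ B' := fun p => by
      rw [norm_mul, mul_comm Complex.I, Complex.norm_exp_ofReal_mul_I, mul_one]; exact hB' p
    rw [eLpNorm_congr_ae (hsol.eq_bilinearExtension ha hb hc hm.continuous hB hχ hχs hχ1 hχm ht.le)]
    simp_rw [mul_duhamelSymbol_eq hres]
    rw [bilinearExtension_sub iF iG c1 b1 c2 b2]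
    have hq1 : 1 ≤ ENNReal.ofReal q := by
      rw [← ENNReal.ofReal_one]
      exact ENNReal.ofReal_le_ofReal (by linarith)
    calc _ ≤ (eLpNorm _ (ENNReal.ofReal q) volume + eLpNorm _ (ENNReal.ofReal q) volume) ^ p :=
          ENNReal.rpow_le_rpow (eLpNorm_sub_le
            (integral_norm_sq_bilinearExtension_le c1 b1 hχ hχs hχ1 mF mG).1.aestronglyMeasurable
            (integral_norm_sq_bilinearExtension_le c2 b2 hχ hχs hχ1 mF mG).1.aestronglyMeasurable
            hq1) hp0.le
      _ ≤ 2 ^ (p - 1) * (_ + _) := ENNReal.rpow_add_le_mul_rpow_add_rpow _ _ (by linarith)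
      _ ≤ _ := mul_le_mul_right (add_le_add (h3 t ht) (h5 t ht)) _
  have hint : ∫⁻ t in Ioi (0 : ℝ), eLpNorm (u t) (ENNReal.ofReal q) volume ^ p ≤
      2 ^ (p - 1) * (C₁ + C₂) * ENNReal.ofReal N ^ p := by
    calc _ ≤ ∫⁻ t in Ioi (0 : ℝ), 2 ^ (p - 1) * (E₁ t + E₂ t) :=
          setLIntegral_mono' measurableSet_Ioi hpt
      _ = 2 ^ (p - 1) * ((∫⁻ t in Ioi (0 : ℝ), E₁ t) + ∫⁻ t in Ioi (0 : ℝ), E₂ t) := by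
          rw [lintegral_const_mul (f := fun t => E₁ t + E₂ t) _ (hE₁.add hE₂), lintegral_add_left hE₁]
      _ ≤ 2 ^ (p - 1) * (C₁ * ENNReal.ofReal N ^ p + C₂ * ENNReal.ofReal N ^ p) :=
          mul_le_mul_right (add_le_add h4 h6) _
      _ = _ := by ring
  rw [mixedNorm]
  refine (ENNReal.rpow_le_rpow hint (by positivity)).trans (le_of_eq ?_)
  rw [ENNReal.mul_rpow_of_nonneg _ _ (by positivity), ← ENNReal.rpow_mul, mul_one_div_cancel hp0.ne',
    ENNReal.rpow_one, mul_assoc X.toReal, ENNReal.ofReal_mul ENNReal.toReal_nonneg,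
    ENNReal.ofReal_toReal hXt]

end normalForm

end

end Dispersive

theorem theorem3p2 (a b c : ℝ → ℝ) (m : ℝ × ℝ → ℂ)
    (ha : ContDiff ℝ ∞ a) (hb : ContDiff ℝ ∞ b) (hc : ContDiff ℝ ∞ c)
    (hm : ContDiff ℝ ∞ m) (hm_supp : HasCompactSupport m)
    (ha2 : Dispersive.BoundedAwayFromZero (iteratedDeriv 2 a))
    (hb2 : Dispersive.BoundedAwayFromZero (iteratedDeriv 2 b))
    (hc2 : Dispersive.BoundedAwayFromZero (iteratedDeriv 2 c)) :
    (∃ C : ℝ, ∀ q : ℝ≥0∞, 2 ≤ q → ∀ (f g : Dispersive.L2) (u v w : ℝ → Dispersive.L2),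
      Dispersive.IsSolution a b c m f g u v w → ∀ t : ℝ, 0 ≤ t →
        eLpNorm (u t) q volume ≤
          ENNReal.ofReal (C * t ^ (1 / 2 + (q⁻¹).toReal / 2) * ‖f‖ * ‖g‖)) ∧
    (Dispersive.timeResonances a b c m = ∅ →
      ∀ p q : ℝ, 2 ≤ p → 2 ≤ q → 1 / p + 1 / q < 1 / 2 →
        ∃ C : ℝ, ∀ (f g : Dispersive.L2) (u v w : ℝ → Dispersive.L2),
          Dispersive.IsSolution a b c m f g u v w →
            Dispersive.mixedNorm p q u ≤ ENNReal.ofReal (C * ‖f‖ * ‖g‖)) :=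
  ⟨Dispersive.exists_eLpNorm_solution_le ha hb hc ha2 hm hm_supp, fun hres _ _ hp hq hpq =>
    Dispersive.exists_mixedNorm_solution_le ha hb hc hm hm_supp ha2 hb2 hc2 hres hp hq hpq⟩
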